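/- **Conventions.** A graph is an undirected multigraph with vertex set $V$ and set $E$ of oriented edges; $e$ runs from $e_-$ to $e_+$, and $\overline e\neq e$ is its reverse. The degree of $p$ is the number of $e\in E$ with $e_+=p$. A $\partial$-graph is a graph with a set $\partial V\subseteq V$ of boundary vertices; $V^\circ=V\setminus\partial V$ is the set of interior vertices. Edge weights in a field $\mathbb F$ are functions $w:E\to\mathbb F\setminus\{0\}$ with $w(\overline e)=w(e)$; $\Delta u(p)=\sum_{e_+=p}w(e)(u(e_+)-u(e_-))$ for $u:V\to\mathbb F$, and $u$ is harmonic if $\Delta u=0$ on $V^\circ$. *Connections.* A connection from $P$ to $Q$ is a collection of vertex-disjoint paths without self-intersections (trivial paths allowed), each having its starting point and no other point in $P$, and its ending point and no other point in $Q$. It is complete if it uses all vertices of $P$ and of $Q$. *Scaffolds.* Let $S\subseteq E$, $\overline S=\{\overline e:e\in S\}$, $S_\pm=\{e_\pm:e\in S\}$. A finite or infinite path (vertices and edges may repeat, the empty path is allowed) is increasing for $S$ if it contains no edge of $\overline S$ and no two consecutive edges outside $S$; it is decreasing if it is increasing for $\overline S$. $S$ is a scaffold if $S\cap\overline S=\varnothing$;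 $e\mapsto e_+$ and $e\mapsto e_-$ are injective on $S$; there is no decreasing path indexed by $\mathbb N$; and whenever there is an increasing path from $p\in V^\circ$ to $q\in V^\circ$, then $p\in S_+$ or $q\in S_-$. *IO-graphs.* A morphism $[G,i,j]:P\to Q$ of finite sets is a finite graph $G$ with injective labellings $i:P\to V$ (inputs) and $j:Q\to V$ (outputs), up to isomorphism respecting the labels. Composition glues the outputs of the first graph to the inputs of the second along their labels. A morphism is of type 1 if each component is either an isolated vertex that is both an input and an output, or a single edge joining an input that is not an output to an output that is not an input. It is of type 2 if every vertex is both an input and an output. For edge weights on $G$, $X([G,i,j])\subseteq(\mathbb F^P)^2\times(\mathbb F^Q)^2$ is the linear relation of all $((x_1,x_2),(y_1,y_2))$ for which some $u\in\mathbb F^V$ satisfies $u\circ i=x_1$, $u\circ j=y_1$ and $\Delta u=j_*y_2-i_*x_2$, where $i_*,j_*$ are extension by zero. The rank of a linear relation $T$ is $\dim\{x:\exists y,\ (x,y)\in T\}-\dim\{x:(x,0)\in T\}$. *Harmonic subgraphs.* A harmonic subgraph $H$ of $G$ is a subgraph with its own set $V^\circ(H)\subseteq V(H)\cap V^\circ$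 of interior vertices, such that every edge $e$ of $G$ with $e_+\in V^\circ(H)$ belongs to $H$; its boundary vertices are those in $V(H)\setminus V^\circ(H)$. It is nontrivial if it has more than one vertex or at least one edge. **Theorem.** Let $G$ be a finite $\partial$-graph with no self-loops, $\partial V=P\cup Q$, $|P|=|Q|=n$; if $n=0$, assume that $G$ does not have exactly one vertex. Let $[G,i,j]:P\to Q$ be the IO-graph morphism with $i,j$ the inclusions. Then the following are equivalent. (a) There is exactly one complete connection from $P$ to $Q$, and it uses all interior vertices. (b) There is a scaffold $S$ on $G$ with $V\setminus S_-=P$ and $V\setminus S_+=Q$. (c) $[G,i,j]$ is a composition of morphisms of types 1 and 2. (d) For every field $\mathbb F$ and all edge weights in $\mathbb F$, $\operatorname{rank}X([G,i,j])=2n$; and $G$ has no nontrivial harmonic subgraph with exactly one boundary vertex. (e) For every field $\mathbb F$, all edge weights in $\mathbb F$, and all $\phi\in\mathbb F^{P}$, $\psi\in\mathbb F^{P\setminus Q}$, there is a unique harmonic $u$ with $u|_P=\phi$ and $\Delta u|_{P\setminus Q}=\psi$; and every interior vertex has degree at least $2$. Moreover, for any one fixed infinite field $\mathbb F$, (a),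 (b), (c) are also equivalent to each of the conditions obtained from (d) and (e) by considering only edge weights in $\mathbb F$. -/

import Mathlib

universe u v w

open Function

namespace ElecNet

/-- A multigraph with vertex set `V` and set `E` of *oriented* edges. An edge `e` runs from `src e`
(written `e₋`) to `tgt e` (written `e₊`), and `rev e` is the same edge with the other orientation. -/
structure Multigraph (V : Type u) (E : Type v) where
  src : E → V
  tgt : E → V
  rev : E → E
  rev_rev : ∀ e, rev (rev e) = e
  rev_ne : ∀ e, rev e ≠ e
  src_rev : ∀ e, src (rev e) = tgt e

namespace Multigraph

variable {V : Type u} {E : Type v}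

theorem tgt_rev (G : Multigraph V E) (e : E) : G.tgt (G.rev e) = G.src e := by
  rw [← G.src_rev (G.rev e), G.rev_rev]

/-- The degree of `p`: the number of oriented edges `e` with `e₊ = p`. -/
noncomputable def degree (G : Multigraph V E) (p : V) : ℕ := {e : E | G.tgt e = p}.ncard

/-- `G.IsWalk p l q`: the sequence `l` of oriented edges is a path from `p` to `q`, vertices and
edges being allowed to repeat. The empty sequence is a path from `p` to `p`. -/
def IsWalk (G : Multigraph V E) : V → List E → V → Prop
  | p, [], q => p = q
  | p, e :: l, q => G.src e = p ∧ G.IsWalk (G.tgt e) l q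

end Multigraph

/-- A graph with boundary: the interior is the complement of `boundary`. -/
structure BoundaryGraph (V : Type u) (E : Type v) extends Multigraph V E where
  boundary : Set V

/-! ### Connections -/

section Connections

variable {V : Type u} {E : Type v}

/-- A path without self-intersections. -/
structure SimplePath (G : Multigraph V E) where
  start : V
  finish : V
  edges : List E
  isWalk : G.IsWalk start edges finish
  nodup : (start :: edges.map G.tgt).Nodup

/-- The vertices of a path. -/
def SimplePath.support {G : Multigraph V E} (α : SimplePath G) : List V :=
  α.start :: α.edges.map G.tgt

/-- A connection from `P` to `Q`: a collection of vertex-disjoint paths, each of which has its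
starting point and no other point in `P`, and its ending point and no other point in `Q`. -/
structure IsConnection (G : Multigraph V E) (P Q : Set V) (C : Set (SimplePath G)) : Prop where
  disjoint : ∀ α ∈ C, ∀ β ∈ C, ∀ x, x ∈ α.support → x ∈ β.support → α = β
  start_iff : ∀ α ∈ C, ∀ x ∈ α.support, x ∈ P ↔ x = α.start
  finish_iff : ∀ α ∈ C, ∀ x ∈ α.support, x ∈ Q ↔ x = α.finish

/-- A connection from `P` to `Q` that uses all the vertices of `P` and all the vertices of `Q`. -/
def IsCompleteConnection (G : Multigraph V E) (P Q : Set V) (C : Set (SimplePath G)) : Prop :=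
  IsConnection G P Q C ∧ ∀ x ∈ P ∪ Q, ∃ α ∈ C, x ∈ α.support

/-- There is exactly one complete connection from `P` to `Q`, and it uses all interior vertices. -/
def HasUniqueFullConnection (G : BoundaryGraph V E) (P Q : Set V) : Prop :=
  ∃ C : Set (SimplePath G.toMultigraph),
    IsCompleteConnection G.toMultigraph P Q C ∧
    (∀ C' : Set (SimplePath G.toMultigraph),
      IsCompleteConnection G.toMultigraph P Q C' → C' = C) ∧
    ∀ x, x ∉ G.boundary → ∃ α ∈ C, x ∈ α.support

end Connections

/-! ### Scaffolds -/

section Scaffolds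

variable {V : Type u} {E : Type v}

/-- The set of reverses of the edges in `S`. -/
def revSet (G : Multigraph V E) (S : Set E) : Set E := {e | G.rev e ∈ S}

/-- A finite sequence of edges is increasing with respect to `S` if it contains no edge whose
reverse is in `S` and no two consecutive edges outside `S`. -/
def IsIncreasing (G : Multigraph V E) (S : Set E) (l : List E) : Prop :=
  (∀ e ∈ l, e ∉ revSet G S) ∧ l.IsChain (fun e e' => e ∈ S ∨ e' ∈ S)

/-- An infinite path (indexed by `ℕ`) that is increasing with respect to `S`. -/
def IsIncreasingRay (G : Multigraph V E) (S : Set E) (r : ℕ → E) : Prop :=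
  (∀ k, G.tgt (r k) = G.src (r (k + 1))) ∧ (∀ k, r k ∉ revSet G S) ∧
    ∀ k, r k ∈ S ∨ r (k + 1) ∈ S

/-- Scaffolds; "decreasing with respect to `S`" means increasing with respect to the set of
reversed edges. -/
structure IsScaffold (G : BoundaryGraph V E) (S : Set E) : Prop where
  disjoint : S ∩ revSet G.toMultigraph S = ∅
  injOn_tgt : Set.InjOn G.tgt S
  injOn_src : Set.InjOn G.src S
  no_decreasing_ray : ¬ ∃ r : ℕ → E,
    IsIncreasingRay G.toMultigraph (revSet G.toMultigraph S) r
  alternative : ∀ p q : V, p ∉ G.boundary → q ∉ G.boundary →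
    (∃ l : List E, G.IsWalk p l q ∧ IsIncreasing G.toMultigraph S l) →
      p ∈ G.tgt '' S ∨ q ∈ G.src '' S

end Scaffolds

/-! ### Input-output graphs and elementary factorizations -/

/-- A representative of a morphism `P → Q` of input-output graphs: a finite graph with injective
labellings of its inputs by `P` and of its outputs by `Q`. -/
structure InOutGraph (P Q : Type u) where
  V : Type u
  E : Type v
  graph : Multigraph V E
  i : P → V
  j : Q → V
  i_inj : Injective i
  j_inj : Injective j
  finV : Finite V
  finE : Finite E

namespace InOutGraph

/-- Two representatives define the same morphism: a graph isomorphism compatible with labels. -/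
structure Iso {P Q : Type u} (M N : InOutGraph.{u, v} P Q) where
  onV : M.V ≃ N.V
  onE : M.E ≃ N.E
  src_comm : ∀ e, N.graph.src (onE e) = onV (M.graph.src e)
  tgt_comm : ∀ e, N.graph.tgt (onE e) = onV (M.graph.tgt e)
  rev_comm : ∀ e, N.graph.rev (onE e) = onE (M.graph.rev e)
  i_comm : ∀ p, onV (M.i p) = N.i p
  j_comm : ∀ q, onV (M.j q) = N.j q

section Comp

variable {P Q R : Type u} (M : InOutGraph.{u, v} P Q) (N : InOutGraph.{u, v} Q R)

/-- The identifications `j(q) ∼ i'(q)` on the disjoint union of the vertex sets. -/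
inductive GlueRel : M.V ⊕ N.V → M.V ⊕ N.V → Prop
  | glue (q : Q) : GlueRel (Sum.inl (M.j q)) (Sum.inr (N.i q))

/-- The vertices of the graph obtained by gluing the outputs of `M` to the inputs of `N`. -/
def GlueV : Type u := Quot (GlueRel M N)

def inLeft (x : M.V) : GlueV M N := Quot.mk _ (Sum.inl x)

def inRight (y : N.V) : GlueV M N := Quot.mk _ (Sum.inr y)

theorem inLeft_j (q : Q) : inLeft M N (M.j q) = inRight M N (N.i q) :=
  Quot.sound (GlueRel.glue q)

theorem inLeft_injective : Injective (inLeft M N) := by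
  classical
  let f : GlueV M N → M.V ⊕ N.V := Quot.lift
    (fun z => Sum.elim (fun x => Sum.inl x)
      (fun y => if h : ∃ q, N.i q = y then Sum.inl (M.j h.choose) else Sum.inr y) z)
    (by
      rintro _ _ ⟨q⟩
      have h : ∃ q', N.i q' = N.i q := ⟨q, rfl⟩
      have hq : h.choose = q := N.i_inj h.choose_spec
      simp only [Sum.elim_inl, Sum.elim_inr]
      rw [dif_pos h, hq])
  intro x y hxy
  have : f (inLeft M N x) = f (inLeft M N y) := by rw [hxy]
  exact Sum.inl_injective this

theorem inRight_injective : Injective (inRight M N) := by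
  classical
  let f : GlueV M N → M.V ⊕ N.V := Quot.lift
    (fun z => Sum.elim
      (fun x => if h : ∃ q, M.j q = x then Sum.inr (N.i h.choose) else Sum.inl x)
      (fun y => Sum.inr y) z)
    (by
      rintro _ _ ⟨q⟩
      have h : ∃ q', M.j q' = M.j q := ⟨q, rfl⟩
      have hq : h.choose = q := M.j_inj h.choose_spec
      simp only [Sum.elim_inl, Sum.elim_inr]
      rw [dif_pos h, hq])
  intro x y hxy
  have : f (inRight M N x) = f (inRight M N y) := by rw [hxy]
  exact Sum.inr_injective this

/-- The composition `N ∘ M` of `M : P → Q` and `N : Q → R`, gluing along the labels in `Q`. -/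
def comp : InOutGraph.{u, v} P R where
  V := GlueV M N
  E := M.E ⊕ N.E
  graph :=
    { src := Sum.elim (fun e => inLeft M N (M.graph.src e)) (fun e => inRight M N (N.graph.src e))
      tgt := Sum.elim (fun e => inLeft M N (M.graph.tgt e)) (fun e => inRight M N (N.graph.tgt e))
      rev := Sum.map M.graph.rev N.graph.rev
      rev_rev := by rintro (e | e) <;> simp [Multigraph.rev_rev]
      rev_ne := by rintro (e | e) <;> simp [Multigraph.rev_ne]
      src_rev := by rintro (e | e) <;> simp [Multigraph.src_rev] }
  i := fun p => inLeft M N (M.i p)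
  j := fun r => inRight M N (N.j r)
  i_inj := (inLeft_injective M N).comp M.i_inj
  j_inj := (inRight_injective M N).comp N.j_inj
  finV := by
    have := M.finV
    have := N.finV
    exact Finite.of_surjective (Quot.mk (GlueRel M N)) Quot.mk_surjective
  finE := by
    have := M.finE
    have := N.finE
    infer_instance

end Comp

/-- Type 1: every component is an isolated vertex, which is both an input and an output, or a single
edge joining an input (not an output) to an output (not an input). That the components have this
form says that every vertex has degree at most one. -/
structure IsType1 {P Q : Type u} (M : InOutGraph.{u, v} P Q) : Prop where
  degree_le_one : ∀ e e', M.graph.tgt e = M.graph.tgt e' → e = e'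
  isolated : ∀ x, (∀ e, M.graph.tgt e ≠ x) → x ∈ Set.range M.i ∧ x ∈ Set.range M.j
  edge : ∀ e,
    (M.graph.src e ∈ Set.range M.i \ Set.range M.j ∧
      M.graph.tgt e ∈ Set.range M.j \ Set.range M.i) ∨
    (M.graph.tgt e ∈ Set.range M.i \ Set.range M.j ∧
      M.graph.src e ∈ Set.range M.j \ Set.range M.i)

/-- Type 2: all vertices are both inputs and outputs, with some edges between them. -/
def IsType2 {P Q : Type u} (M : InOutGraph.{u, v} P Q) : Prop :=
  ∀ x, x ∈ Set.range M.i ∧ x ∈ Set.range M.j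

/-- The morphism represented by the given graph is a composition `Mₙ ∘ ⋯ ∘ M₁` of morphisms of
types 1 and 2. -/
inductive HasFactorization12 : {P Q : Type u} → InOutGraph.{u, v} P Q → Prop
  | single {P Q : Type u} (M : InOutGraph.{u, v} P Q) (hM : M.IsType1 ∨ M.IsType2) :
      HasFactorization12 M
  | comp {P Q R : Type u} (M : InOutGraph.{u, v} P Q) (N : InOutGraph.{u, v} Q R)
      (hM : HasFactorization12 M) (hN : N.IsType1 ∨ N.IsType2) : HasFactorization12 (M.comp N)
  | iso {P Q : Type u} (M N : InOutGraph.{u, v} P Q) (f : Iso M N) (hM : HasFactorization12 M) :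
      HasFactorization12 N

end InOutGraph

/-- The morphism `[G, i, j] : P → Q` for two sets `P, Q` of vertices, with `i, j` the inclusions. -/
def Multigraph.inOut {V : Type u} {E : Type v} [Finite V] [Finite E] (G : Multigraph V E)
    (P Q : Set V) : InOutGraph.{u, v} P Q where
  V := V
  E := E
  graph := G
  i := Subtype.val
  j := Subtype.val
  i_inj := Subtype.val_injective
  j_inj := Subtype.val_injective
  finV := inferInstance
  finE := inferInstance

/-! ### Networks and harmonic functions -/

section Networks

variable {V : Type u} {E : Type v} {F : Type w} [Field F]

/-- Admissible edge weights: nonzero and invariant under reversal. -/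
def IsWeight (G : Multigraph V E) (c : E → F) : Prop :=
  (∀ e, c e ≠ 0) ∧ ∀ e, c (G.rev e) = c e

open Classical in
/-- The weighted Laplacian `Δu(p) = ∑_{e₊ = p} c(e) (u(e₊) - u(e₋))`. -/
noncomputable def laplacian [Fintype E] (G : Multigraph V E) (c : E → F) (a : V → F) (p : V) : F :=
  ∑ e : E with G.tgt e = p, c e * (a (G.tgt e) - a (G.src e))

/-- Harmonic potentials: the net current vanishes at every interior vertex. -/
def IsHarmonic [Fintype E] (G : BoundaryGraph V E) (c : E → F) (a : V → F) : Prop :=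
  ∀ p, p ∉ G.boundary → laplacian G.toMultigraph c a p = 0

theorem laplacian_add [Fintype E] (G : Multigraph V E) (c : E → F) (a b : V → F) :
    laplacian G c (a + b) = laplacian G c a + laplacian G c b := by
  funext p
  simp only [laplacian, Pi.add_apply, ← Finset.sum_add_distrib]
  exact Finset.sum_congr rfl fun e _ => by ring

theorem laplacian_smul [Fintype E] (G : Multigraph V E) (c : E → F) (t : F) (a : V → F) :
    laplacian G c (t • a) = t • laplacian G c a := by
  funext p
  simp only [laplacian, Pi.smul_apply, smul_eq_mul, Finset.mul_sum]
  exact Finset.sum_congr rfl fun e _ => by ring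

/-- The boundary relation `X([Γ, i, j])` from `(F^P)²` to `(F^Q)²`: all `((x₁, x₂), (y₁, y₂))` for
which there is a potential `a` with `i^* a = x₁`, `j^* a = y₁` and `Δa = j_* y₂ - i_* x₂`, where
`i_*` and `j_*` denote extension by zero along the (injective) labellings. -/
noncomputable def boundaryRelation [Fintype E] (G : Multigraph V E) (c : E → F)
    {P Q : Type u} (i : P → V) (j : Q → V) :
    Submodule F (((P → F) × (P → F)) × ((Q → F) × (Q → F))) where
  carrier := {z | ∃ a : V → F, a ∘ i = z.1.1 ∧ a ∘ j = z.2.1 ∧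
    laplacian G c a =
      Function.ExtendByZero.linearMap F j z.2.2 - Function.ExtendByZero.linearMap F i z.1.2}
  add_mem' := by
    rintro z z' ⟨a, h1, h2, h3⟩ ⟨a', h1', h2', h3'⟩
    refine ⟨a + a', ?_, ?_, ?_⟩
    · simp only [Prod.fst_add, ← h1, ← h1']; rfl
    · simp only [Prod.fst_add, Prod.snd_add, ← h2, ← h2']; rfl
    · simp only [Prod.fst_add, Prod.snd_add, map_add, laplacian_add, h3, h3']
      abel
  zero_mem' := by
    refine ⟨0, rfl, rfl, ?_⟩
    have h := laplacian_smul G c 0 (0 : V → F)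
    simp only [zero_smul] at h
    rw [h]
    simp
  smul_mem' := by
    rintro t z ⟨a, h1, h2, h3⟩
    refine ⟨t • a, ?_, ?_, ?_⟩
    · simp only [Prod.smul_fst, ← h1]; rfl
    · simp only [Prod.smul_fst, Prod.smul_snd, ← h2]; rfl
    · simp only [Prod.smul_fst, Prod.smul_snd, map_smul, laplacian_smul, h3, smul_sub]

/-- The rank of a linear relation `T` from `A` to `B`: the dimension of its domain minus the
dimension of its kernel `{x | (x, 0) ∈ T}` (which is contained in the domain). -/
noncomputable def relRank {A B : Type*} [AddCommGroup A] [Module F A] [AddCommGroup B] [Module F B]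
    (T : Submodule F (A × B)) : ℕ :=
  Module.finrank F (T.map (LinearMap.fst F A B)) - Module.finrank F (T.comap (LinearMap.inl F A B))

variable (F) in
/-- `rank X([Γ, i, j]) = 2n` for all edge weights in `F`. -/
def FullRank [Fintype E] (G : BoundaryGraph V E) (P Q : Set V) (n : ℕ) : Prop :=
  ∀ c : E → F, IsWeight G.toMultigraph c →
    relRank (boundaryRelation G.toMultigraph c (Subtype.val : P → V) (Subtype.val : Q → V)) = 2 * n

variable (F) in
/-- For all edge weights in `F`, potentials prescribed on `P` and net currents prescribed on
`P \ Q` are those of a unique harmonic function. -/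
def MixedProblemSolvable [Fintype E] (G : BoundaryGraph V E) (P Q : Set V) : Prop :=
  ∀ c : E → F, IsWeight G.toMultigraph c →
    ∀ (φ : P → F) (ψ : ↥(P \ Q) → F), ∃! a : V → F, IsHarmonic G c a ∧
      (∀ p : P, a p = φ p) ∧ ∀ p : ↥(P \ Q), laplacian G.toMultigraph c a p = ψ p

end Networks

/-! ### Harmonic subgraphs -/

section HarmonicSubgraphs

variable {V : Type u} {E : Type v}

/-- A harmonic subgraph, with its own set of interior vertices: these are interior in `G`, and every
edge of `G` at such a vertex belongs to the subgraph. -/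
structure HarmonicSubgraph (G : BoundaryGraph V E) where
  verts : Set V
  edges : Set E
  interior : Set V
  rev_mem : ∀ e ∈ edges, G.rev e ∈ edges
  tgt_mem : ∀ e ∈ edges, G.tgt e ∈ verts
  interior_subset : interior ⊆ verts
  interior_disjoint : ∀ x ∈ interior, x ∉ G.boundary
  star_subset : ∀ x ∈ interior, ∀ e, G.tgt e = x → e ∈ edges

/-- A subgraph is nontrivial if it is more than a single vertex. -/
def HarmonicSubgraph.IsNontrivial {G : BoundaryGraph V E} (H : HarmonicSubgraph G) : Prop :=
  H.verts.Nontrivial ∨ H.edges.Nonempty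

/-- `G` has no nontrivial harmonic subgraph with exactly one boundary vertex. -/
def NoOneBoundarySubgraph (G : BoundaryGraph V E) : Prop :=
  ¬ ∃ H : HarmonicSubgraph G, H.IsNontrivial ∧ ∃ x, H.verts \ H.interior = {x}

end HarmonicSubgraphs

end ElecNet

/-!
The five conditions are linked through a set `T` of edges that cuts the graph into disjoint paths
from `P` to `Q`, with no infinite path that uses no edge of `T` backwards and no two consecutive
edges outside `T` (`IsDirectedScaffold`). Such sets are the sets of reverses of the scaffolds in
(b), by `exists_isScaffold_iff`.

*Scaffolds and factorizations* (`hasFactorization12_inOut_iff`). Scaffolds of two graphs can be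
composed, since a decreasing path in a composition changes sides at most once. Conversely, from a
graph with a nonempty scaffold one can split off at the outputs either an edge between two outputs
or a last edge of one of the paths.

*From scaffolds to connections* (`IsDirectedScaffold.hasUniqueFullConnection`). A second complete
connection would give an infinite decreasing path, alternating between the two connections.

*From connections to networks* (`HasUniqueFullConnection.mixedProblemSolvable`). Only one
permutation contributes to the Leibniz expansion of the determinant of the mixed boundary value
problem in (e), the one given by the unique connection; its term is a product of edge weights up
to sign. Solvability of the mixed problem gives the full rank in (d)
(`MixedProblemSolvable.fullRank`), and a path of the scaffold through a harmonic subgraph enters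
and leaves it at different boundary vertices (`IsDirectedScaffold.noOneBoundarySubgraph`).

*From networks to scaffolds.* Let the field be infinite. By Green's identity, (e) implies that the
problem with potentials prescribed on `Q` and net currents prescribed outside `P` is nonsingular
for all weights (`MixedProblemSolvable.eq_zero`); under (d) it is nonsingular for some weights
(`NoOneBoundarySubgraph.exists_weight_dirichlet`). By the Cauchy–Binet formula there is then a set
of edges that is a spanning forest rooted at `P` and also one rooted at `Q`, called a grove
(`exists_grove`). An edge `e` outside the grove is related to an edge `e'` outside if some edge of
the grove lies in the cut which `e` crosses relative to `Q`, and on the circuit which `e'` closes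
relative to `P`. If chains of this relation could be continued forever, then the cuts and circuits
involved would carry a generic potential and a generic flow with the same support. Their quotients
are edge weights (`exists_weight`) for which the mixed problem is singular, which contradicts (e);
under (d), the potential and the flow have to vanish at the boundary, and their support gives a
harmonic subgraph with one boundary vertex
(`Grove.cyclicEdges_eq_empty_of_noOneBoundarySubgraph`). Hence all chains end. As interior
vertices have degree at least two, the grove is then a union of disjoint paths from `P` to `Q`,
and it is a scaffold, because a decreasing path runs through a chain of the relation
(`Grove.isDirectedScaffold`).
-/

namespace ElecNet

/-! ### Scaffolds that join two vertex sets -/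

section Directed

variable {V : Type u} {E : Type v}

/-- The set `T` of reverses of a scaffold `S` with `V \ S₋ = P` and `V \ S₊ = Q`, described
directly: the edges of `T` form disjoint paths which lead from `P` to `Q` and cover all vertices.
The last field excludes infinite decreasing paths. -/
structure IsDirectedScaffold (G : Multigraph V E) (P Q : Set V) (T : Set E) : Prop where
  rev_notMem : ∀ e ∈ T, G.rev e ∉ T
  injOn_src : Set.InjOn G.src T
  injOn_tgt : Set.InjOn G.tgt T
  src_image : ∀ x, x ∈ G.src '' T ↔ x ∉ Q
  tgt_image : ∀ x, x ∈ G.tgt '' T ↔ x ∉ P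
  no_ray : ¬ ∃ r : ℕ → E, (∀ k, G.tgt (r k) = G.src (r (k + 1))) ∧ (∀ k, G.rev (r k) ∉ T) ∧
    ∀ k, r k ∈ T ∨ r (k + 1) ∈ T

theorem revSet_revSet (G : Multigraph V E) (S : Set E) : revSet G (revSet G S) = S := by
  ext e
  simp [revSet, G.rev_rev]

theorem src_image_revSet (G : Multigraph V E) (S : Set E) :
    G.src '' revSet G S = G.tgt '' S := by
  ext x
  constructor
  · rintro ⟨e, he, rfl⟩
    exact ⟨G.rev e, he, G.tgt_rev e⟩
  · rintro ⟨e, he, rfl⟩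
    exact ⟨G.rev e, by simpa [revSet, G.rev_rev] using he, G.src_rev e⟩

theorem tgt_image_revSet (G : Multigraph V E) (S : Set E) :
    G.tgt '' revSet G S = G.src '' S := by
  rw [← src_image_revSet, revSet_revSet]

theorem injOn_src_revSet {G : Multigraph V E} {S : Set E} (h : Set.InjOn G.tgt S) :
    Set.InjOn G.src (revSet G S) := by
  intro e he e' he' hee
  have := h he he' (by simpa [G.tgt_rev] using hee)
  rw [← G.rev_rev e, this, G.rev_rev]

theorem injOn_tgt_revSet {G : Multigraph V E} {S : Set E} (h : Set.InjOn G.src S) :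
    Set.InjOn G.tgt (revSet G S) := by
  intro e he e' he' hee
  have := h he he' (by simpa [G.src_rev] using hee)
  rw [← G.rev_rev e, this, G.rev_rev]

/-- When the boundary is `P ∪ Q`, every interior vertex lies in `S₊` (and in `S₋`), so that the last
axiom of a scaffold holds automatically. -/
theorem exists_isScaffold_iff (G : BoundaryGraph V E) {P Q : Set V}
    (hb : G.boundary = P ∪ Q) :
    (∃ S : Set E, IsScaffold G S ∧ (G.src '' S)ᶜ = P ∧ (G.tgt '' S)ᶜ = Q) ↔
      ∃ T : Set E, IsDirectedScaffold G.toMultigraph P Q T := by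
  constructor
  · rintro ⟨S, hS, rfl, rfl⟩
    refine ⟨revSet G.toMultigraph S, ?_, injOn_src_revSet hS.injOn_tgt,
      injOn_tgt_revSet hS.injOn_src, ?_, ?_, ?_⟩
    · intro e he he'
      have : e ∈ S ∩ revSet G.toMultigraph S := ⟨by simpa [revSet, G.rev_rev] using he', he⟩
      rw [hS.disjoint] at this
      exact this
    · intro x
      rw [src_image_revSet]
      simp
    · intro x
      rw [tgt_image_revSet]
      simp
    · rintro ⟨r, h1, h2, h3⟩
      exact hS.no_decreasing_ray ⟨r, h1, h2, h3⟩
  · rintro ⟨T, hT⟩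
    refine ⟨revSet G.toMultigraph T, ⟨?_, injOn_tgt_revSet hT.injOn_src,
      injOn_src_revSet hT.injOn_tgt, ?_, ?_⟩, ?_, ?_⟩
    · rw [revSet_revSet]
      ext e
      simp only [Set.mem_inter_iff, Set.mem_empty_iff_false, iff_false, not_and]
      intro he he'
      exact hT.rev_notMem e he' he
    · rw [revSet_revSet]
      rintro ⟨r, h1, h2, h3⟩
      exact hT.no_ray ⟨r, h1, h2, h3⟩
    · intro p q hp _ _
      left
      rw [tgt_image_revSet, hT.src_image]
      rw [hb] at hp
      exact fun h => hp (Or.inr h)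
    · ext x
      rw [Set.mem_compl_iff, src_image_revSet, hT.tgt_image, not_not]
    · ext x
      rw [Set.mem_compl_iff, tgt_image_revSet, hT.src_image, not_not]

variable {G : Multigraph V E} {P Q : Set V} {T : Set E}

/-- A set of edges, none of them the reverse of an edge of `T`, in which every edge can be continued
along a decreasing path, is empty. -/
theorem IsDirectedScaffold.eq_empty (h : IsDirectedScaffold G P Q T) (Z : Set E)
    (hrev : ∀ e ∈ Z, G.rev e ∉ T)
    (hnext : ∀ e ∈ Z, ∃ e' ∈ Z, G.tgt e = G.src e' ∧ (e ∈ T ∨ e' ∈ T)) : Z = ∅ := by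
  by_contra hne
  obtain ⟨e₀, he₀⟩ := Set.nonempty_iff_ne_empty.mpr hne
  choose! f hf using hnext
  have hmem : ∀ k, f^[k] e₀ ∈ Z := by
    intro k
    induction k with
    | zero => exact he₀
    | succ k ih => rw [Function.iterate_succ_apply']; exact (hf _ ih).1
  refine h.no_ray ⟨fun k => f^[k] e₀, fun k => ?_, fun k => hrev _ (hmem k), fun k => ?_⟩
  · simp only [Function.iterate_succ_apply']; exact (hf _ (hmem k)).2.1
  · simp only [Function.iterate_succ_apply']; exact (hf _ (hmem k)).2.2

theorem IsDirectedScaffold.exists_height [Finite V] (h : IsDirectedScaffold G P Q T) :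
    ∃ d : V → ℕ, ∀ e ∈ T, d (G.tgt e) < d (G.src e) := by
  classical
  let r : V → V → Prop := fun a b => ∃ e ∈ T, G.src e = b ∧ G.tgt e = a
  have hwf : WellFounded r := by
    refine ⟨fun a => ?_⟩
    by_contra ha
    have hZ := h.eq_empty {e | e ∈ T ∧ ¬ Acc r (G.src e)} (fun e he => h.rev_notMem e he.1) ?_
    · have : ∃ e ∈ T, G.src e = a := by
        by_contra hno
        refine ha ⟨a, ?_⟩
        rintro b ⟨e, he, hea, -⟩
        exact absurd ⟨e, he, hea⟩ hno
      obtain ⟨e, he, rfl⟩ := this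
      have : e ∈ {e | e ∈ T ∧ ¬ Acc r (G.src e)} := ⟨he, ha⟩
      rw [hZ] at this
      exact this
    · rintro e ⟨he, hacc⟩
      have : ¬ Acc r (G.tgt e) := by
        intro hacc'
        refine hacc ⟨_, ?_⟩
        rintro b ⟨e', he', hs, rfl⟩
        rwa [h.injOn_src he' he hs]
      have : ∃ e' ∈ T, G.src e' = G.tgt e := by
        by_contra hno
        refine this ⟨_, ?_⟩
        rintro b ⟨e', he', hea, -⟩
        exact absurd ⟨e', he', hea⟩ hno
      obtain ⟨e', he', hs⟩ := this
      refine ⟨e', ⟨he', by rwa [hs]⟩, hs.symm, Or.inl he⟩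
  have hirr : ∀ a, ¬ Relation.TransGen r a a := fun a ha =>
    (hwf.transGen).irrefl.irrefl a ha
  refine ⟨fun x => {y | Relation.TransGen r y x}.ncard, fun e he => ?_⟩
  have hr : r (G.tgt e) (G.src e) := ⟨e, he, rfl, rfl⟩
  refine Set.ncard_lt_ncard ⟨fun y hy => Relation.TransGen.tail hy hr, fun hsub => ?_⟩
    (Set.toFinite _)
  exact hirr _ (hsub (Relation.TransGen.single hr))

end Directed

/-! ### Paths inside a set of edges -/

section Paths

variable {V : Type u} {E : Type v} {G : Multigraph V E}

theorem Multigraph.IsWalk.src_mem {p q : V} {l : List E} (h : G.IsWalk p l q) :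
    ∀ e ∈ l, G.src e ∈ p :: l.map G.tgt := by
  induction l generalizing p with
  | nil => simp
  | cons a l ih =>
    obtain ⟨h1, h2⟩ := h
    intro e he
    rcases List.mem_cons.1 he with rfl | he
    · simp [h1]
    · exact List.mem_cons_of_mem _ (ih h2 e he)

theorem Multigraph.IsWalk.finish_mem {p q : V} {l : List E} (h : G.IsWalk p l q) :
    q ∈ p :: l.map G.tgt := by
  induction l generalizing p with
  | nil => cases h; simp
  | cons a l ih => exact List.mem_cons_of_mem _ (ih h.2)

theorem Multigraph.IsWalk.src_ne_finish {p q : V} {l : List E} (h : G.IsWalk p l q)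
    (hn : (p :: l.map G.tgt).Nodup) : ∀ e ∈ l, G.src e ≠ q := by
  induction l generalizing p with
  | nil => simp
  | cons a l ih =>
    obtain ⟨h1, h2⟩ := h
    rw [List.map_cons, List.nodup_cons] at hn
    intro e he
    rcases List.mem_cons.1 he with rfl | he
    · rintro rfl
      exact hn.1 (h1 ▸ h2.finish_mem)
    · exact ih h2 hn.2 e he

theorem Multigraph.IsWalk.src_inj {p q : V} {l : List E} (h : G.IsWalk p l q)
    (hn : (p :: l.map G.tgt).Nodup) :
    ∀ e ∈ l, ∀ e' ∈ l, G.src e = G.src e' → e = e' := by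
  induction l generalizing p with
  | nil => simp
  | cons a l ih =>
    obtain ⟨h1, h2⟩ := h
    rw [List.map_cons, List.nodup_cons] at hn
    intro e he e' he' hee
    rcases List.mem_cons.1 he with h | h <;> rcases List.mem_cons.1 he' with h' | h'
    · rw [h, h']
    · exact absurd (h2.src_mem e' h') (by rw [← hee, h, h1]; exact hn.1)
    · exact absurd (h2.src_mem e h) (by rw [hee, h', h1]; exact hn.1)
    · exact ih h2 hn.2 e h e' h' hee

theorem Multigraph.IsWalk.exists_src_eq {p q : V} {l : List E} (h : G.IsWalk p l q) {x : V}
    (hx : x ∈ p :: l.map G.tgt) (hxq : x ≠ q) : ∃ e ∈ l, G.src e = x := by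
  induction l generalizing p with
  | nil => cases h; simp at hx; exact absurd hx hxq
  | cons a l ih =>
    obtain ⟨h1, h2⟩ := h
    rcases List.mem_cons.1 hx with rfl | hx
    · exact ⟨a, by simp, h1⟩
    · obtain ⟨e, he, hs⟩ := ih h2 hx
      exact ⟨e, List.mem_cons_of_mem _ he, hs⟩

theorem Multigraph.IsWalk.concat {p : V} {l : List E} {e : E} (h : G.IsWalk p l (G.src e)) :
    G.IsWalk p (l ++ [e]) (G.tgt e) := by
  induction l generalizing p with
  | nil => exact ⟨h.symm, rfl⟩
  | cons a l ih => exact ⟨h.1, ih h.2⟩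

/-- A vertex set which contains a vertex of a walk along edges of `T`, and the source of any edge of
`T` whose target it contains, contains the starting point of the walk. -/
theorem Multigraph.IsWalk.start_mem {T : Set E} {p q : V} {l : List E} (h : G.IsWalk p l q)
    (hl : ∀ e ∈ l, e ∈ T) {B : Set V} (hB : ∀ e ∈ T, G.tgt e ∈ B → G.src e ∈ B) {x : V}
    (hx : x ∈ p :: l.map G.tgt) (hxB : x ∈ B) : p ∈ B := by
  induction l generalizing p with
  | nil => simp at hx; exact hx ▸ hxB
  | cons a l ih =>
    obtain ⟨h1, h2⟩ := h
    rcases List.mem_cons.1 hx with rfl | hx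
    · exact hxB
    · rw [← h1]
      exact hB a (hl a (by simp)) (ih h2 (fun e he => hl e (by simp [he])) hx)

theorem Multigraph.IsWalk.unique {T : Set E} {Q : Set V} (hsrc : Set.InjOn G.src T)
    (hQ : ∀ e ∈ T, G.src e ∉ Q) {p q q' : V} {l l' : List E} (h : G.IsWalk p l q)
    (h' : G.IsWalk p l' q') (hl : ∀ e ∈ l, e ∈ T) (hl' : ∀ e ∈ l', e ∈ T) (hq : q ∈ Q)
    (hq' : q' ∈ Q) : l = l' ∧ q = q' := by
  induction l generalizing p l' with
  | nil =>
    cases h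
    cases l' with
    | nil => cases h'; exact ⟨rfl, rfl⟩
    | cons b l' => exact absurd hq (h'.1 ▸ hQ b (hl' b (by simp)))
  | cons a l ih =>
    obtain ⟨h1, h2⟩ := h
    cases l' with
    | nil => cases h'; exact absurd hq' (h1 ▸ hQ a (hl a (by simp)))
    | cons b l' =>
      obtain ⟨h1', h2'⟩ := h'
      obtain rfl := hsrc (hl a (by simp)) (hl' b (by simp)) (h1.trans h1'.symm)
      obtain ⟨rfl, rfl⟩ := ih h2 h2' (fun e he => hl e (by simp [he]))
        (fun e he => hl' e (by simp [he]))
      exact ⟨rfl, rfl⟩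

theorem SimplePath.ext_of_eq {α β : SimplePath G} (h1 : α.start = β.start)
    (h2 : α.finish = β.finish) (h3 : α.edges = β.edges) : α = β := by
  cases α; cases β; cases h1; cases h2; cases h3; rfl

theorem SimplePath.mem_support_iff {α : SimplePath G} {x : V} :
    x ∈ α.support ↔ x = α.start ∨ ∃ e ∈ α.edges, G.tgt e = x := by
  simp [SimplePath.support]

theorem SimplePath.src_mem_support {α : SimplePath G} {e : E} (he : e ∈ α.edges) :
    G.src e ∈ α.support := α.isWalk.src_mem e he

theorem SimplePath.tgt_mem_support {α : SimplePath G} {e : E} (he : e ∈ α.edges) :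
    G.tgt e ∈ α.support := SimplePath.mem_support_iff.2 (Or.inr ⟨e, he, rfl⟩)

theorem SimplePath.start_mem_support (α : SimplePath G) : α.start ∈ α.support := by
  simp [SimplePath.support]

theorem SimplePath.finish_mem_support (α : SimplePath G) : α.finish ∈ α.support :=
  α.isWalk.finish_mem

theorem SimplePath.src_ne_finish {α : SimplePath G} {e : E} (he : e ∈ α.edges) :
    G.src e ≠ α.finish := α.isWalk.src_ne_finish α.nodup e he

theorem SimplePath.tgt_ne_start {α : SimplePath G} {e : E} (he : e ∈ α.edges) :
    G.tgt e ≠ α.start := by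
  intro h
  have := α.nodup
  rw [List.nodup_cons] at this
  exact this.1 (h ▸ List.mem_map_of_mem he)

theorem SimplePath.src_inj {α : SimplePath G} {e e' : E} (he : e ∈ α.edges) (he' : e' ∈ α.edges)
    (h : G.src e = G.src e') : e = e' := α.isWalk.src_inj α.nodup e he e' he' h

theorem SimplePath.tgt_inj {α : SimplePath G} {e e' : E} (he : e ∈ α.edges) (he' : e' ∈ α.edges)
    (h : G.tgt e = G.tgt e') : e = e' := by
  have := α.nodup
  rw [List.nodup_cons] at this
  exact List.inj_on_of_nodup_map this.2 he he' h

/-- The paths from `P` to `Q` whose edges belong to `T`. -/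
def pathsIn (G : Multigraph V E) (P Q : Set V) (T : Set E) : Set (SimplePath G) :=
  {α | α.start ∈ P ∧ α.finish ∈ Q ∧ ∀ e ∈ α.edges, e ∈ T}

variable {P Q : Set V} {T : Set E}

theorem start_iff_of_mem_pathsIn (htgt : ∀ e ∈ T, G.tgt e ∉ P) {α : SimplePath G}
    (hα : α ∈ pathsIn G P Q T) {x : V} (hx : x ∈ α.support) : x ∈ P ↔ x = α.start := by
  constructor
  · intro hxP
    rcases SimplePath.mem_support_iff.1 hx with h | ⟨e, he, rfl⟩
    · exact h
    · exact absurd hxP (htgt e (hα.2.2 e he))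
  · rintro rfl
    exact hα.1

theorem eq_of_mem_pathsIn (hsrc : Set.InjOn G.src T) (hQ : ∀ e ∈ T, G.src e ∉ Q)
    {α β : SimplePath G} (hα : α ∈ pathsIn G P Q T) (hβ : β ∈ pathsIn G P Q T)
    (h : α.start = β.start) : α = β := by
  obtain ⟨h1, h2⟩ := Multigraph.IsWalk.unique hsrc hQ α.isWalk (h ▸ β.isWalk) hα.2.2 hβ.2.2
    hα.2.1 hβ.2.1
  exact SimplePath.ext_of_eq h h2 h1

theorem isConnection_pathsIn (hsrc : Set.InjOn G.src T) (htgt : Set.InjOn G.tgt T)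
    (hQ : ∀ e ∈ T, G.src e ∉ Q) (hP : ∀ e ∈ T, G.tgt e ∉ P) :
    IsConnection G P Q (pathsIn G P Q T) where
  disjoint := by
    intro α hα β hβ x hxα hxβ
    refine eq_of_mem_pathsIn hsrc hQ hα hβ ?_
    have hmem : α.start ∈ {y | y ∈ β.support} := by
      refine α.isWalk.start_mem hα.2.2 ?_ hxα hxβ
      intro e he hmem
      rcases SimplePath.mem_support_iff.1 hmem with h | ⟨e', he', h⟩
      · exact absurd hβ.1 (h ▸ hP e he)
      · rw [← htgt (hβ.2.2 e' he') he h]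
        exact SimplePath.src_mem_support he'
    exact (start_iff_of_mem_pathsIn hP hβ hmem).1 hα.1
  start_iff := fun α hα x hx => start_iff_of_mem_pathsIn hP hα hx
  finish_iff := by
    intro α hα x hx
    constructor
    · intro hxQ
      by_contra hne
      obtain ⟨e, he, rfl⟩ := α.isWalk.exists_src_eq hx hne
      exact hQ e (hα.2.2 e he) hxQ
    · rintro rfl
      exact hα.2.1

/-- A partial injection on the vertices along edges, which is defined at the points of `P` outside
`Q` and at all its values outside `Q`, leads from every point of `P` to a point of `Q` by a simple
path. -/
theorem exists_mem_pathsIn [Finite V] (htgt : Set.InjOn G.tgt T)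
    (hP : ∀ e ∈ T, G.tgt e ∉ P) (hstart : ∀ x ∈ P, x ∉ Q → x ∈ G.src '' T)
    (hcont : ∀ e ∈ T, G.tgt e ∉ Q → G.tgt e ∈ G.src '' T) {p : V} (hp : p ∈ P) :
    ∃ α ∈ pathsIn G P Q T, α.start = p := by
  classical
  have := Fintype.ofFinite V
  by_contra hno
  have key : ∀ k : ℕ, ∃ α : SimplePath G, α.start = p ∧ (∀ e ∈ α.edges, e ∈ T) ∧
      α.edges.length = k := by
    intro k
    induction k with
    | zero => exact ⟨⟨p, p, [], rfl, by simp⟩, rfl, by simp, rfl⟩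
    | succ k ih =>
      obtain ⟨α, hα, hT, hk⟩ := ih
      have hfin : α.finish ∉ Q := fun hq => hno ⟨α, ⟨hα ▸ hp, hq, hT⟩, hα⟩
      have : α.finish ∈ G.src '' T := by
        rcases SimplePath.mem_support_iff.1 α.finish_mem_support with h | ⟨e, he, h⟩
        · exact hstart _ (by rw [h, hα]; exact hp) hfin
        · rw [← h]
          exact hcont e (hT e he) (h ▸ hfin)
      obtain ⟨e, he, hes⟩ := this
      refine ⟨⟨α.start, G.tgt e, α.edges ++ [e], ?_, ?_⟩, hα, ?_, by simp [hk]⟩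
      · exact Multigraph.IsWalk.concat (by rw [hes]; exact α.isWalk)
      · rw [List.map_append, ← List.cons_append, List.nodup_append]
        refine ⟨α.nodup, by simp, ?_⟩
        intro x hx y hy hxy
        simp only [List.map_cons, List.map_nil, List.mem_singleton] at hy
        rw [hxy, hy] at hx
        rcases SimplePath.mem_support_iff.1 hx with h | ⟨e', he', h⟩
        · exact hP e he (h ▸ hα ▸ hp)
        · have := htgt (hT e' he') he h
          exact SimplePath.src_ne_finish he' (this ▸ hes)
      · intro e' he'
        rcases List.mem_append.1 he' with h | h
        · exact hT e' h
        · rw [List.mem_singleton.1 h]; exact he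
  obtain ⟨α, -, -, hk⟩ := key (Fintype.card V)
  have := α.nodup.length_le_card
  simp [hk] at this

theorem isCompleteConnection_pathsIn [Finite V] (hsrc : Set.InjOn G.src T)
    (htgt : Set.InjOn G.tgt T) (hQ : ∀ e ∈ T, G.src e ∉ Q) (hP : ∀ e ∈ T, G.tgt e ∉ P)
    (hstart : ∀ x ∈ P, x ∉ Q → x ∈ G.src '' T)
    (hcont : ∀ e ∈ T, G.tgt e ∉ Q → G.tgt e ∈ G.src '' T) (hcard : P.ncard = Q.ncard) :
    IsCompleteConnection G P Q (pathsIn G P Q T) := by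
  have hconn := isConnection_pathsIn hsrc htgt hQ hP
  refine ⟨hconn, ?_⟩
  have hex : ∀ p ∈ P, ∃ α ∈ pathsIn G P Q T, α.start = p := fun p hp =>
    exists_mem_pathsIn htgt hP hstart hcont hp
  rcases P.eq_empty_or_nonempty with rfl | ⟨p₀, hp₀⟩
  · rw [Set.ncard_empty, eq_comm, Set.ncard_eq_zero] at hcard
    simp [hcard]
  have : Nonempty (SimplePath G) := ⟨(hex p₀ hp₀).choose⟩
  choose! f hf hfs using hex
  have himg : (fun p => (f p).finish) '' P = Q := by
    refine Set.eq_of_subset_of_ncard_le ?_ ?_ (Set.toFinite _)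
    · rintro _ ⟨p, hp, rfl⟩
      exact (hf p hp).2.1
    · rw [Set.InjOn.ncard_image, hcard]
      intro p hp p' hp' h
      have := hconn.disjoint _ (hf p hp) _ (hf p' hp') _ (f p).finish_mem_support
        (by simp only at h; rw [h]; exact (f p').finish_mem_support)
      rw [← hfs p hp, this, hfs p' hp']
  rintro x (hx | hx)
  · exact ⟨f x, hf x hx, by
      have := (f x).start_mem_support
      rwa [hfs x hx] at this⟩
  · rw [← himg] at hx
    obtain ⟨p, hp, rfl⟩ := hx
    exact ⟨f p, hf p hp, (f p).finish_mem_support⟩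

/-- The edges used by a collection of paths. -/
def usedEdges (C : Set (SimplePath G)) : Set E := {e | ∃ α ∈ C, e ∈ α.edges}

variable {C : Set (SimplePath G)}

theorem IsConnection.injOn_src (h : IsConnection G P Q C) : Set.InjOn G.src (usedEdges C) := by
  rintro e ⟨α, hα, he⟩ e' ⟨β, hβ, he'⟩ hee
  obtain rfl := h.disjoint α hα β hβ (G.src e) (SimplePath.src_mem_support he)
    (hee ▸ SimplePath.src_mem_support he')
  exact SimplePath.src_inj he he' hee

theorem IsConnection.injOn_tgt (h : IsConnection G P Q C) : Set.InjOn G.tgt (usedEdges C) := by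
  rintro e ⟨α, hα, he⟩ e' ⟨β, hβ, he'⟩ hee
  obtain rfl := h.disjoint α hα β hβ (G.tgt e) (SimplePath.tgt_mem_support he)
    (hee ▸ SimplePath.tgt_mem_support he')
  exact SimplePath.tgt_inj he he' hee

theorem IsConnection.src_notMem (h : IsConnection G P Q C) {e : E} (he : e ∈ usedEdges C) :
    G.src e ∉ Q := by
  obtain ⟨α, hα, he⟩ := he
  intro hQ
  exact SimplePath.src_ne_finish he
    ((h.finish_iff α hα _ (SimplePath.src_mem_support he)).1 hQ)

theorem IsConnection.tgt_notMem (h : IsConnection G P Q C) {e : E} (he : e ∈ usedEdges C) :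
    G.tgt e ∉ P := by
  obtain ⟨α, hα, he⟩ := he
  intro hP
  exact SimplePath.tgt_ne_start he
    ((h.start_iff α hα _ (SimplePath.tgt_mem_support he)).1 hP)

theorem IsConnection.mem_src_image (h : IsConnection G P Q C) {α : SimplePath G} (hα : α ∈ C)
    {x : V} (hx : x ∈ α.support) (hxQ : x ∉ Q) : ∃ e ∈ α.edges, G.src e = x := by
  refine α.isWalk.exists_src_eq hx ?_
  rintro rfl
  exact hxQ ((h.finish_iff α hα _ hx).2 rfl)

theorem IsConnection.mem_tgt_image (h : IsConnection G P Q C) {α : SimplePath G} (hα : α ∈ C)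
    {x : V} (hx : x ∈ α.support) (hxP : x ∉ P) : ∃ e ∈ α.edges, G.tgt e = x := by
  rcases SimplePath.mem_support_iff.1 hx with h' | h'
  · exact absurd ((h.start_iff α hα _ hx).2 h') hxP
  · exact h'

/-- A complete connection consists of all the paths from `P` to `Q` along the edges it uses. -/
theorem IsCompleteConnection.eq_pathsIn (h : IsCompleteConnection G P Q C) :
    C = pathsIn G P Q (usedEdges C) := by
  have hsub : C ⊆ pathsIn G P Q (usedEdges C) := fun α hα =>
    ⟨(h.1.start_iff α hα _ α.start_mem_support).2 rfl,
      (h.1.finish_iff α hα _ α.finish_mem_support).2 rfl, fun e he => ⟨α, hα, he⟩⟩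
  refine Set.Subset.antisymm hsub fun α hα => ?_
  obtain ⟨β, hβ, hmem⟩ := h.2 α.start (Or.inl hα.1)
  have hs := (h.1.start_iff β hβ _ hmem).1 hα.1
  rwa [eq_of_mem_pathsIn h.1.injOn_src (fun e he => h.1.src_notMem he) hα (hsub hβ) hs]

/-- Following alternately the edges of the scaffold, and backwards the edges of another complete
connection, would give an infinite decreasing path. -/
theorem IsDirectedScaffold.hasUniqueFullConnection [Finite V] {G : BoundaryGraph V E} {P Q : Set V}
    {T : Set E} (h : IsDirectedScaffold G.toMultigraph P Q T) (hcard : P.ncard = Q.ncard) :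
    HasUniqueFullConnection G P Q := by
  have hQ : ∀ e ∈ T, G.src e ∉ Q := fun e he => (h.src_image _).1 ⟨e, he, rfl⟩
  have hP : ∀ e ∈ T, G.tgt e ∉ P := fun e he => (h.tgt_image _).1 ⟨e, he, rfl⟩
  have hcompl : IsCompleteConnection G.toMultigraph P Q (pathsIn G.toMultigraph P Q T) :=
    isCompleteConnection_pathsIn h.injOn_src h.injOn_tgt hQ hP
      (fun x _ hx => (h.src_image x).2 hx) (fun e _ hx => (h.src_image _).2 hx) hcard
  refine ⟨_, hcompl, ?_, ?_⟩
  · intro C' hC'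
    suffices hT : usedEdges C' = T by rw [hC'.eq_pathsIn, hT]
    have hZ := h.eq_empty ({e | e ∈ T ∧ e ∉ usedEdges C'} ∪
      {e | G.rev e ∈ usedEdges C' ∧ G.rev e ∉ T}) ?_ ?_
    · rw [Set.union_empty_iff] at hZ
      ext e
      constructor
      · intro he
        by_contra heT
        have : G.rev e ∈ {e | G.rev e ∈ usedEdges C' ∧ G.rev e ∉ T} := by
          simp only [Set.mem_ofPred_eq, G.rev_rev]; exact ⟨he, heT⟩
        rw [hZ.2] at this
        exact this
      · intro he
        by_contra heT
        have : e ∈ {e | e ∈ T ∧ e ∉ usedEdges C'} := ⟨he, heT⟩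
        rw [hZ.1] at this
        exact this
    · rintro e (⟨he, -⟩ | ⟨-, he⟩)
      · exact h.rev_notMem e he
      · exact he
    · rintro e (⟨he, he'⟩ | ⟨he, he'⟩)
      · by_cases hused : ∃ α ∈ C', G.tgt e ∈ α.support
        · obtain ⟨α, hα, hx⟩ := hused
          obtain ⟨e', he'α, ht⟩ := hC'.1.mem_tgt_image hα hx (hP e he)
          refine ⟨G.rev e', Or.inr ?_, by rw [G.src_rev, ht], Or.inl he⟩
          simp only [Set.mem_ofPred_eq, G.rev_rev]
          refine ⟨⟨α, hα, he'α⟩, fun hT => he' ?_⟩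
          rw [← h.injOn_tgt hT he ht]
          exact ⟨α, hα, he'α⟩
        · have hyQ : G.tgt e ∉ Q := fun hy => hused (hC'.2 _ (Or.inr hy))
          obtain ⟨e', he'T, hs⟩ := (h.src_image _).2 hyQ
          refine ⟨e', Or.inl ⟨he'T, ?_⟩, hs.symm, Or.inl he⟩
          rintro ⟨α, hα, hmem⟩
          exact hused ⟨α, hα, hs ▸ SimplePath.src_mem_support hmem⟩
      · have hyQ : G.tgt e ∉ Q := by
          rw [← G.src_rev]
          exact hC'.1.src_notMem he
        obtain ⟨e', he'T, hs⟩ := (h.src_image _).2 hyQ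
        refine ⟨e', Or.inl ⟨he'T, fun hu => he' ?_⟩, hs.symm, Or.inr he'T⟩
        rwa [hC'.1.injOn_src he hu (by rw [G.src_rev, hs])]
  · intro x hx
    obtain ⟨d, hd⟩ := h.exists_height
    -- An unused vertex of least height would have an unused successor.
    by_contra hno
    obtain ⟨y, hy, hmin⟩ := WellFounded.has_min (measure d).wf
      {y | ¬ ∃ α ∈ pathsIn G.toMultigraph P Q T, y ∈ α.support} ⟨x, hno⟩
    have hyQ : y ∉ Q := fun h' => hy (hcompl.2 y (Or.inr h'))
    obtain ⟨e, he, rfl⟩ := (h.src_image y).2 hyQ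
    refine hmin (G.tgt e) ?_ (hd e he)
    rintro ⟨α, hα, hmem⟩
    obtain ⟨e', he', ht⟩ := hcompl.1.mem_tgt_image hα hmem (hP e he)
    rw [h.injOn_tgt (hα.2.2 e' he') he ht] at he'
    exact hy ⟨α, hα, SimplePath.src_mem_support he'⟩

end Paths

/-! ### Scaffolds and elementary factorizations -/

namespace InOutGraph

section Scaffold

variable {P Q R : Type u}

/-- The graph has a scaffold whose paths lead from the inputs to the outputs. -/
def HasScaffold (M : InOutGraph.{u, v} P Q) : Prop :=
  ∃ T : Set M.E, IsDirectedScaffold M.graph (Set.range M.i) (Set.range M.j) T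

theorem IsType2.hasScaffold {M : InOutGraph.{u, v} P Q} (h : M.IsType2) : M.HasScaffold := by
  refine ⟨∅, by simp, by simp, by simp, ?_, ?_, ?_⟩
  · intro x; simpa using (h x).2
  · intro x; simpa using (h x).1
  · rintro ⟨r, -, -, h3⟩
    simpa using h3 0

theorem IsType1.hasScaffold {M : InOutGraph.{u, v} P Q} (h : M.IsType1) : M.HasScaffold := by
  have hsrc : ∀ e e', M.graph.src e = M.graph.src e' → e = e' := by
    intro e e' hee
    have := h.degree_le_one (M.graph.rev e) (M.graph.rev e')
      (by rw [M.graph.tgt_rev, M.graph.tgt_rev, hee])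
    rw [← M.graph.rev_rev e, this, M.graph.rev_rev]
  refine ⟨{e | M.graph.src e ∉ Set.range M.j}, ?_, fun e _ e' _ => hsrc e e',
    fun e _ e' _ => h.degree_le_one e e', ?_, ?_, ?_⟩
  · intro e he he'
    simp only [Set.mem_ofPred_eq, M.graph.src_rev] at he he'
    rcases h.edge e with h' | h'
    · exact he' h'.2.1
    · exact he h'.2.1
  · intro x
    constructor
    · rintro ⟨e, he, rfl⟩
      exact he
    · intro hx
      by_contra hno
      refine hx (h.isolated x fun e he => hno ⟨M.graph.rev e, ?_, ?_⟩).2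
      · simpa [M.graph.src_rev, he] using hx
      · rw [M.graph.src_rev, he]
  · intro x
    constructor
    · rintro ⟨e, he, rfl⟩
      rcases h.edge e with h' | h'
      · exact h'.2.2
      · exact absurd h'.2.1 he
    · intro hx
      by_contra hno
      refine hx (h.isolated x fun e he => hno ⟨e, ?_, he⟩).1
      rcases h.edge e with h' | h'
      · exact h'.1.2
      · exact absurd h'.1.1 (he ▸ hx)
  · rintro ⟨r, h1, h2, h3⟩
    have hr : r 1 = M.graph.rev (r 0) := hsrc _ _ (by rw [M.graph.src_rev, h1 0])
    rcases h3 0 with h0 | h0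
    · refine h2 1 ?_
      rwa [hr, M.graph.rev_rev]
    · rw [zero_add, hr] at h0
      exact h2 0 h0

theorem Iso.hasScaffold {M N : InOutGraph.{u, v} P Q} (f : Iso M N) (h : M.HasScaffold) :
    N.HasScaffold := by
  obtain ⟨T, hT⟩ := h
  have hi : ∀ x, f.onV x ∈ Set.range N.i ↔ x ∈ Set.range M.i := fun x => by
    simp only [Set.mem_range, ← f.i_comm, f.onV.apply_eq_iff_eq]
  have hj : ∀ x, f.onV x ∈ Set.range N.j ↔ x ∈ Set.range M.j := fun x => by
    simp only [Set.mem_range, ← f.j_comm, f.onV.apply_eq_iff_eq]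
  have hsrc : ∀ e, M.graph.src (f.onE.symm e) = f.onV.symm (N.graph.src e) := fun e => by
    rw [Equiv.eq_symm_apply, ← f.src_comm, Equiv.apply_symm_apply]
  have htgt : ∀ e, M.graph.tgt (f.onE.symm e) = f.onV.symm (N.graph.tgt e) := fun e => by
    rw [Equiv.eq_symm_apply, ← f.tgt_comm, Equiv.apply_symm_apply]
  have hrev : ∀ e, M.graph.rev (f.onE.symm e) = f.onE.symm (N.graph.rev e) := fun e => by
    rw [Equiv.eq_symm_apply, ← f.rev_comm, Equiv.apply_symm_apply]
  refine ⟨{e | f.onE.symm e ∈ T}, ?_, ?_, ?_, ?_, ?_, ?_⟩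
  · intro e he he'
    exact hT.rev_notMem _ he (by rw [hrev]; exact he')
  · intro e he e' he' hee
    exact f.onE.symm.injective (hT.injOn_src he he' (by rw [hsrc, hsrc, hee]))
  · intro e he e' he' hee
    exact f.onE.symm.injective (hT.injOn_tgt he he' (by rw [htgt, htgt, hee]))
  · intro x
    obtain ⟨x, rfl⟩ := f.onV.surjective x
    rw [hj, ← hT.src_image]
    constructor
    · rintro ⟨e, he, h⟩
      exact ⟨_, he, by rw [hsrc, h, Equiv.symm_apply_apply]⟩
    · rintro ⟨e, he, rfl⟩
      exact ⟨f.onE e, by simpa using he, f.src_comm e⟩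
  · intro x
    obtain ⟨x, rfl⟩ := f.onV.surjective x
    rw [hi, ← hT.tgt_image]
    constructor
    · rintro ⟨e, he, h⟩
      exact ⟨_, he, by rw [htgt, h, Equiv.symm_apply_apply]⟩
    · rintro ⟨e, he, rfl⟩
      exact ⟨f.onE e, by simpa using he, f.tgt_comm e⟩
  · rintro ⟨r, h1, h2, h3⟩
    exact hT.no_ray ⟨fun k => f.onE.symm (r k), fun k => by rw [htgt, hsrc, h1],
      fun k => by rw [hrev]; exact h2 k, h3⟩

variable (M : InOutGraph.{u, v} P Q) (N : InOutGraph.{u, v} Q R)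

theorem inLeft_eq_inRight {x : M.V} {y : N.V} (h : inLeft M N x = inRight M N y) :
    ∃ q, M.j q = x ∧ N.i q = y := by
  let φ : GlueV M N → Prop := Quot.lift
    (fun z => Sum.elim (fun x' => ∃ q, M.j q = x' ∧ N.i q = y) (fun y' => y' = y) z)
    (by
      rintro _ _ ⟨q⟩
      simp only [Sum.elim_inl, Sum.elim_inr, eq_iff_iff]
      constructor
      · rintro ⟨q', h1, h2⟩
        rwa [← M.j_inj h1]
      · intro h
        exact ⟨q, rfl, h⟩)
  have h1 : φ (inLeft M N x) = φ (inRight M N y) := by rw [h]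
  have h2 : φ (inRight M N y) := rfl
  rw [← h1] at h2
  exact h2

theorem exists_inLeft_or_inRight (z : GlueV M N) :
    (∃ x, inLeft M N x = z) ∨ ∃ y, inRight M N y = z := by
  induction z using Quot.ind with
  | mk z =>
    rcases z with x | y
    · exact Or.inl ⟨x, rfl⟩
    · exact Or.inr ⟨y, rfl⟩

/-- A decreasing path in a composition never returns from the second graph to the first, because no
edge of the scaffold of the second graph ends at a glued vertex and none of the first graph starts
there. -/
theorem HasScaffold.comp {M : InOutGraph.{u, v} P Q} {N : InOutGraph.{u, v} Q R}
    (hM : M.HasScaffold) (hN : N.HasScaffold) : (M.comp N).HasScaffold := by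
  obtain ⟨S, hS⟩ := hM
  obtain ⟨T, hT⟩ := hN
  have hSj : ∀ e ∈ S, ∀ q, M.j q ≠ M.graph.src e := fun e he q hq =>
    (hS.src_image _).1 ⟨e, he, rfl⟩ ⟨q, hq⟩
  have hTi : ∀ e ∈ T, ∀ q, N.i q ≠ N.graph.tgt e := fun e he q hq =>
    (hT.tgt_image _).1 ⟨e, he, rfl⟩ ⟨q, hq⟩
  refine ⟨{e | Sum.elim (· ∈ S) (· ∈ T) e}, ?_, ?_, ?_, ?_, ?_, ?_⟩
  · rintro (e | e) he he'
    · exact hS.rev_notMem e he he'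
    · exact hT.rev_notMem e he he'
  · rintro (e | e) he (e' | e') he' hee
    · exact congrArg Sum.inl (hS.injOn_src he he' (inLeft_injective M N hee))
    · obtain ⟨q, hq, -⟩ := inLeft_eq_inRight M N hee
      exact absurd hq (hSj e he q)
    · obtain ⟨q, hq, -⟩ := inLeft_eq_inRight M N hee.symm
      exact absurd hq (hSj e' he' q)
    · exact congrArg Sum.inr (hT.injOn_src he he' (inRight_injective M N hee))
  · rintro (e | e) he (e' | e') he' hee
    · exact congrArg Sum.inl (hS.injOn_tgt he he' (inLeft_injective M N hee))
    · obtain ⟨q, -, hq⟩ := inLeft_eq_inRight M N hee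
      exact absurd hq (hTi e' he' q)
    · obtain ⟨q, -, hq⟩ := inLeft_eq_inRight M N hee.symm
      exact absurd hq (hTi e he q)
    · exact congrArg Sum.inr (hT.injOn_tgt he he' (inRight_injective M N hee))
  · intro z
    constructor
    · rintro ⟨e | e, he, rfl⟩ ⟨r, hr⟩
      · obtain ⟨q, hq, -⟩ := inLeft_eq_inRight M N hr.symm
        exact hSj e he q hq
      · exact (hT.src_image _).1 ⟨e, he, rfl⟩ ⟨r, inRight_injective M N hr⟩
    · intro hz
      have hright : ∀ y, inRight M N y = z →
          z ∈ (M.comp N).graph.src '' {e | Sum.elim (· ∈ S) (· ∈ T) e} := by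
        rintro y rfl
        have hy : y ∉ Set.range N.j := fun ⟨r, hr⟩ => hz ⟨r, congrArg (inRight M N) hr⟩
        obtain ⟨e, he, rfl⟩ := (hT.src_image y).2 hy
        exact ⟨Sum.inr e, he, rfl⟩
      rcases exists_inLeft_or_inRight M N z with ⟨x, rfl⟩ | ⟨y, hy⟩
      · by_cases hx : x ∈ Set.range M.j
        · obtain ⟨q, rfl⟩ := hx
          exact hright (N.i q) (inLeft_j M N q).symm
        · obtain ⟨e, he, rfl⟩ := (hS.src_image x).2 hx
          exact ⟨Sum.inl e, he, rfl⟩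
      · exact hright y hy
  · intro z
    constructor
    · rintro ⟨e | e, he, rfl⟩ ⟨p, hp⟩
      · exact (hS.tgt_image _).1 ⟨e, he, rfl⟩ ⟨p, inLeft_injective M N hp⟩
      · obtain ⟨q, -, hq⟩ := inLeft_eq_inRight M N hp
        exact hTi e he q hq
    · intro hz
      have hleft : ∀ x, inLeft M N x = z →
          z ∈ (M.comp N).graph.tgt '' {e | Sum.elim (· ∈ S) (· ∈ T) e} := by
        rintro x rfl
        have hx : x ∉ Set.range M.i := fun ⟨p, hp⟩ => hz ⟨p, congrArg (inLeft M N) hp⟩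
        obtain ⟨e, he, rfl⟩ := (hS.tgt_image x).2 hx
        exact ⟨Sum.inl e, he, rfl⟩
      rcases exists_inLeft_or_inRight M N z with ⟨x, hx⟩ | ⟨y, rfl⟩
      · exact hleft x hx
      · by_cases hy : y ∈ Set.range N.i
        · obtain ⟨q, rfl⟩ := hy
          exact hleft (M.j q) (inLeft_j M N q)
        · obtain ⟨e, he, rfl⟩ := (hT.tgt_image y).2 hy
          exact ⟨Sum.inr e, he, rfl⟩
  · rintro ⟨r, h1, h2, h3⟩
    have hstep : ∀ k e, r k = Sum.inr e → ∃ e', r (k + 1) = Sum.inr e' := by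
      intro k e hk
      rcases hk' : r (k + 1) with e' | e'
      · exfalso
        have hglue := h1 k
        rw [hk, hk'] at hglue
        obtain ⟨q, hq, hq'⟩ := inLeft_eq_inRight M N hglue.symm
        rcases h3 k with h | h
        · rw [hk] at h
          exact hTi e h q hq'
        · rw [hk'] at h
          exact hSj e' h q hq
      · exact ⟨e', rfl⟩
    by_cases hex : ∃ k e, r k = Sum.inr e
    · obtain ⟨k₀, e₀, hk₀⟩ := hex
      have hall : ∀ k, ∃ e, r (k₀ + k) = Sum.inr e := by
        intro k
        induction k with
        | zero => exact ⟨e₀, hk₀⟩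
        | succ k ih => obtain ⟨e, he⟩ := ih; exact hstep _ e he
      choose s hs using hall
      refine hT.no_ray ⟨s, fun k => ?_, fun k => ?_, fun k => ?_⟩
      · have := h1 (k₀ + k)
        rw [hs, add_assoc, hs] at this
        exact inRight_injective M N this
      · have := h2 (k₀ + k)
        rw [hs] at this
        exact this
      · have := h3 (k₀ + k)
        rw [hs, add_assoc, hs] at this
        exact this
    · have hall : ∀ k, ∃ e, r k = Sum.inl e := by
        intro k
        rcases hk : r k with e | e
        · exact ⟨e, rfl⟩
        · exact absurd ⟨k, e, hk⟩ hex
      choose s hs using hall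
      refine hS.no_ray ⟨s, fun k => ?_, fun k => ?_, fun k => ?_⟩
      · have := h1 k
        rw [hs, hs] at this
        exact inLeft_injective M N this
      · have := h2 k
        rw [hs] at this
        exact this
      · have := h3 k
        rw [hs, hs] at this
        exact this

theorem HasFactorization12.hasScaffold {P Q : Type u} {M : InOutGraph.{u, v} P Q}
    (h : HasFactorization12 M) : M.HasScaffold := by
  induction h with
  | single M hM => exact hM.elim IsType1.hasScaffold IsType2.hasScaffold
  | comp M N _ hN ih => exact ih.comp (hN.elim IsType1.hasScaffold IsType2.hasScaffold)
  | iso M N f _ ih => exact f.hasScaffold ih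

end Scaffold

section Peeling

variable {P Q R : Type u}

/-- A graph that is covered by two pieces, which share no edges and exactly the vertices that carry
corresponding labels, is isomorphic to the composition of the pieces. -/
theorem nonempty_iso_comp (M : InOutGraph.{u, v} P Q) (N : InOutGraph.{u, v} Q R)
    (K : InOutGraph.{u, v} P R) (f : M.V → K.V) (g : N.V → K.V) (f' : M.E → K.E) (g' : N.E → K.E)
    (hglue : ∀ q, f (M.j q) = g (N.i q)) (hf : Injective f) (hg : Injective g)
    (hmeet : ∀ x y, f x = g y → ∃ q, M.j q = x ∧ N.i q = y)
    (hcover : ∀ z, (∃ x, f x = z) ∨ ∃ y, g y = z)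
    (hf' : Injective f') (hg' : Injective g') (hdisj : ∀ e e', f' e ≠ g' e')
    (hcover' : ∀ z, (∃ x, f' x = z) ∨ ∃ y, g' y = z)
    (hfsrc : ∀ e, K.graph.src (f' e) = f (M.graph.src e))
    (hgsrc : ∀ e, K.graph.src (g' e) = g (N.graph.src e))
    (hfrev : ∀ e, K.graph.rev (f' e) = f' (M.graph.rev e))
    (hgrev : ∀ e, K.graph.rev (g' e) = g' (N.graph.rev e))
    (hi : ∀ p, f (M.i p) = K.i p) (hj : ∀ r, g (N.j r) = K.j r) :
    Nonempty (Iso (M.comp N) K) := by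
  let φ : GlueV M N → K.V := Quot.lift (Sum.elim f g) (by
    rintro _ _ ⟨q⟩
    exact hglue q)
  have hφ : Bijective φ := by
    constructor
    · intro z z' h
      rcases exists_inLeft_or_inRight M N z with ⟨x, rfl⟩ | ⟨y, rfl⟩ <;>
        rcases exists_inLeft_or_inRight M N z' with ⟨x', rfl⟩ | ⟨y', rfl⟩
      · exact congrArg _ (hf h)
      · obtain ⟨q, rfl, rfl⟩ := hmeet x y' h
        exact inLeft_j M N q
      · obtain ⟨q, rfl, rfl⟩ := hmeet x' y h.symm
        exact (inLeft_j M N q).symm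
      · exact congrArg _ (hg h)
    · intro z
      rcases hcover z with ⟨x, hx⟩ | ⟨y, hy⟩
      · exact ⟨inLeft M N x, hx⟩
      · exact ⟨inRight M N y, hy⟩
  have hψ : Bijective (Sum.elim f' g' : M.E ⊕ N.E → K.E) := by
    constructor
    · exact hf'.sumElim hg' hdisj
    · intro z
      rcases hcover' z with ⟨x, hx⟩ | ⟨y, hy⟩
      · exact ⟨Sum.inl x, hx⟩
      · exact ⟨Sum.inr y, hy⟩
  have hsrc : ∀ e : M.E ⊕ N.E,
      K.graph.src (Sum.elim f' g' e) = φ ((M.comp N).graph.src e) := by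
    rintro (e | e)
    · exact hfsrc e
    · exact hgsrc e
  have hrev : ∀ e : M.E ⊕ N.E,
      K.graph.rev (Sum.elim f' g' e) = Sum.elim f' g' ((M.comp N).graph.rev e) := by
    rintro (e | e)
    · exact hfrev e
    · exact hgrev e
  have htgt : ∀ e : M.E ⊕ N.E,
      K.graph.tgt (Sum.elim f' g' e) = φ ((M.comp N).graph.tgt e) := by
    rintro (e | e)
    · change K.graph.tgt (f' e) = f (M.graph.tgt e)
      rw [← K.graph.src_rev, hfrev, hfsrc, M.graph.src_rev]
    · change K.graph.tgt (g' e) = g (N.graph.tgt e)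
      rw [← K.graph.src_rev, hgrev, hgsrc, N.graph.src_rev]
  exact ⟨⟨Equiv.ofBijective φ hφ, Equiv.ofBijective _ hψ, hsrc, htgt, hrev, hi, hj⟩⟩

/-- The subgraph with vertex set `W` and edge set `F`. -/
def _root_.ElecNet.Multigraph.restrict {V : Type u} {E : Type v} (G : Multigraph V E) (W : Set V)
    (F : Set E) (hrev : ∀ e ∈ F, G.rev e ∈ F) (hsrc : ∀ e ∈ F, G.src e ∈ W) : Multigraph W F where
  src e := ⟨G.src e, hsrc e e.2⟩
  tgt e := ⟨G.tgt e, by rw [← G.src_rev]; exact hsrc _ (hrev e e.2)⟩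
  rev e := ⟨G.rev e, hrev e e.2⟩
  rev_rev e := Subtype.ext (G.rev_rev e)
  rev_ne e h := G.rev_ne e (congrArg Subtype.val h)
  src_rev e := Subtype.ext (G.src_rev e)

theorem _root_.ElecNet.IsDirectedScaffold.restrict {V : Type u} {E : Type v} {G : Multigraph V E}
    {A B : Set V} {T : Set E} (h : IsDirectedScaffold G A B T) {W : Set V} {F : Set E}
    (hrev : ∀ e ∈ F, G.rev e ∈ F) (hsrc : ∀ e ∈ F, G.src e ∈ W) {A' B' : Set W}
    (hB : ∀ x : W, (∃ e ∈ T, e ∈ F ∧ G.src e = x) ↔ x ∉ B')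
    (hA : ∀ x : W, (∃ e ∈ T, e ∈ F ∧ G.tgt e = x) ↔ x ∉ A') :
    IsDirectedScaffold (G.restrict W F hrev hsrc) A' B' {e | (e : E) ∈ T} where
  rev_notMem := fun e he he' => h.rev_notMem e he he'
  injOn_src := fun e he e' he' hee =>
    Subtype.ext (h.injOn_src he he' (congrArg Subtype.val hee))
  injOn_tgt := fun e he e' he' hee =>
    Subtype.ext (h.injOn_tgt he he' (congrArg Subtype.val hee))
  src_image := by
    intro x
    rw [← hB]
    constructor
    · rintro ⟨e, he, rfl⟩
      exact ⟨e, he, e.2, rfl⟩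
    · rintro ⟨e, he, heF, hx⟩
      exact ⟨⟨e, heF⟩, he, Subtype.ext hx⟩
  tgt_image := by
    intro x
    rw [← hA]
    constructor
    · rintro ⟨e, he, rfl⟩
      exact ⟨e, he, e.2, rfl⟩
    · rintro ⟨e, he, heF, hx⟩
      exact ⟨⟨e, heF⟩, he, Subtype.ext hx⟩
  no_ray := by
    rintro ⟨r, h1, h2, h3⟩
    exact h.no_ray ⟨fun k => r k, fun k => congrArg Subtype.val (h1 k), h2, h3⟩

/-- A graph with a single edge, from `a` to `b`. -/
def _root_.ElecNet.Multigraph.singleEdge {V : Type u} (a b : V) :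
    Multigraph V (ULift.{v} Bool) where
  src e := bif e.down then a else b
  tgt e := bif e.down then b else a
  rev e := ⟨!e.down⟩
  rev_rev e := by simp
  rev_ne := by
    rintro ⟨_ | _⟩ h
    · exact Bool.noConfusion (congrArg ULift.down h)
    · exact Bool.noConfusion (congrArg ULift.down h)
  src_rev := by rintro ⟨_ | _⟩ <;> rfl

theorem rev_mem_ne {V : Type u} {E : Type v} (G : Multigraph V E) (t : E) :
    ∀ e ∈ {e | e ≠ t ∧ e ≠ G.rev t}, G.rev e ∈ {e | e ≠ t ∧ e ≠ G.rev t} := by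
  rintro e ⟨h1, h2⟩
  refine ⟨fun h => h2 ?_, fun h => h1 ?_⟩
  · rw [← h, G.rev_rev]
  · rw [← G.rev_rev e, h, G.rev_rev]

theorem card_ne_lt {M : InOutGraph.{u, v} P Q} (t : M.E) :
    Nat.card {e | e ≠ t ∧ e ≠ M.graph.rev t} < Nat.card M.E := by
  have := M.finE
  exact Finite.card_subtype_lt (x := t) (fun h => h.1 rfl)

/-- An edge between two outputs can be split off as a morphism of type 2. -/
theorem HasScaffold.exists_peel_type2 {M : InOutGraph.{u, v} P Q} (hM : M.HasScaffold) {t : M.E}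
    (hs : M.graph.src t ∈ Set.range M.j) (ht : M.graph.tgt t ∈ Set.range M.j) :
    ∃ (M' : InOutGraph.{u, v} P Q) (N : InOutGraph.{u, v} Q Q), M'.HasScaffold ∧ N.IsType2 ∧
      Nat.card M'.E < Nat.card M.E ∧ Nonempty (Iso (M'.comp N) M) := by
  obtain ⟨T, hT⟩ := hM
  obtain ⟨a, ha⟩ := hs
  obtain ⟨b, hb⟩ := ht
  have := M.finV
  have := M.finE
  have hQ : Finite Q := Finite.of_injective _ M.j_inj
  have htT : t ∉ T := fun h => (hT.src_image _).1 ⟨t, h, rfl⟩ ⟨a, ha⟩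
  have htT' : M.graph.rev t ∉ T := fun h =>
    (hT.src_image _).1 ⟨_, h, rfl⟩ ⟨b, by rw [hb, M.graph.src_rev]⟩
  have hTF : ∀ e ∈ T, e ∈ {e | e ≠ t ∧ e ≠ M.graph.rev t} := fun e he =>
    ⟨fun h => htT (h ▸ he), fun h => htT' (h ▸ he)⟩
  let M' : InOutGraph.{u, v} P Q :=
    { V := (Set.univ : Set M.V)
      E := {e | e ≠ t ∧ e ≠ M.graph.rev t}
      graph := M.graph.restrict Set.univ _ (rev_mem_ne M.graph t) (fun _ _ => Set.mem_univ _)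
      i := fun p => ⟨M.i p, Set.mem_univ _⟩
      j := fun q => ⟨M.j q, Set.mem_univ _⟩
      i_inj := fun p p' h => M.i_inj (congrArg Subtype.val h)
      j_inj := fun p p' h => M.j_inj (congrArg Subtype.val h)
      finV := inferInstance
      finE := inferInstance }
  let N : InOutGraph.{u, v} Q Q :=
    { V := Q
      E := ULift.{v} Bool
      graph := Multigraph.singleEdge a b
      i := id
      j := id
      i_inj := injective_id
      j_inj := injective_id
      finV := hQ
      finE := inferInstance }
  refine ⟨M', N, ⟨{e | (e : M.E) ∈ T}, ?_⟩, fun x => ⟨⟨x, rfl⟩, ⟨x, rfl⟩⟩, card_ne_lt t, ?_⟩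
  · refine hT.restrict (rev_mem_ne M.graph t) (fun _ _ => Set.mem_univ _) (fun x => ?_)
      (fun x => ?_)
    · have h1 : x ∈ Set.range M'.j ↔ (x : M.V) ∈ Set.range M.j :=
        exists_congr fun q => Subtype.ext_iff
      rw [h1, ← hT.src_image]
      exact ⟨fun ⟨e, he, _, hx⟩ => ⟨e, he, hx⟩, fun ⟨e, he, hx⟩ => ⟨e, he, hTF e he, hx⟩⟩
    · have h1 : x ∈ Set.range M'.i ↔ (x : M.V) ∈ Set.range M.i :=
        exists_congr fun q => Subtype.ext_iff
      rw [h1, ← hT.tgt_image]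
      exact ⟨fun ⟨e, he, _, hx⟩ => ⟨e, he, hx⟩, fun ⟨e, he, hx⟩ => ⟨e, he, hTF e he, hx⟩⟩
  · refine nonempty_iso_comp M' N M Subtype.val M.j Subtype.val
      (fun e => bif e.down then t else M.graph.rev t) (fun q => rfl) Subtype.val_injective M.j_inj
      ?_ (fun z => Or.inl ⟨⟨z, Set.mem_univ _⟩, rfl⟩) Subtype.val_injective ?_ ?_ ?_
      (fun e => rfl) ?_ (fun e => rfl) ?_ (fun p => rfl) (fun r => rfl)
    · intro x y hxy
      exact ⟨y, Subtype.ext hxy.symm, rfl⟩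
    · rintro ⟨_ | _⟩ ⟨_ | _⟩ h
      · rfl
      · exact absurd h (M.graph.rev_ne t)
      · exact absurd h.symm (M.graph.rev_ne t)
      · rfl
    · rintro ⟨e, he⟩ ⟨_ | _⟩ h
      · exact he.2 h
      · exact he.1 h
    · intro z
      by_cases h1 : z = t
      · exact Or.inr ⟨⟨true⟩, h1.symm⟩
      by_cases h2 : z = M.graph.rev t
      · exact Or.inr ⟨⟨false⟩, h2.symm⟩
      exact Or.inl ⟨⟨z, h1, h2⟩, rfl⟩
    · rintro ⟨_ | _⟩
      · exact (M.graph.src_rev t).trans hb.symm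
      · exact ha.symm
    · rintro ⟨_ | _⟩
      · exact M.graph.rev_rev t
      · rfl

/-- An edge of the scaffold that is the only edge at its end, an output, can be split off as a
morphism of type 1: the start of the edge becomes an output in place of its end. -/
theorem exists_peel_type1 {M : InOutGraph.{u, v} P Q} {T : Set M.E}
    (hT : IsDirectedScaffold M.graph (Set.range M.i) (Set.range M.j) T) {t : M.E} (ht : t ∈ T)
    {q : Q} (hq : M.j q = M.graph.tgt t)
    (honly : ∀ e, M.graph.src e = M.graph.tgt t → e = M.graph.rev t) :
    ∃ (M' : InOutGraph.{u, v} P Q) (N : InOutGraph.{u, v} Q Q), M'.HasScaffold ∧ N.IsType1 ∧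
      Nat.card M'.E < Nat.card M.E ∧ Nonempty (Iso (M'.comp N) M) := by
  classical
  have := M.finV
  have := M.finE
  have hQ : Finite Q := Finite.of_injective _ M.j_inj
  have hsj : ∀ r, M.j r ≠ M.graph.src t := fun r hr => (hT.src_image _).1 ⟨t, ht, rfl⟩ ⟨r, hr⟩
  have hti : ∀ p, M.i p ≠ M.graph.tgt t := fun r hr => (hT.tgt_image _).1 ⟨t, ht, rfl⟩ ⟨r, hr⟩
  have hrt : M.graph.rev t ∉ T := hT.rev_notMem t ht
  have hst : M.graph.src t ≠ M.graph.tgt t := fun h => hsj q (hq.trans h.symm)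
  have hjq : ∀ r, r ≠ q → M.j r ≠ M.graph.tgt t := fun r hr h => hr (M.j_inj (h.trans hq.symm))
  let W : Set M.V := {x | x ≠ M.graph.tgt t}
  let j' : Q → W := fun r => if h : r = q then ⟨M.graph.src t, hst⟩ else ⟨M.j r, hjq r h⟩
  have hj' : ∀ r, r ≠ q → (j' r : M.V) = M.j r := fun r hr => by simp [j', hr]
  have hj'q : (j' q : M.V) = M.graph.src t := by simp [j']
  have hj'inj : Injective j' := by
    intro r r' h
    have h := congrArg Subtype.val h
    by_cases hr : r = q <;> by_cases hr' : r' = q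
    · rw [hr, hr']
    · rw [hr, hj'q, hj' r' hr'] at h
      exact absurd h.symm (hsj r')
    · rw [hr', hj'q, hj' r hr] at h
      exact absurd h (hsj r)
    · rw [hj' r hr, hj' r' hr'] at h
      exact M.j_inj h
  have hsrc : ∀ e ∈ {e | e ≠ t ∧ e ≠ M.graph.rev t}, M.graph.src e ∈ W := fun e he h =>
    he.2 (honly e h)
  let M' : InOutGraph.{u, v} P Q :=
    { V := W
      E := {e | e ≠ t ∧ e ≠ M.graph.rev t}
      graph := M.graph.restrict W _ (rev_mem_ne M.graph t) hsrc
      i := fun p => ⟨M.i p, hti p⟩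
      j := j'
      i_inj := fun p p' h => M.i_inj (congrArg Subtype.val h)
      j_inj := hj'inj
      finV := inferInstance
      finE := inferInstance }
  let iN : Q → Option Q := fun r => if r = q then none else some r
  have hiN : ∀ r, r ≠ q → iN r = some r := fun r hr => by simp [iN, hr]
  have hiNq : iN q = none := by simp [iN]
  have hiNinj : Injective iN := by
    intro r r' h
    by_cases hr : r = q <;> by_cases hr' : r' = q
    · rw [hr, hr']
    · rw [hr, hiNq, hiN r' hr'] at h
      exact absurd h (by simp)
    · rw [hr', hiNq, hiN r hr] at h
      exact absurd h (by simp)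
    · rw [hiN r hr, hiN r' hr'] at h
      exact Option.some_injective _ h
  let N : InOutGraph.{u, v} Q Q :=
    { V := Option Q
      E := ULift.{v} Bool
      graph := Multigraph.singleEdge none (some q)
      i := iN
      j := some
      i_inj := hiNinj
      j_inj := Option.some_injective _
      finV := inferInstance
      finE := inferInstance }
  have hqi : some q ∉ Set.range iN := by
    rintro ⟨r, hr⟩
    by_cases h : r = q
    · rw [h, hiNq] at hr
      exact absurd hr (by simp)
    · rw [hiN r h] at hr
      exact h (Option.some_injective _ hr)
  have hN : N.IsType1 := by
    refine ⟨?_, ?_, ?_⟩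
    · rintro ⟨_ | _⟩ ⟨_ | _⟩ h
      · rfl
      · cases h
      · cases h
      · rfl
    · rintro (_ | r) hx
      · exact absurd rfl (hx ⟨false⟩)
      · have hr : r ≠ q := by
          rintro rfl
          exact hx ⟨true⟩ rfl
        exact ⟨⟨r, hiN r hr⟩, ⟨r, rfl⟩⟩
    · have h1 : (none : Option Q) ∈ Set.range iN \ Set.range some := ⟨⟨q, hiNq⟩, by simp⟩
      have h2 : some q ∈ Set.range some \ Set.range iN := ⟨⟨q, rfl⟩, hqi⟩
      rintro ⟨_ | _⟩
      · exact Or.inr ⟨h1, h2⟩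
      · exact Or.inl ⟨h1, h2⟩
  refine ⟨M', N, ⟨{e | (e : M.E) ∈ T}, ?_⟩, hN, card_ne_lt t, ?_⟩
  · refine hT.restrict (rev_mem_ne M.graph t) hsrc (fun x => ?_) (fun x => ?_)
    · constructor
      · rintro ⟨e, he, heF, hx⟩ ⟨r, hr⟩
        have hr : (j' r : M.V) = x := congrArg Subtype.val hr
        by_cases hrq : r = q
        · rw [hrq, hj'q, ← hx] at hr
          exact heF.1 (hT.injOn_src ht he hr).symm
        · rw [hj' r hrq] at hr
          exact (hT.src_image _).1 ⟨e, he, hx⟩ ⟨r, hr⟩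
      · intro hx
        have hxj : (x : M.V) ∉ Set.range M.j := by
          rintro ⟨r, hr⟩
          have hrq : r ≠ q := by
            rintro rfl
            exact x.2 (hr.symm.trans hq)
          exact hx ⟨r, Subtype.ext ((hj' r hrq).trans hr)⟩
        obtain ⟨e, he, hex⟩ := (hT.src_image _).2 hxj
        refine ⟨e, he, ⟨?_, ?_⟩, hex⟩
        · rintro rfl
          exact hx ⟨q, Subtype.ext (hj'q.trans hex)⟩
        · rintro rfl
          exact hrt he
    · have h1 : x ∈ Set.range M'.i ↔ (x : M.V) ∈ Set.range M.i :=
        exists_congr fun q => Subtype.ext_iff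
      rw [h1, ← hT.tgt_image]
      constructor
      · rintro ⟨e, he, _, hx⟩
        exact ⟨e, he, hx⟩
      · rintro ⟨e, he, hx⟩
        refine ⟨e, he, ⟨?_, ?_⟩, hx⟩
        · rintro rfl
          exact x.2 hx.symm
        · rintro rfl
          exact hrt he
  · refine nonempty_iso_comp M' N M Subtype.val (fun y => y.elim (M.graph.src t) M.j) Subtype.val
      (fun e => bif e.down then t else M.graph.rev t) ?_ Subtype.val_injective ?_
      ?_ ?_ Subtype.val_injective ?_ ?_ ?_
      (fun e => rfl) ?_ (fun e => rfl) ?_ (fun p => rfl) (fun r => rfl)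
    · intro r
      change (j' r : M.V) = (iN r).elim (M.graph.src t) M.j
      by_cases hr : r = q
      · rw [hr, hj'q, hiNq]; rfl
      · rw [hj' r hr, hiN r hr]; rfl
    · rintro (_ | r) (_ | r') h
      · rfl
      · exact absurd h.symm (hsj r')
      · exact absurd h (hsj r)
      · exact congrArg some (M.j_inj h)
    · rintro x (_ | r) h
      · exact ⟨q, Subtype.ext (hj'q.trans h.symm), hiNq⟩
      · have h : (x : M.V) = M.j r := h
        have hr : r ≠ q := by
          rintro rfl
          exact x.2 (h.trans hq)
        exact ⟨r, Subtype.ext ((hj' r hr).trans h.symm), hiN r hr⟩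
    · intro z
      by_cases hz : z = M.graph.tgt t
      · exact Or.inr ⟨some q, hq.trans hz.symm⟩
      · exact Or.inl ⟨⟨z, hz⟩, rfl⟩
    · rintro ⟨_ | _⟩ ⟨_ | _⟩ h
      · rfl
      · exact absurd h (M.graph.rev_ne t)
      · exact absurd h.symm (M.graph.rev_ne t)
      · rfl
    · rintro ⟨e, he⟩ ⟨_ | _⟩ h
      · exact he.2 h
      · exact he.1 h
    · intro z
      by_cases h1 : z = t
      · exact Or.inr ⟨⟨true⟩, h1.symm⟩
      by_cases h2 : z = M.graph.rev t
      · exact Or.inr ⟨⟨false⟩, h2.symm⟩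
      exact Or.inl ⟨⟨z, h1, h2⟩, rfl⟩
    · rintro ⟨_ | _⟩
      · exact (M.graph.src_rev t).trans hq.symm
      · rfl
    · rintro ⟨_ | _⟩
      · exact M.graph.rev_rev t
      · rfl

/-- As long as the scaffold is not empty, one of the two kinds of edges can be split off at the
outputs: otherwise a decreasing path could be continued at every output. -/
theorem HasScaffold.exists_peel {M : InOutGraph.{u, v} P Q} (hM : M.HasScaffold)
    (h2 : ¬ M.IsType2) :
    ∃ (M' : InOutGraph.{u, v} P Q) (N : InOutGraph.{u, v} Q Q), M'.HasScaffold ∧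
      (N.IsType1 ∨ N.IsType2) ∧ Nat.card M'.E < Nat.card M.E ∧
        Nonempty (Iso (M'.comp N) M) := by
  by_cases hA : ∃ t, M.graph.src t ∈ Set.range M.j ∧ M.graph.tgt t ∈ Set.range M.j
  · obtain ⟨t, hs, ht⟩ := hA
    obtain ⟨M', N, h1, h2, h3⟩ := hM.exists_peel_type2 hs ht
    exact ⟨M', N, h1, Or.inr h2, h3⟩
  obtain ⟨T, hT⟩ := hM
  by_cases hB : ∃ t ∈ T, M.graph.tgt t ∈ Set.range M.j ∧
      ∀ e, M.graph.src e = M.graph.tgt t → e = M.graph.rev t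
  · obtain ⟨t, ht, ⟨q, hq⟩, honly⟩ := hB
    obtain ⟨M', N, h1, h2, h3⟩ := exists_peel_type1 hT ht hq honly
    exact ⟨M', N, h1, Or.inl h2, h3⟩
  exfalso
  push Not at hA hB
  have hnext : ∀ e, M.graph.tgt e ∉ Set.range M.j → ∃ e' ∈ T, M.graph.tgt e = M.graph.src e' := by
    intro e he
    obtain ⟨e', he', hs⟩ := (hT.src_image _).2 he
    exact ⟨e', he', hs.symm⟩
  have hZ := hT.eq_empty (T ∪ {e | M.graph.rev e ∉ T ∧ M.graph.src e ∈ Set.range M.j}) ?_ ?_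
  · have hT0 : T = ∅ := (Set.union_empty_iff.1 hZ).1
    subst hT0
    refine h2 fun x => ⟨?_, ?_⟩
    · have := hT.tgt_image x
      simpa using this
    · have := hT.src_image x
      simpa using this
  · rintro e (he | he)
    · exact hT.rev_notMem e he
    · exact he.1
  · rintro e (he | ⟨he, hs⟩)
    · by_cases hj : M.graph.tgt e ∈ Set.range M.j
      · obtain ⟨e', hs, hne⟩ := hB e he hj
        refine ⟨e', Or.inr ⟨fun hr => hne ?_, hs ▸ hj⟩, hs.symm, Or.inl he⟩
        rw [← hT.injOn_tgt hr he (by rw [M.graph.tgt_rev, hs]), M.graph.rev_rev]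
      · obtain ⟨e', he', hs⟩ := hnext e hj
        exact ⟨e', Or.inl he', hs, Or.inl he⟩
    · obtain ⟨e', he', hs⟩ := hnext e (hA e hs)
      exact ⟨e', Or.inl he', hs, Or.inr he'⟩

theorem HasScaffold.hasFactorization12 {M : InOutGraph.{u, v} P Q} (hM : M.HasScaffold) :
    HasFactorization12 M := by
  induction hn : Nat.card M.E using Nat.strong_induction_on generalizing M with
  | _ n ih =>
    by_cases h2 : M.IsType2
    · exact HasFactorization12.single M (Or.inr h2)
    obtain ⟨M', N, h1, hN, hlt, ⟨f⟩⟩ := hM.exists_peel h2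
    exact HasFactorization12.iso _ _ f
      (HasFactorization12.comp M' N (ih _ (hn ▸ hlt) h1 rfl) hN)

end Peeling

end InOutGraph

theorem hasFactorization12_inOut_iff {V : Type u} {E : Type v} [Finite V] [Finite E]
    (G : Multigraph V E) (P Q : Set V) :
    (G.inOut P Q).HasFactorization12 ↔ ∃ T : Set E, IsDirectedScaffold G P Q T := by
  have h : (G.inOut P Q).HasScaffold ↔ ∃ T : Set E, IsDirectedScaffold G P Q T := by
    have hi : Set.range (G.inOut P Q).i = P := Subtype.range_coe
    have hj : Set.range (G.inOut P Q).j = Q := Subtype.range_coe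
    unfold InOutGraph.HasScaffold
    rw [hi, hj]
    exact Iff.rfl
  rw [← h]
  exact ⟨InOutGraph.HasFactorization12.hasScaffold, InOutGraph.HasScaffold.hasFactorization12⟩

/-! ### The mixed boundary value problem -/

section Green

variable {V : Type u} {E : Type v} {F : Type w} [Field F] [Fintype E]

open Classical in
/-- The net flow into `p`. -/
noncomputable def divergence (G : Multigraph V E) (c : E → F) (p : V) : F :=
  ∑ e : E with G.tgt e = p, c e

theorem laplacian_eq_divergence (G : Multigraph V E) (c : E → F) (a : V → F) :
    laplacian G c a = divergence G (fun e => c e * (a (G.tgt e) - a (G.src e))) := rfl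

theorem sum_mul_divergence [Fintype V] (G : Multigraph V E) (c : E → F) (h : V → F) :
    ∑ p, h p * divergence G c p = ∑ e, h (G.tgt e) * c e := by
  classical
  rw [← Finset.sum_fiberwise Finset.univ G.tgt]
  refine Finset.sum_congr rfl fun p _ => ?_
  rw [divergence, Finset.mul_sum]
  refine Finset.sum_congr (by congr) fun e he => ?_
  rw [(Finset.mem_filter.1 he).2]

theorem sum_comp_rev (G : Multigraph V E) (f : E → F) : ∑ e, f (G.rev e) = ∑ e, f e :=
  Equiv.sum_comp (Function.Involutive.toPerm G.rev G.rev_rev) f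

/-- Green's identity. -/
theorem sum_mul_laplacian_comm [Fintype V] (G : Multigraph V E) {c : E → F} (hc : IsWeight G c)
    (a b : V → F) : ∑ p, a p * laplacian G c b p = ∑ p, b p * laplacian G c a p := by
  simp only [laplacian_eq_divergence, sum_mul_divergence]
  have h := sum_comp_rev G (fun e => a (G.tgt e) * (c e * b (G.src e)))
  simp only [hc.2, G.src_rev, G.tgt_rev] at h
  have h1 : ∑ e, a (G.tgt e) * (c e * (b (G.tgt e) - b (G.src e))) =
      ∑ e, a (G.tgt e) * (c e * b (G.tgt e)) - ∑ e, a (G.tgt e) * (c e * b (G.src e)) := by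
    rw [← Finset.sum_sub_distrib]
    exact Finset.sum_congr rfl fun e _ => by ring
  have h2 : ∑ e, b (G.tgt e) * (c e * (a (G.tgt e) - a (G.src e))) =
      ∑ e, a (G.tgt e) * (c e * b (G.tgt e)) - ∑ e, a (G.src e) * (c e * b (G.tgt e)) := by
    rw [← Finset.sum_sub_distrib]
    exact Finset.sum_congr rfl fun e _ => by ring
  rw [h1, h2, h]

theorem laplacian_zero (G : Multigraph V E) (c : E → F) (p : V) : laplacian G c 0 p = 0 := by
  simp [laplacian]

/-- If potentials on `P` and net currents on `P \ Q` can be prescribed, then the problem in which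
potentials on `Q` and net currents on `Q \ P` are prescribed has at most one solution. -/
theorem MixedProblemSolvable.eq_zero [Fintype V] {G : BoundaryGraph V E} {P Q : Set V}
    (hb : G.boundary = P ∪ Q) (h : MixedProblemSolvable F G P Q) {c : E → F}
    (hc : IsWeight G.toMultigraph c) {a : V → F} (haQ : ∀ q ∈ Q, a q = 0)
    (haP : ∀ p, p ∉ P → laplacian G.toMultigraph c a p = 0) : a = 0 := by
  classical
  have key : ∀ (φ : P → F) (ψ : ↥(P \ Q) → F),
      ∑ p, (if h : p ∈ P \ Q then a p * ψ ⟨p, h⟩ else 0) =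
        ∑ p, if h : p ∈ P then φ ⟨p, h⟩ * laplacian G.toMultigraph c a p else 0 := by
    intro φ ψ
    obtain ⟨b, ⟨hb1, hb2, hb3⟩, -⟩ := h c hc φ ψ
    have hG := sum_mul_laplacian_comm G.toMultigraph hc a b
    convert hG using 1
    · refine Finset.sum_congr rfl fun p _ => ?_
      split_ifs with hp
      · rw [← hb3 ⟨p, hp⟩]
      · by_cases hq : p ∈ Q
        · rw [haQ p hq, zero_mul]
        · have hpP : p ∉ P := fun h' => hp ⟨h', hq⟩
          rw [hb1 p (by rw [hb]; rintro (h | h) <;> contradiction), mul_zero]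
    · refine Finset.sum_congr rfl fun p _ => ?_
      split_ifs with hp
      · rw [← hb2 ⟨p, hp⟩]
      · rw [haP p hp, mul_zero]
  have h1 : ∀ p ∈ P, a p = 0 := by
    intro p hp
    by_cases hq : p ∈ Q
    · exact haQ p hq
    have := key 0 (Pi.single ⟨p, hp, hq⟩ 1)
    rw [Finset.sum_eq_single p, dif_pos ⟨hp, hq⟩] at this
    · simpa using this
    · intro x _ hx
      split_ifs with hxP
      · rw [Pi.single_eq_of_ne (fun h => hx (congrArg Subtype.val h)), mul_zero]
      · rfl
    · simp
  have h2 : ∀ p ∈ P, laplacian G.toMultigraph c a p = 0 := by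
    intro p hp
    have := key (Pi.single ⟨p, hp⟩ 1) 0
    symm at this
    rw [Finset.sum_eq_single p, dif_pos hp] at this
    · simpa using this
    · intro x _ hx
      split_ifs with hxP
      · rw [Pi.single_eq_of_ne (fun h => hx (congrArg Subtype.val h)), zero_mul]
      · rfl
    · simp
  have hall : ∀ p, laplacian G.toMultigraph c a p = 0 := fun p => by
    by_cases hp : p ∈ P
    · exact h2 p hp
    · exact haP p hp
  exact (h c hc 0 0).unique ⟨fun p _ => hall p, fun p => h1 p p.2, fun p => hall p⟩
    ⟨fun p _ => laplacian_zero _ _ _, fun p => rfl, fun p => laplacian_zero _ _ _⟩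

end Green

section Rank

variable {V : Type u} {E : Type v} {F : Type w} [Field F]

theorem extendByZero_apply_mem {P : Set V} (x : P → F) {p : V} (hp : p ∈ P) :
    Function.ExtendByZero.linearMap F (Subtype.val : P → V) x p = x ⟨p, hp⟩ :=
  Subtype.val_injective.extend_apply x 0 ⟨p, hp⟩

theorem extendByZero_apply_notMem {P : Set V} (x : P → F) {p : V} (hp : p ∉ P) :
    Function.ExtendByZero.linearMap F (Subtype.val : P → V) x p = 0 :=
  Function.extend_apply' x (0 : V → F) p (by rintro ⟨q, rfl⟩; exact hp q.2)

variable [Fintype V] [Fintype E]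

theorem finrank_boundary_data (P : Set V) :
    Module.finrank F ((P → F) × (P → F)) = 2 * P.ncard := by
  classical
  rw [Module.finrank_prod, Module.finrank_fintype_fun_eq_card, ← Nat.card_eq_fintype_card,
    Nat.card_coe_set_eq, two_mul]

theorem MixedProblemSolvable.fullRank {G : BoundaryGraph V E} {P Q : Set V} {n : ℕ}
    (hb : G.boundary = P ∪ Q) (hP : P.ncard = n) (h : MixedProblemSolvable F G P Q) :
    FullRank F G P Q n := by
  classical
  intro c hc
  set X := boundaryRelation G.toMultigraph c (Subtype.val : P → V) (Subtype.val : Q → V) with hX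
  have hdom : X.map (LinearMap.fst F _ _) = ⊤ := by
    rw [eq_top_iff]
    rintro ⟨x₁, x₂⟩ -
    obtain ⟨a, ⟨h1, h2, h3⟩, -⟩ := h c hc x₁ (fun p => - x₂ ⟨p, p.2.1⟩)
    refine ⟨((x₁, x₂), (fun q => a q, fun q => laplacian G.toMultigraph c a q +
      Function.ExtendByZero.linearMap F (Subtype.val : P → V) x₂ q)), ⟨a, ?_, rfl, ?_⟩, rfl⟩
    · funext p; exact h2 p
    · funext p
      rw [Pi.sub_apply]
      by_cases hq : p ∈ Q
      · rw [extendByZero_apply_mem _ hq]; simp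
      · rw [extendByZero_apply_notMem _ hq]
        by_cases hp : p ∈ P
        · rw [extendByZero_apply_mem _ hp, h3 ⟨p, hp, hq⟩, zero_sub]
        · rw [extendByZero_apply_notMem _ hp, sub_zero]
          exact h1 p (by rw [hb]; rintro (h | h) <;> contradiction)
  have hker : X.comap (LinearMap.inl F _ _) = ⊥ := by
    rw [eq_bot_iff]
    rintro ⟨x₁, x₂⟩ ⟨a, h1, h2, h3⟩
    have ha : a = 0 := by
      refine h.eq_zero hb hc (fun q hq => congrFun h2 ⟨q, hq⟩) fun p hp => ?_
      rw [h3, Pi.sub_apply]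
      change Function.ExtendByZero.linearMap F (Subtype.val : Q → V) 0 p - _ = _
      rw [map_zero, Pi.zero_apply, zero_sub]
      exact neg_eq_zero.2 (extendByZero_apply_notMem _ hp)
    subst ha
    rw [Submodule.mem_bot, Prod.mk_eq_zero]
    refine ⟨h1.symm, funext fun p => ?_⟩
    have := congrFun h3 p
    rw [laplacian_zero, Pi.sub_apply] at this
    change 0 = Function.ExtendByZero.linearMap F (Subtype.val : Q → V) 0 p -
      Function.ExtendByZero.linearMap F (Subtype.val : P → V) x₂ p at this
    rw [extendByZero_apply_mem _ p.2, map_zero, Pi.zero_apply, zero_sub, eq_comm,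
      neg_eq_zero] at this
    exact this
  rw [relRank, hdom, hker, finrank_top, finrank_bot, finrank_boundary_data, hP, Nat.sub_zero]

theorem FullRank.eq_zero {G : BoundaryGraph V E} {P Q : Set V} {n : ℕ} (hP : P.ncard = n)
    (h : FullRank F G P Q n) {c : E → F} (hc : IsWeight G.toMultigraph c) {a : V → F}
    (haQ : ∀ q ∈ Q, a q = 0) (haP : ∀ p, p ∉ P → laplacian G.toMultigraph c a p = 0) :
    (∀ p ∈ P, a p = 0) ∧ ∀ p, laplacian G.toMultigraph c a p = 0 := by
  classical
  have hr := h c hc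
  set X := boundaryRelation G.toMultigraph c (Subtype.val : P → V) (Subtype.val : Q → V) with hX
  have h1 := Submodule.finrank_le (X.map (LinearMap.fst F _ _))
  have h2 := Submodule.finrank_le (X.comap (LinearMap.inl F _ _))
  rw [finrank_boundary_data, hP] at h1 h2
  rw [relRank] at hr
  have h0 : Module.finrank F (X.comap (LinearMap.inl F _ _)) = 0 := by omega
  rw [Submodule.finrank_eq_zero] at h0
  have hmem : ((fun p : P => a p), fun p : P => - laplacian G.toMultigraph c a p) ∈
      X.comap (LinearMap.inl F _ _) := by
    refine ⟨a, rfl, funext fun q => haQ q q.2, funext fun p => ?_⟩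
    rw [Pi.sub_apply]
    change _ = Function.ExtendByZero.linearMap F (Subtype.val : Q → V) 0 p -
      Function.ExtendByZero.linearMap F (Subtype.val : P → V)
        (fun p : P => - laplacian G.toMultigraph c a p) p
    rw [map_zero, Pi.zero_apply, zero_sub]
    by_cases hp : p ∈ P
    · rw [extendByZero_apply_mem _ hp, neg_neg]
    · rw [extendByZero_apply_notMem _ hp, neg_zero, haP p hp]
  rw [h0, Submodule.mem_bot, Prod.mk_eq_zero] at hmem
  refine ⟨fun p hp => congrFun hmem.1 ⟨p, hp⟩, fun p => ?_⟩
  by_cases hp : p ∈ P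
  · exact neg_eq_zero.1 (congrFun hmem.2 ⟨p, hp⟩)
  · exact haP p hp

end Rank

section Permutation

variable {V : Type u} {E : Type v} {G : BoundaryGraph V E} {P Q : Set V}

theorem HasUniqueFullConnection.exists_cover (hb : G.boundary = P ∪ Q)
    (h : HasUniqueFullConnection G P Q) :
    ∃ C : Set (SimplePath G.toMultigraph), IsCompleteConnection G.toMultigraph P Q C ∧
      (∀ C', IsCompleteConnection G.toMultigraph P Q C' → C' = C) ∧
      ∀ x, ∃ α ∈ C, x ∈ α.support := by
  obtain ⟨C, hC, huniq, hcov⟩ := h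
  refine ⟨C, hC, huniq, fun x => ?_⟩
  by_cases hx : x ∈ G.boundary
  · rw [hb] at hx
    exact hC.2 x hx
  · exact hcov x hx

/-- If the complete connection is unique, then any permutation that carries `Q` to `P` and moves
every other vertex, if at all, along an edge, moves all of them along the edges of the connection.
-/
theorem mem_usedEdges_of_perm [Finite V] {C : Set (SimplePath G.toMultigraph)}
    (huniq : ∀ C', IsCompleteConnection G.toMultigraph P Q C' → C' = C)
    (hcover : ∀ x, ∃ α ∈ C, x ∈ α.support) (hcard : P.ncard = Q.ncard) {τ : Equiv.Perm V}
    (hτ : ∀ x, τ x ∈ P ↔ x ∈ Q) {t : V → E}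
    (ht : ∀ x, x ∉ Q → τ x = x ∨ (G.src (t x) = x ∧ G.tgt (t x) = τ x)) {x : V} (hx : x ∉ Q) :
    τ x ≠ x ∧ t x ∈ usedEdges C := by
  have ht' : ∀ x, x ∉ Q → τ x ≠ x → G.src (t x) = x ∧ G.tgt (t x) = τ x := fun x hx h =>
    (ht x hx).resolve_left h
  let T : Set E := {e | ∃ x, x ∉ Q ∧ τ x ≠ x ∧ e = t x}
  have hC : IsCompleteConnection G.toMultigraph P Q (pathsIn G.toMultigraph P Q T) := by
    refine isCompleteConnection_pathsIn ?_ ?_ ?_ ?_ ?_ ?_ hcard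
    · rintro _ ⟨x, hx, hxx, rfl⟩ _ ⟨y, hy, hyy, rfl⟩ h
      rw [(ht' x hx hxx).1, (ht' y hy hyy).1] at h
      rw [h]
    · rintro _ ⟨x, hx, hxx, rfl⟩ _ ⟨y, hy, hyy, rfl⟩ h
      rw [(ht' x hx hxx).2, (ht' y hy hyy).2] at h
      rw [τ.injective h]
    · rintro _ ⟨x, hx, hxx, rfl⟩
      rwa [(ht' x hx hxx).1]
    · rintro _ ⟨x, hx, hxx, rfl⟩
      rwa [(ht' x hx hxx).2, hτ]
    · intro x hxP hxQ
      have hxx : τ x ≠ x := fun h => hxQ ((hτ x).1 (h.symm ▸ hxP))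
      exact ⟨t x, ⟨x, hxQ, hxx, rfl⟩, (ht' x hxQ hxx).1⟩
    · rintro _ ⟨x, hx, hxx, rfl⟩ hQ
      rw [(ht' x hx hxx).2] at hQ ⊢
      have hxx' : τ (τ x) ≠ τ x := fun h => hxx (τ.injective h)
      exact ⟨t (τ x), ⟨τ x, hQ, hxx', rfl⟩, (ht' _ hQ hxx').1⟩
  obtain ⟨α, hα, hmem⟩ := hcover x
  rw [← huniq _ hC] at hα
  obtain ⟨e, he, hes⟩ := hC.1.mem_src_image hα hmem hx
  obtain ⟨y, hy, hyy, rfl⟩ := hα.2.2 e he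
  rw [(ht' y hy hyy).1] at hes
  subst hes
  refine ⟨hyy, α, ?_, he⟩
  rw [← huniq _ hC]
  exact hα

theorem HasUniqueFullConnection.two_le_degree [Finite E] (hb : G.boundary = P ∪ Q)
    (h : HasUniqueFullConnection G P Q) {x : V} (hx : x ∉ G.boundary) : 2 ≤ G.degree x := by
  obtain ⟨C, hC, -, hcov⟩ := h.exists_cover hb
  rw [hb] at hx
  obtain ⟨α, hα, hmem⟩ := hcov x
  obtain ⟨e, he, hes⟩ := hC.1.mem_src_image hα hmem (fun h => hx (Or.inr h))
  obtain ⟨e', he', het⟩ := hC.1.mem_tgt_image hα hmem (fun h => hx (Or.inl h))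
  have hne : G.rev e ≠ e' := by
    rintro rfl
    -- The two end points of `e` would follow each other on the path, in both directions.
    have hstart : α.start ∈ ({G.src e, G.tgt e} : Set V) := by
      refine α.isWalk.start_mem (T := {e | e ∈ α.edges}) (fun _ h => h) ?_
        (SimplePath.src_mem_support he) (by simp)
      rintro f hf (hf' | hf')
      · rw [SimplePath.tgt_inj hf he' (hf'.trans (G.tgt_rev e).symm)]
        exact Or.inr (G.src_rev e)
      · rw [SimplePath.tgt_inj hf he hf']
        exact Or.inl rfl
    rcases hstart with h' | h'
    · exact SimplePath.tgt_ne_start he' ((G.tgt_rev e).trans h'.symm)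
    · exact SimplePath.tgt_ne_start he h'.symm
  have hsub : ({G.rev e, e'} : Set E) ⊆ {e | G.tgt e = x} := by
    rintro _ (rfl | rfl)
    · exact (G.tgt_rev e).trans hes
    · exact het
  calc 2 = ({G.rev e, e'} : Set E).ncard := (Set.ncard_pair hne).symm
    _ ≤ _ := Set.ncard_le_ncard hsub (Set.toFinite _)

end Permutation

section Mixed

variable {V : Type u} {E : Type v} {F : Type w} [Field F] [Fintype E]

open Classical in
/-- The operator whose value at a point outside `Q` is the net current, and whose value at a point
`x` of `Q` is the potential at `π x`. For a permutation `π` with `π Q = P` it collects the data of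
the mixed boundary value problem. -/
noncomputable def mixedOperator (G : Multigraph V E) (c : E → F) (Q : Set V) (π : Equiv.Perm V) :
    (V → F) →ₗ[F] (V → F) where
  toFun a x := if x ∈ Q then a (π x) else laplacian G c a x
  map_add' a b := by
    funext x
    simp only [Pi.add_apply, laplacian_add]
    split_ifs <;> rfl
  map_smul' t a := by
    funext x
    simp only [Pi.smul_apply, laplacian_smul, RingHom.id_apply]
    split_ifs <;> rfl

theorem mixedOperator_apply_mem (G : Multigraph V E) (c : E → F) {Q : Set V} (π : Equiv.Perm V)
    (a : V → F) {x : V} (hx : x ∈ Q) : mixedOperator G c Q π a x = a (π x) := if_pos hx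

theorem mixedOperator_apply_notMem (G : Multigraph V E) (c : E → F) {Q : Set V}
    (π : Equiv.Perm V) (a : V → F) {x : V} (hx : x ∉ Q) :
    mixedOperator G c Q π a x = laplacian G c a x := if_neg hx

theorem exists_edge_of_laplacian_single_ne_zero [DecidableEq V] {G : Multigraph V E} {c : E → F}
    {x y : V} (h : laplacian G c (Pi.single y 1) x ≠ 0) :
    y = x ∨ ∃ e, G.src e = x ∧ G.tgt e = y := by
  obtain ⟨e, he, hne⟩ := Finset.exists_ne_zero_of_sum_ne_zero h
  have he : G.tgt e = x := by simpa using he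
  by_contra hno
  push Not at hno
  have h1 : G.tgt e ≠ y := fun h' => hno.1 (h'.symm.trans he)
  have h2 : G.src e ≠ y := fun h' => hno.2 (G.rev e) (by rw [G.src_rev, he]) (by rw [G.tgt_rev, h'])
  simp [Pi.single_eq_of_ne h1, Pi.single_eq_of_ne h2] at hne

variable [Fintype V]

theorem exists_perm_image {P Q : Set V} (h : P.ncard = Q.ncard) :
    ∃ π : Equiv.Perm V, ∀ x, π x ∈ P ↔ x ∈ Q := by
  classical
  have hcard : Nat.card {x // x ∈ Q} = Nat.card {x // x ∈ P} := by
    change Nat.card Q = Nat.card P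
    rw [Nat.card_coe_set_eq, Nat.card_coe_set_eq, h]
  obtain ⟨e⟩ := Finite.card_eq.1 hcard
  refine ⟨e.extendSubtype, fun x => ⟨fun hx => ?_, fun hx => e.extendSubtype_mem x hx⟩⟩
  by_contra hxQ
  exact e.extendSubtype_not_mem x hxQ hx

theorem injective_iff_det_toMatrix'_ne_zero [DecidableEq V] (L : (V → F) →ₗ[F] (V → F)) :
    (∀ a, L a = 0 → a = 0) ↔ (LinearMap.toMatrix' L).det ≠ 0 := by
  rw [Ne, ← Matrix.exists_mulVec_eq_zero_iff]
  simp only [LinearMap.toMatrix'_mulVec]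
  push Not
  exact ⟨fun h a ha h0 => ha (h a h0), fun h a h0 => by_contra fun ha => h a ha h0⟩

theorem existsUnique_of_mixedOperator {G : BoundaryGraph V E} {P Q : Set V}
    (hb : G.boundary = P ∪ Q) {π : Equiv.Perm V} (hπ : ∀ x, π x ∈ P ↔ x ∈ Q) {c : E → F}
    (hinj : ∀ a, mixedOperator G.toMultigraph c Q π a = 0 → a = 0) (φ : P → F)
    (ψ : ↥(P \ Q) → F) :
    ∃! a : V → F, IsHarmonic G c a ∧ (∀ p : P, a p = φ p) ∧
      ∀ p : ↥(P \ Q), laplacian G.toMultigraph c a p = ψ p := by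
  classical
  set L := mixedOperator G.toMultigraph c Q π
  have hLinj : Injective L := (injective_iff_map_eq_zero L).2 hinj
  have hLsurj : Surjective L := LinearMap.injective_iff_surjective.1 hLinj
  let f : V → F := fun x => if hx : x ∈ Q then φ ⟨π x, (hπ x).2 hx⟩ else
    if hx' : x ∈ P then ψ ⟨x, hx', hx⟩ else 0
  have hiff : ∀ a : V → F, (IsHarmonic G c a ∧ (∀ p : P, a p = φ p) ∧
      ∀ p : ↥(P \ Q), laplacian G.toMultigraph c a p = ψ p) ↔ L a = f := by
    intro a
    constructor
    · rintro ⟨h1, h2, h3⟩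
      funext x
      by_cases hx : x ∈ Q
      · simp only [f, dif_pos hx, L, mixedOperator_apply_mem _ _ _ _ hx]
        exact h2 ⟨π x, _⟩
      · simp only [f, dif_neg hx, L, mixedOperator_apply_notMem _ _ _ _ hx]
        split_ifs with hx'
        · exact h3 ⟨x, hx', hx⟩
        · exact h1 x (by rw [hb]; rintro (h | h) <;> contradiction)
    · intro h
      refine ⟨fun x hx => ?_, fun p => ?_, fun p => ?_⟩
      · rw [hb] at hx
        have hxQ : x ∉ Q := fun h => hx (Or.inr h)
        have hxP : x ∉ P := fun h => hx (Or.inl h)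
        have := congrFun h x
        simpa only [f, dif_neg hxQ, dif_neg hxP, L, mixedOperator_apply_notMem _ _ _ _ hxQ]
          using this
      · have hq : π.symm p ∈ Q := (hπ _).1 (by simp)
        have := congrFun h (π.symm p)
        simpa only [f, dif_pos hq, L, mixedOperator_apply_mem _ _ _ _ hq,
          Equiv.apply_symm_apply] using this
      · have := congrFun h p
        simpa only [f, dif_neg p.2.2, dif_pos p.2.1, L,
          mixedOperator_apply_notMem _ _ _ _ p.2.2] using this
  obtain ⟨a, ha⟩ := hLsurj f
  exact ⟨a, (hiff a).2 ha, fun b hb => hLinj (((hiff b).1 hb).trans ha.symm)⟩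

variable {G : BoundaryGraph V E} {P Q : Set V}

/-- In the Leibniz expansion of the determinant of the mixed problem, only the permutation given by
the unique complete connection contributes, and its term is a product of edge weights up to sign. -/
theorem HasUniqueFullConnection.mixedProblemSolvable (hloop : ∀ e, G.src e ≠ G.tgt e)
    (hb : G.boundary = P ∪ Q) (hcard : P.ncard = Q.ncard) (h : HasUniqueFullConnection G P Q) :
    MixedProblemSolvable F G P Q := by
  classical
  intro c hc
  obtain ⟨C, hC, huniq, hcov⟩ := h.exists_cover hb
  obtain ⟨π, hπ⟩ := exists_perm_image hcard
  refine existsUnique_of_mixedOperator hb hπ ((injective_iff_det_toMatrix'_ne_zero _).2 ?_)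
  have hT : ∀ x, x ∉ Q → ∃ e ∈ usedEdges C, G.src e = x := by
    intro x hx
    obtain ⟨α, hα, hmem⟩ := hcov x
    obtain ⟨e, he, hes⟩ := hC.1.mem_src_image hα hmem hx
    exact ⟨e, ⟨α, hα, he⟩, hes⟩
  have hτ₀ : ∃ τ₀ : Equiv.Perm V, (∀ x ∈ Q, τ₀ x = π x) ∧
      ∀ e ∈ usedEdges C, τ₀ (G.src e) = G.tgt e := by
    choose s hs hss using hT
    have hinj : Injective (fun x => if hx : x ∈ Q then π x else G.tgt (s x hx)) := by
      intro x y hxy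
      by_cases hx : x ∈ Q <;> by_cases hy : y ∈ Q
      · simp only [dif_pos hx, dif_pos hy] at hxy
        exact π.injective hxy
      · simp only [dif_pos hx, dif_neg hy] at hxy
        exact absurd ((hπ x).2 hx) (hxy ▸ hC.1.tgt_notMem (hs y hy))
      · simp only [dif_neg hx, dif_pos hy] at hxy
        exact absurd ((hπ y).2 hy) (hxy ▸ hC.1.tgt_notMem (hs x hx))
      · simp only [dif_neg hx, dif_neg hy] at hxy
        have := hC.1.injOn_tgt (hs x hx) (hs y hy) hxy
        rw [← hss x hx, this, hss y hy]
    refine ⟨Equiv.ofBijective _ (Finite.injective_iff_bijective.1 hinj), fun x hx => ?_,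
      fun e he => ?_⟩
    · exact dif_pos hx
    · have hx := hC.1.src_notMem he
      refine (dif_neg hx).trans ?_
      rw [hC.1.injOn_src (hs _ hx) he (hss _ hx)]
  obtain ⟨τ₀, hτ₀Q, hτ₀⟩ := hτ₀
  -- Permutations with a nonzero term satisfy the conditions of `mem_usedEdges_of_perm`.
  have hperm : ∀ τ : Equiv.Perm V, (∀ x ∈ Q, τ x = π x) → ∀ x, τ x ∈ P ↔ x ∈ Q := by
    intro τ hτ x
    constructor
    · intro hx
      have hq : π.symm (τ x) ∈ Q := (hπ _).1 (by simpa using hx)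
      have := hτ _ hq
      rw [Equiv.apply_symm_apply] at this
      rwa [← τ.injective this]
    · intro hx
      rw [hτ x hx]
      exact (hπ x).2 hx
  have hentry : ∀ x y, LinearMap.toMatrix' (mixedOperator G.toMultigraph c Q π) x y =
      mixedOperator G.toMultigraph c Q π (Pi.single y 1) x := by
    intro x y
    rw [LinearMap.toMatrix'_apply]
  rw [← Matrix.det_transpose, Matrix.det_apply', Finset.sum_eq_single τ₀]
  · refine mul_ne_zero ?_ (Finset.prod_ne_zero_iff.2 fun x _ => ?_)
    · rcases Int.units_eq_one_or (Equiv.Perm.sign τ₀) with h | h <;> simp [h]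
    · rw [Matrix.transpose_apply, hentry]
      by_cases hx : x ∈ Q
      · rw [mixedOperator_apply_mem _ _ _ _ hx, hτ₀Q x hx, Pi.single_eq_same]
        exact one_ne_zero
      rw [mixedOperator_apply_notMem _ _ _ _ hx]
      obtain ⟨e₀, he₀, hs₀⟩ := hT x hx
      have ht₀ : G.tgt e₀ = τ₀ x := by rw [← hs₀, hτ₀ e₀ he₀]
      have hne : τ₀ x ≠ x := by
        rw [← ht₀, ← hs₀]
        exact (hloop e₀).symm
      -- Parallel edges would give another complete connection.
      have huniq_edge : ∀ e, G.tgt e = x → G.src e = τ₀ x → e = G.rev e₀ := by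
        intro e he hes
        choose s hs hss using hT
        let t : V → E := fun y => if hy : y ∈ Q then e else if y = x then G.rev e else s y hy
        have hmem := (mem_usedEdges_of_perm huniq hcov hcard (hperm τ₀ hτ₀Q) (t := t) ?_ hx).2
        · have htx : t x = G.rev e := by simp [t, hx]
          rw [htx] at hmem
          rw [← hC.1.injOn_src hmem he₀ (by rw [G.src_rev, he, hs₀]), G.rev_rev]
        · intro y hy
          right
          by_cases hyx : y = x
          · subst hyx
            simp [t, hx, G.src_rev, G.tgt_rev, he, hes]
          · simp only [t, dif_neg hy, if_neg hyx]
            refine ⟨hss y hy, ?_⟩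
            rw [← hτ₀ _ (hs y hy), hss]
      rw [laplacian, Finset.sum_eq_single (G.rev e₀)]
      · rw [G.tgt_rev, G.src_rev, hs₀, ht₀, Pi.single_eq_same, Pi.single_eq_of_ne hne.symm,
          zero_sub]
        exact mul_ne_zero (hc.1 _) (neg_ne_zero.2 one_ne_zero)
      · intro e he hne'
        have he := (Finset.mem_filter.1 he).2
        have : G.src e ≠ τ₀ x := fun h' => hne' (huniq_edge e he h')
        rw [he, Pi.single_eq_of_ne hne.symm, Pi.single_eq_of_ne this, sub_zero, mul_zero]
      · intro h'
        exact absurd (Finset.mem_filter.2 ⟨Finset.mem_univ _, by rw [G.tgt_rev, hs₀]⟩) h'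
  · intro τ _ hne
    rw [mul_eq_zero]
    right
    by_contra hprod
    rw [← Ne, Finset.prod_ne_zero_iff] at hprod
    simp only [Matrix.transpose_apply, hentry] at hprod
    have hQ : ∀ x ∈ Q, τ x = π x := by
      intro x hx
      have := hprod x (Finset.mem_univ _)
      rw [mixedOperator_apply_mem _ _ _ _ hx] at this
      by_contra h'
      exact this (Pi.single_eq_of_ne (Ne.symm h') _)
    have hE : ∀ x, ∃ e : Option E, x ∉ Q →
        τ x = x ∨ ∃ e', e = some e' ∧ G.src e' = x ∧ G.tgt e' = τ x := by
      intro x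
      by_cases hx : x ∈ Q
      · exact ⟨none, fun h => absurd hx h⟩
      have := hprod x (Finset.mem_univ _)
      rw [mixedOperator_apply_notMem _ _ _ _ hx] at this
      rcases exists_edge_of_laplacian_single_ne_zero this with h' | ⟨e, he⟩
      · exact ⟨none, fun _ => Or.inl h'⟩
      · exact ⟨some e, fun _ => Or.inr ⟨e, rfl, he⟩⟩
    refine hne (Equiv.ext fun x => ?_)
    by_cases hx : x ∈ Q
    · rw [hQ x hx, hτ₀Q x hx]
    · obtain ⟨e₀, he₀, hs₀⟩ := hT x hx
      choose s hs using hE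
      have key := mem_usedEdges_of_perm huniq hcov hcard (hperm τ hQ)
        (t := fun y => (s y).getD e₀) (fun y hy => ?_) hx
      · obtain ⟨e', he', h1, h2⟩ := (hs x hx).resolve_left key.1
        have hmem : e' ∈ usedEdges C := by simpa [he'] using key.2
        rw [← h2, ← hτ₀ _ hmem, h1]
      · rcases hs y hy with h' | ⟨e', he', h'⟩
        · exact Or.inl h'
        · right
          simpa [he'] using h'
  · exact fun h' => absurd (Finset.mem_univ _) h'

end Mixed

/-! ### Harmonic subgraphs and scaffolds -/

section NoOneBoundary

variable {V : Type u} {E : Type v}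

/-- A path of the scaffold through an interior vertex of a harmonic subgraph has to enter and to
leave the subgraph at different boundary vertices. -/
theorem IsDirectedScaffold.noOneBoundarySubgraph [Finite V] {G : BoundaryGraph V E} {P Q : Set V}
    {T : Set E} (h : IsDirectedScaffold G.toMultigraph P Q T) (hb : G.boundary = P ∪ Q)
    (hloop : ∀ e, G.src e ≠ G.tgt e) : NoOneBoundarySubgraph G := by
  rintro ⟨H, hnt, x, hx⟩
  obtain ⟨d, hd⟩ := h.exists_height
  have hxmem : x ∈ H.verts ∧ x ∉ H.interior := by
    have : x ∈ H.verts \ H.interior := by rw [hx]; rfl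
    exact this
  have hverts : ∀ y ∈ H.verts, y ∉ H.interior → y = x := fun y hy hy' => by
    have : y ∈ H.verts \ H.interior := ⟨hy, hy'⟩
    rwa [hx] at this
  have hnot : ∀ y ∈ H.interior, y ∉ P ∧ y ∉ Q := fun y hy => by
    have := H.interior_disjoint y hy
    rw [hb] at this
    exact ⟨fun h => this (Or.inl h), fun h => this (Or.inr h)⟩
  have hlow : ∀ n, ∀ y ∈ H.interior, d y = n → d x < d y := by
    intro n
    induction n using Nat.strong_induction_on with
    | _ n ih =>
      rintro y hy rfl
      obtain ⟨e, he, rfl⟩ := (h.src_image y).2 (hnot y hy).2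
      have hmem : e ∈ H.edges := by
        have := H.rev_mem _ (H.star_subset _ hy (G.rev e) (G.tgt_rev e))
        rwa [G.rev_rev] at this
      by_cases hi : G.tgt e ∈ H.interior
      · exact (ih _ (hd e he) _ hi rfl).trans (hd e he)
      · rw [← hverts _ (H.tgt_mem e hmem) hi]
        exact hd e he
  have hempty : H.interior = ∅ := by
    by_contra hne
    obtain ⟨y, hy, hmax⟩ := Set.exists_max_image H.interior d (Set.toFinite _)
      (Set.nonempty_iff_ne_empty.2 hne)
    obtain ⟨e, he, rfl⟩ := (h.tgt_image y).2 (hnot y hy).1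
    have hmem : G.src e ∈ H.verts := by
      rw [← G.tgt_rev]
      exact H.tgt_mem _ (H.rev_mem _ (H.star_subset _ hy e rfl))
    have h1 := hlow _ _ hy rfl
    have h2 := hd e he
    by_cases hi : G.src e ∈ H.interior
    · exact absurd (hmax _ hi) (not_le.2 h2)
    · rw [hverts _ hmem hi] at h2
      exact lt_asymm h1 h2
  have hall : ∀ y ∈ H.verts, y = x := fun y hy => hverts y hy (by rw [hempty]; simp)
  rcases hnt with ⟨y, hy, z, hz, hyz⟩ | ⟨e, he⟩
  · exact hyz ((hall y hy).trans (hall z hz).symm)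
  · refine hloop e ?_
    rw [← G.tgt_rev, hall _ (H.tgt_mem _ (H.rev_mem e he)), hall _ (H.tgt_mem e he)]

end NoOneBoundary

/-! ### Rooted forests -/

section Forest

variable {V : Type u} {E : Type v}

/-- A spanning forest in which every component contains exactly one point of `R`, its root. It is
given by the first edge `next x` of the path from `x` to the root, for `x` outside `R`; the function
`rank` decreases along these paths. The values of `next` on `R` are irrelevant. -/
structure RootedForest (G : Multigraph V E) (R : Set V) where
  next : V → E
  rank : V → ℕ
  src_next : ∀ x, x ∉ R → G.src (next x) = x
  rank_lt : ∀ x, x ∉ R → rank (G.tgt (next x)) < rank x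

namespace RootedForest

variable {G : Multigraph V E} {R : Set V} (f : RootedForest G R)

open Classical in
/-- The next vertex on the way to the root; a root is its own parent. -/
noncomputable def parent (x : V) : V := if x ∈ R then x else G.tgt (f.next x)

/-- The vertices whose path to the root passes through `x`. -/
def subtree (x : V) : Set V := {y | ∃ k : ℕ, f.parent^[k] y = x}

/-- The edges of the forest, with both orientations. -/
def edgeSet : Set E := {e | ∃ x, x ∉ R ∧ (e = f.next x ∨ e = G.rev (f.next x))}

variable {f}

theorem parent_of_mem {x : V} (hx : x ∈ R) : f.parent x = x := if_pos hx

theorem parent_of_notMem {x : V} (hx : x ∉ R) : f.parent x = G.tgt (f.next x) := if_neg hx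

theorem mem_subtree_self (x : V) : x ∈ f.subtree x := ⟨0, rfl⟩

theorem mem_subtree_iff_parent {x y : V} (h : y ≠ x) :
    y ∈ f.subtree x ↔ f.parent y ∈ f.subtree x := by
  constructor
  · rintro ⟨_ | k, hk⟩
    · exact absurd hk h
    · exact ⟨k, hk⟩
  · rintro ⟨k, hk⟩
    exact ⟨k + 1, hk⟩

theorem mem_subtree_of_parent {x y : V} (h : f.parent y ∈ f.subtree x) : y ∈ f.subtree x := by
  obtain ⟨k, hk⟩ := h
  exact ⟨k + 1, hk⟩

theorem notMem_subtree_of_mem {x y : V} (hx : x ∉ R) (hy : y ∈ R) : y ∉ f.subtree x := by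
  rintro ⟨k, hk⟩
  rw [Function.iterate_fixed (parent_of_mem hy)] at hk
  exact hx (hk ▸ hy)

theorem rank_parent_le (y : V) : f.rank (f.parent y) ≤ f.rank y := by
  by_cases hy : y ∈ R
  · rw [parent_of_mem hy]
  · rw [parent_of_notMem hy]
    exact (f.rank_lt y hy).le

theorem rank_le_of_mem_subtree {x y : V} (h : y ∈ f.subtree x) : f.rank x ≤ f.rank y := by
  obtain ⟨k, rfl⟩ := h
  induction k generalizing y with
  | zero => exact le_rfl
  | succ k ih => exact (ih (y := f.parent y)).trans (rank_parent_le y)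

theorem parent_notMem_subtree {x : V} (hx : x ∉ R) : f.parent x ∉ f.subtree x := by
  intro h
  have h1 := rank_le_of_mem_subtree h
  rw [parent_of_notMem hx] at h1
  exact absurd h1 (not_le.2 (f.rank_lt x hx))

theorem exists_iterate_parent_mem (y : V) : ∃ k, f.parent^[k] y ∈ R := by
  induction hn : f.rank y using Nat.strong_induction_on generalizing y with
  | _ n ih =>
    by_cases hy : y ∈ R
    · exact ⟨0, hy⟩
    · obtain ⟨k, hk⟩ := ih _ (by rw [← hn, parent_of_notMem hy]; exact f.rank_lt y hy)
        (f.parent y) rfl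
      exact ⟨k + 1, hk⟩

theorem next_inj {x y : V} (hx : x ∉ R) (hy : y ∉ R) (h : f.next x = f.next y) : x = y := by
  rw [← f.src_next x hx, h, f.src_next y hy]

theorem next_ne_rev {x y : V} (hx : x ∉ R) (hy : y ∉ R) : f.next x ≠ G.rev (f.next y) := by
  intro h
  have h1 : x = G.tgt (f.next y) := by rw [← f.src_next x hx, h, G.src_rev]
  have h2 : G.tgt (f.next x) = y := by rw [h, G.tgt_rev, f.src_next y hy]
  have h3 := f.rank_lt x hx
  have h4 := f.rank_lt y hy
  rw [h2] at h3
  rw [← h1] at h4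
  omega

theorem next_mem_edgeSet {x : V} (hx : x ∉ R) : f.next x ∈ f.edgeSet := ⟨x, hx, Or.inl rfl⟩

theorem rev_mem_edgeSet {e : E} (h : e ∈ f.edgeSet) : G.rev e ∈ f.edgeSet := by
  obtain ⟨x, hx, rfl | rfl⟩ := h
  · exact ⟨x, hx, Or.inr rfl⟩
  · exact ⟨x, hx, Or.inl (G.rev_rev _)⟩

theorem rev_notMem_edgeSet {e : E} (h : e ∉ f.edgeSet) : G.rev e ∉ f.edgeSet := fun h' =>
  h (by rw [← G.rev_rev e]; exact rev_mem_edgeSet h')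

end RootedForest

/-- Exactly one end point of the edge `e` lies in `A`. -/
def Separates (G : Multigraph V E) (A : Set V) (e : E) : Prop := ¬ (G.src e ∈ A ↔ G.tgt e ∈ A)

theorem Separates.rev {G : Multigraph V E} {A : Set V} {e : E} (h : Separates G A e) :
    Separates G A (G.rev e) := by
  rw [Separates, G.src_rev, G.tgt_rev]
  exact fun h' => h h'.symm

theorem separates_rev_iff {G : Multigraph V E} {A : Set V} {e : E} :
    Separates G A (G.rev e) ↔ Separates G A e :=
  ⟨fun h => by simpa only [G.rev_rev] using h.rev, Separates.rev⟩

/-- An edge of the forest crosses the boundary of the subtree of `x` only if it starts at `x`. -/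
theorem RootedForest.separates_next_iff {G : Multigraph V E} {R : Set V} {f : RootedForest G R}
    {x y : V} (hx : x ∉ R) (hy : y ∉ R) : Separates G (f.subtree x) (f.next y) ↔ y = x := by
  rw [Separates, f.src_next y hy, ← parent_of_notMem hy]
  constructor
  · intro h
    by_contra hne
    exact h (mem_subtree_iff_parent hne)
  · rintro rfl h
    exact parent_notMem_subtree hy (h.1 (mem_subtree_self y))

theorem RootedForest.eq_of_separates {G : Multigraph V E} {R : Set V} {f : RootedForest G R}
    {x : V} (hx : x ∉ R) {e : E} (he : e ∈ f.edgeSet) (h : Separates G (f.subtree x) e) :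
    e = f.next x ∨ e = G.rev (f.next x) := by
  obtain ⟨y, hy, rfl | rfl⟩ := he
  · left
    rw [(separates_next_iff hx hy).1 h]
  · right
    rw [separates_rev_iff] at h
    rw [(separates_next_iff hx hy).1 h]

end Forest

/-! ### Fundamental flows and fundamental cuts of a rooted forest -/

section Flow

variable {V : Type u} {E : Type v} {F : Type w} [Field F]

open Classical in
/-- The unit flow along the edge `e`. -/
noncomputable def edgeFlow (F : Type w) [Field F] (G : Multigraph V E) (e : E) (e' : E) : F :=
  (if e' = e then 1 else 0) - if e' = G.rev e then 1 else 0

theorem edgeFlow_rev (G : Multigraph V E) (e e' : E) :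
    edgeFlow F G e (G.rev e') = - edgeFlow F G e e' := by
  classical
  have h1 : G.rev e' = e ↔ e' = G.rev e :=
    ⟨fun h => by rw [← h, G.rev_rev], fun h => by rw [h, G.rev_rev]⟩
  have h2 : G.rev e' = G.rev e ↔ e' = e :=
    ⟨fun h => by rw [← G.rev_rev e', h, G.rev_rev], fun h => by rw [h]⟩
  simp only [edgeFlow, neg_sub]
  rw [if_congr h1 rfl rfl, if_congr h2 rfl rfl]

theorem edgeFlow_self (G : Multigraph V E) (e : E) : edgeFlow F G e e = 1 := by
  simp [edgeFlow, (G.rev_ne e).symm]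

theorem edgeFlow_of_ne (G : Multigraph V E) {e e' : E} (h1 : e' ≠ e) (h2 : e' ≠ G.rev e) :
    edgeFlow F G e e' = 0 := by
  simp [edgeFlow, h1, h2]

/-- The net flow into the vertices, as a linear map. -/
noncomputable def divergenceMap (F : Type w) [Field F] [Fintype E] (G : Multigraph V E) :
    (E → F) →ₗ[F] (V → F) where
  toFun c := divergence G c
  map_add' a b := by
    funext p
    simp only [divergence, Pi.add_apply, Finset.sum_add_distrib]
  map_smul' t a := by
    funext p
    simp only [divergence, Pi.smul_apply, smul_eq_mul, Finset.mul_sum, RingHom.id_apply]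

theorem divergenceMap_apply [Fintype E] (G : Multigraph V E) (c : E → F) (p : V) :
    divergenceMap F G c p = divergence G c p := rfl

theorem divergence_edgeFlow [Fintype E] [DecidableEq V] (G : Multigraph V E) (e : E) (p : V) :
    divergence G (edgeFlow F G e) p =
      (if G.tgt e = p then 1 else 0) - if G.src e = p then 1 else 0 := by
  simp only [divergence, edgeFlow, Finset.sum_sub_distrib, Finset.sum_filter]
  congr 1
  · rw [Finset.sum_eq_single e (fun b _ hb => by simp [hb]) (by simp)]
    simp
  · rw [Finset.sum_eq_single (G.rev e) (fun b _ hb => by simp [hb]) (by simp)]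
    simp [G.tgt_rev]

namespace RootedForest

variable {G : Multigraph V E} {R : Set V} (f : RootedForest G R) [Fintype V]

open Classical in
/-- The unit flow along the path from `y` to its root: the path consists of the edges `next x` for
the vertices `x` outside `R` whose subtree contains `y`. -/
noncomputable def pathFlow (F : Type w) [Field F] (y : V) : E → F :=
  ∑ x : V with x ∉ R ∧ y ∈ f.subtree x, edgeFlow F G (f.next x)

variable {f}

theorem pathFlow_of_mem {y : V} (hy : y ∈ R) : f.pathFlow F y = 0 := by
  classical
  rw [pathFlow, Finset.sum_eq_zero]
  intro x hx
  have hx := (Finset.mem_filter.1 hx).2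
  exact absurd hx.2 (notMem_subtree_of_mem hx.1 hy)

theorem pathFlow_of_notMem {y : V} (hy : y ∉ R) :
    f.pathFlow F y = edgeFlow F G (f.next y) + f.pathFlow F (f.parent y) := by
  classical
  have : (Finset.univ.filter fun x : V => x ∉ R ∧ y ∈ f.subtree x) =
      insert y (Finset.univ.filter fun x : V => x ∉ R ∧ f.parent y ∈ f.subtree x) := by
    ext x
    simp only [Finset.mem_filter, Finset.mem_univ, true_and, Finset.mem_insert]
    by_cases hxy : x = y
    · subst hxy
      simp [hy, mem_subtree_self]
    · simp [hxy, mem_subtree_iff_parent (f := f) (Ne.symm hxy)]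
  rw [pathFlow, pathFlow, ← Finset.sum_insert (a := y) (f := fun x => edgeFlow F G (f.next x))]
  · exact Finset.sum_congr (by convert this) fun _ _ => rfl
  · simp [parent_notMem_subtree hy]

theorem pathFlow_rev (y : V) (e : E) : f.pathFlow F y (G.rev e) = - f.pathFlow F y e := by
  simp only [pathFlow, Finset.sum_apply, edgeFlow_rev, Finset.sum_neg_distrib]

theorem divergence_pathFlow [Fintype E] [DecidableEq V] (y : V) {p : V} (hp : p ∉ R) :
    divergence G (f.pathFlow F y) p = - if y = p then 1 else 0 := by
  induction hn : f.rank y using Nat.strong_induction_on generalizing y with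
  | _ n ih =>
    by_cases hy : y ∈ R
    · have hyp : y ≠ p := fun h => hp (h ▸ hy)
      rw [pathFlow_of_mem hy, if_neg hyp, ← divergenceMap_apply, map_zero]
      simp
    · have := ih _ (by rw [← hn, parent_of_notMem hy]; exact f.rank_lt y hy) (f.parent y) rfl
      rw [pathFlow_of_notMem hy, ← divergenceMap_apply, map_add, Pi.add_apply,
        divergenceMap_apply, divergenceMap_apply, this, divergence_edgeFlow, f.src_next y hy,
        ← parent_of_notMem hy]
      ring

theorem pathFlow_of_notMem_edgeSet (y : V) {e : E} (he : e ∉ f.edgeSet) :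
    f.pathFlow F y e = 0 := by
  classical
  rw [pathFlow, Finset.sum_apply, Finset.sum_eq_zero]
  intro x hx
  have hx := (Finset.mem_filter.1 hx).2
  exact edgeFlow_of_ne G (fun h => he ⟨x, hx.1, Or.inl h⟩) (fun h => he ⟨x, hx.1, Or.inr h⟩)

open Classical in
theorem pathFlow_next (y : V) {z : V} (hz : z ∉ R) :
    f.pathFlow F y (f.next z) = if y ∈ f.subtree z then 1 else 0 := by
  rw [pathFlow, Finset.sum_apply]
  have hne : ∀ x, x ∉ R → x ≠ z → edgeFlow F G (f.next x) (f.next z) = 0 := fun x hx hxz =>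
    edgeFlow_of_ne G (fun h => hxz (next_inj hz hx h).symm) (next_ne_rev hz hx)
  split_ifs with hy
  · rw [Finset.sum_eq_single z]
    · exact edgeFlow_self G _
    · intro x hx hxz
      exact hne x (Finset.mem_filter.1 hx).2.1 hxz
    · intro h
      exact absurd (Finset.mem_filter.2 ⟨Finset.mem_univ _, hz, hy⟩) h
  · refine Finset.sum_eq_zero fun x hx => ?_
    have hx := (Finset.mem_filter.1 hx).2
    exact hne x hx.1 fun h => hy (h ▸ hx.2)

variable (f)

/-- The unit flow through `e` which returns through the forest. It is a circulation, except that the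
two ends of `e` may have different roots, where it then has its source and its sink. -/
noncomputable def fundamentalFlow (F : Type w) [Field F] (e : E) : E → F :=
  edgeFlow F G e + (f.pathFlow F (G.tgt e) - f.pathFlow F (G.src e))

variable {f}

theorem fundamentalFlow_rev (e e' : E) :
    f.fundamentalFlow F e (G.rev e') = - f.fundamentalFlow F e e' := by
  simp only [fundamentalFlow, Pi.add_apply, Pi.sub_apply, edgeFlow_rev, pathFlow_rev]
  ring

theorem divergence_fundamentalFlow [Fintype E] (e : E) {p : V} (hp : p ∉ R) :
    divergence G (f.fundamentalFlow F e) p = 0 := by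
  classical
  rw [fundamentalFlow, ← divergenceMap_apply, map_add, map_sub, Pi.add_apply, Pi.sub_apply,
    divergenceMap_apply, divergenceMap_apply, divergenceMap_apply, divergence_edgeFlow,
    divergence_pathFlow _ hp, divergence_pathFlow _ hp]
  ring

theorem fundamentalFlow_self {e : E} (he : e ∉ f.edgeSet) : f.fundamentalFlow F e e = 1 := by
  simp [fundamentalFlow, edgeFlow_self, pathFlow_of_notMem_edgeSet _ he]

theorem fundamentalFlow_next_ne_zero {e : E} (he : e ∉ f.edgeSet) {z : V} (hz : z ∉ R)
    (h : Separates G (f.subtree z) e) : f.fundamentalFlow F e (f.next z) ≠ 0 := by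
  classical
  have h1 : f.next z ≠ e := fun h' => he (h' ▸ next_mem_edgeSet hz)
  have h2 : f.next z ≠ G.rev e := fun h' =>
    rev_notMem_edgeSet he (h' ▸ next_mem_edgeSet hz)
  rw [fundamentalFlow, Pi.add_apply, Pi.sub_apply, edgeFlow_of_ne G h1 h2, pathFlow_next _ hz,
    pathFlow_next _ hz]
  by_cases ha : G.src e ∈ f.subtree z <;> by_cases hb : G.tgt e ∈ f.subtree z
  · exact absurd (iff_of_true ha hb) h
  · simp [ha, hb]
  · simp [ha, hb]
  · exact absurd (iff_of_false ha hb) h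

theorem separates_of_pathFlow_ne {e : E} {e' : E}
    (h : (f.pathFlow F (G.tgt e) - f.pathFlow F (G.src e)) e' ≠ 0) :
    ∃ z, z ∉ R ∧ Separates G (f.subtree z) e ∧ (e' = f.next z ∨ e' = G.rev (f.next z)) := by
  classical
  have hmem : e' ∈ f.edgeSet := by
    by_contra hno
    simp [pathFlow_of_notMem_edgeSet _ hno] at h
  obtain ⟨z, hz, hz'⟩ := hmem
  refine ⟨z, hz, fun hiff => h ?_, hz'⟩
  rcases hz' with rfl | rfl
  · rw [Pi.sub_apply, pathFlow_next _ hz, pathFlow_next _ hz, if_congr hiff.symm rfl rfl, sub_self]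
  · rw [Pi.sub_apply, pathFlow_rev, pathFlow_rev, pathFlow_next _ hz, pathFlow_next _ hz,
      if_congr hiff.symm rfl rfl, sub_self]

theorem fundamentalFlow_ne_zero {e e' : E} (h : f.fundamentalFlow F e e' ≠ 0) :
    e' = e ∨ e' = G.rev e ∨
      ∃ z, z ∉ R ∧ Separates G (f.subtree z) e ∧ (e' = f.next z ∨ e' = G.rev (f.next z)) := by
  by_contra hno
  push Not at hno
  refine h ?_
  rw [fundamentalFlow, Pi.add_apply, edgeFlow_of_ne G hno.1 hno.2.1, zero_add]
  by_contra hne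
  obtain ⟨z, hz, hs, h'⟩ := separates_of_pathFlow_ne hne
  have := hno.2.2 z hz hs
  rcases h' with h' | h'
  · exact this.1 h'
  · exact this.2 h'

end RootedForest

end Flow

/-! ### Weights with prescribed flows and potentials -/

section Generic

variable {V : Type u} {E : Type v} {F : Type w} [Field F] [Fintype E]

/-- The flows supported in `D` whose net flow vanishes outside `P`. -/
def flowSpace (F : Type w) [Field F] (G : Multigraph V E) (P : Set V) (D : Set E) :
    Submodule F (E → F) where
  carrier := {c | (∀ e, c (G.rev e) = - c e) ∧ (∀ e, e ∉ D → c e = 0) ∧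
    ∀ p, p ∉ P → divergenceMap F G c p = 0}
  add_mem' := by
    rintro a b ⟨h1, h2, h3⟩ ⟨h1', h2', h3'⟩
    refine ⟨fun e => ?_, fun e he => ?_, fun p hp => ?_⟩
    · simp only [Pi.add_apply, h1, h1']; ring
    · simp only [Pi.add_apply, h2 e he, h2' e he, add_zero]
    · rw [map_add, Pi.add_apply, h3 p hp, h3' p hp, add_zero]
  zero_mem' := by
    refine ⟨fun e => by simp, fun e _ => rfl, fun p _ => by rw [map_zero]; rfl⟩
  smul_mem' := by
    rintro t a ⟨h1, h2, h3⟩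
    refine ⟨fun e => ?_, fun e he => ?_, fun p hp => ?_⟩
    · simp only [Pi.smul_apply, smul_eq_mul, h1]; ring
    · simp only [Pi.smul_apply, smul_eq_mul, h2 e he, mul_zero]
    · rw [map_smul, Pi.smul_apply, h3 p hp, smul_zero]

/-- The potentials that vanish on `Q` and are constant along the edges outside `D`. -/
def potentialSpace (F : Type w) [Field F] (G : Multigraph V E) (Q : Set V) (D : Set E) :
    Submodule F (V → F) where
  carrier := {a | (∀ q ∈ Q, a q = 0) ∧ ∀ e, e ∉ D → a (G.tgt e) - a (G.src e) = 0}
  add_mem' := by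
    rintro a b ⟨h1, h2⟩ ⟨h1', h2'⟩
    refine ⟨fun q hq => ?_, fun e he => ?_⟩
    · simp only [Pi.add_apply, h1 q hq, h1' q hq, add_zero]
    · simp only [Pi.add_apply]
      linear_combination h2 e he + h2' e he
  zero_mem' := ⟨fun q _ => rfl, fun e _ => sub_self _⟩
  smul_mem' := by
    rintro t a ⟨h1, h2⟩
    refine ⟨fun q hq => ?_, fun e he => ?_⟩
    · simp only [Pi.smul_apply, h1 q hq, smul_zero]
    · simp only [Pi.smul_apply, smul_eq_mul]
      linear_combination t * h2 e he

/-- Over an infinite field, a subspace contains a vector at which none of finitely many functionals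
vanishes, except those that vanish on the whole subspace. -/
theorem exists_mem_forall_ne_zero [Infinite F] {M : Type*} [AddCommGroup M] [Module F M]
    {ι : Type*} [Finite ι] (p : Submodule F M) (f : ι → Module.Dual F M) :
    ∃ x ∈ p, ∀ i, (∃ y ∈ p, f i y ≠ 0) → f i x ≠ 0 := by
  obtain ⟨x, hx, h⟩ := Module.Dual.exists_forall_mem_ne_zero_of_forall_exists p
    (fun i : {i // ∃ y ∈ p, f i y ≠ 0} => f i) (fun i => i.2)
  exact ⟨x, hx, fun i hi => h ⟨i, hi⟩⟩

/-- If every edge of `D` carries a flow in `flowSpace` and has a potential difference in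
`potentialSpace`, then generic elements of both spaces are nonzero on all of `D`. Their quotients
are edge weights for which the generic potential has the generic flow as its current. -/
theorem exists_weight [Finite V] [Infinite F] (G : Multigraph V E) {P Q : Set V} {D : Set E}
    (hrev : ∀ e ∈ D, G.rev e ∈ D)
    (hflow : ∀ e ∈ D, ∃ c ∈ flowSpace F G P D, c e ≠ 0)
    (hpot : ∀ e ∈ D, ∃ a ∈ potentialSpace F G Q D, a (G.tgt e) - a (G.src e) ≠ 0) :
    ∃ (c : E → F) (a : V → F), IsWeight G c ∧ (∀ q ∈ Q, a q = 0) ∧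
      (∀ p, p ∉ P → laplacian G c a p = 0) ∧
      (∀ e ∈ D, a (G.tgt e) - a (G.src e) ≠ 0) ∧
      (∀ p, (∃ b ∈ flowSpace F G P D, divergenceMap F G b p ≠ 0) → laplacian G c a p ≠ 0) ∧
      ∀ p, (∃ b ∈ potentialSpace F G Q D, b p ≠ 0) → a p ≠ 0 := by
  classical
  obtain ⟨b, hb, hbne⟩ := exists_mem_forall_ne_zero (flowSpace F G P D)
    (Sum.elim (fun e : E => (LinearMap.proj e : (E → F) →ₗ[F] F))
      (fun p : V => (LinearMap.proj p : (V → F) →ₗ[F] F).comp (divergenceMap F G)))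
  obtain ⟨a, ha, hane⟩ := exists_mem_forall_ne_zero (potentialSpace F G Q D)
    (Sum.elim (fun e : E => (LinearMap.proj (G.tgt e) : (V → F) →ₗ[F] F) -
      (LinearMap.proj (G.src e) : (V → F) →ₗ[F] F))
      (fun p : V => (LinearMap.proj p : (V → F) →ₗ[F] F)))
  have hb' : ∀ e ∈ D, b e ≠ 0 := fun e he => hbne (Sum.inl e) (hflow e he)
  have ha' : ∀ e ∈ D, a (G.tgt e) - a (G.src e) ≠ 0 := fun e he => hane (Sum.inl e) (hpot e he)
  let c : E → F := fun e => if e ∈ D then b e / (a (G.tgt e) - a (G.src e)) else 1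
  have hca : ∀ e, c e * (a (G.tgt e) - a (G.src e)) = b e := by
    intro e
    by_cases he : e ∈ D
    · simp only [c, if_pos he]
      exact div_mul_cancel₀ _ (ha' e he)
    · rw [ha.2 e he, hb.2.1 e he, mul_zero]
  have hlap : laplacian G c a = divergenceMap F G b := by
    rw [laplacian_eq_divergence]
    simp only [hca]
    rfl
  have hc : IsWeight G c := by
    refine ⟨fun e => ?_, fun e => ?_⟩
    · by_cases he : e ∈ D
      · simp only [c, if_pos he]
        exact div_ne_zero (hb' e he) (ha' e he)
      · simp [c, he]
    · by_cases he : e ∈ D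
      · simp only [c, if_pos he, if_pos (hrev e he), hb.1, G.src_rev, G.tgt_rev]
        rw [← neg_sub, div_neg, neg_div, neg_neg]
      · have he' : G.rev e ∉ D := fun h => he (by rw [← G.rev_rev e]; exact hrev _ h)
        simp [c, he, he']
  refine ⟨c, a, hc, ha.1, fun p hp => ?_, ha', fun p hp => ?_, fun p hp => ?_⟩
  · rw [hlap]
    exact hb.2.2 p hp
  · rw [hlap]
    exact hbne (Sum.inr p) hp
  · exact hane (Sum.inr p) hp

end Generic

/-! ### The exchange relation -/

section Exchange

variable {V : Type u} {E : Type v}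

/-- A spanning forest in which every component contains exactly one point of `P` and exactly one
point of `Q`, presented as a forest rooted at `P` and as a forest rooted at `Q`. -/
structure Grove (G : Multigraph V E) (P Q : Set V) where
  toP : RootedForest G P
  toQ : RootedForest G Q
  edgeSet_eq : toP.edgeSet = toQ.edgeSet

namespace Grove

variable {G : Multigraph V E} {P Q : Set V} (g : Grove G P Q)

/-- For some edge `b` of the grove, `e` lies in the fundamental cut of `b` relative to `Q`, and `b`
lies on the fundamental circuit of `e'` relative to `P`. The edge `b` is `toQ.next x` and, up to its
orientation, `toP.next y`. For edges `e`, `e'` outside the grove, this says that exchanging `b` for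
`e` gives a forest rooted at `Q`, and exchanging `b` for `e'` gives a forest rooted at `P`. -/
def Exchange (e e' : E) : Prop :=
  ∃ x y, x ∉ Q ∧ y ∉ P ∧ (g.toQ.next x = g.toP.next y ∨ g.toQ.next x = G.rev (g.toP.next y)) ∧
    Separates G (g.toQ.subtree x) e ∧ Separates G (g.toP.subtree y) e'

/-- The exchange relation between edges outside the grove, read backwards: a descending chain for
`Step` is a chain of exchanges that never ends. -/
def Step (e' e : E) : Prop := e ∉ g.toQ.edgeSet ∧ e' ∉ g.toQ.edgeSet ∧ g.Exchange e e'

/-- The edges outside the grove from which exchanges can be continued forever. -/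
def cyclicEdges : Set E := {e | ¬ Acc g.Step e}

/-- The edges outside the grove from which exchanges can be continued forever, together with the
edges of the grove that lie on their fundamental circuits relative to `P`. -/
def cyclicSupport : Set E := g.cyclicEdges ∪
  {b | ∃ x y, x ∉ Q ∧ y ∉ P ∧ (g.toQ.next x = g.toP.next y ∨ g.toQ.next x = G.rev (g.toP.next y)) ∧
    (b = g.toQ.next x ∨ b = G.rev (g.toQ.next x)) ∧
      ∃ e ∈ g.cyclicEdges, e ∉ g.toQ.edgeSet ∧ Separates G (g.toP.subtree y) e}

variable {g}

theorem exists_step {e : E} (he : e ∈ g.cyclicEdges) : ∃ e' ∈ g.cyclicEdges, g.Step e' e := by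
  by_contra hno
  push Not at hno
  exact he ⟨_, fun e' h => by_contra fun hacc => hno e' hacc h⟩

theorem notMem_edgeSet_of_mem_cyclicEdges {e : E} (he : e ∈ g.cyclicEdges) :
    e ∉ g.toQ.edgeSet := by
  obtain ⟨e', -, h⟩ := exists_step he
  exact h.1

theorem mem_cyclicEdges_of_step {e e' : E} (h : g.Step e' e) (he' : e' ∈ g.cyclicEdges) :
    e ∈ g.cyclicEdges := fun hacc => he' (hacc.inv h)

theorem rev_mem_cyclicEdges {e : E} (he : e ∈ g.cyclicEdges) : G.rev e ∈ g.cyclicEdges := by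
  obtain ⟨e', he', h1, h2, x, y, hx, hy, hxy, hs, hs'⟩ := exists_step he
  exact mem_cyclicEdges_of_step
    ⟨RootedForest.rev_notMem_edgeSet h1, h2, x, y, hx, hy, hxy, hs.rev, hs'⟩ he'

theorem rev_mem_cyclicSupport {e : E} (he : e ∈ g.cyclicSupport) : G.rev e ∈ g.cyclicSupport := by
  rcases he with he | ⟨x, y, hx, hy, hxy, rfl | rfl, h⟩
  · exact Or.inl (rev_mem_cyclicEdges he)
  · exact Or.inr ⟨x, y, hx, hy, hxy, Or.inr rfl, h⟩
  · exact Or.inr ⟨x, y, hx, hy, hxy, Or.inl (G.rev_rev _), h⟩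

theorem exists_toQ_next {y : V} (hy : y ∉ P) :
    ∃ x, x ∉ Q ∧ (g.toQ.next x = g.toP.next y ∨ g.toQ.next x = G.rev (g.toP.next y)) := by
  have := RootedForest.next_mem_edgeSet (f := g.toP) hy
  rw [g.edgeSet_eq] at this
  obtain ⟨x, hx, h | h⟩ := this
  · exact ⟨x, hx, Or.inl h.symm⟩
  · exact ⟨x, hx, Or.inr (by rw [h, G.rev_rev])⟩

theorem exists_toP_next {x : V} (hx : x ∉ Q) :
    ∃ y, y ∉ P ∧ (g.toQ.next x = g.toP.next y ∨ g.toQ.next x = G.rev (g.toP.next y)) := by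
  have := RootedForest.next_mem_edgeSet (f := g.toQ) hx
  rw [← g.edgeSet_eq] at this
  exact this

/-- For an edge of the grove in `cyclicSupport`, the fundamental cut relative to `Q` consists of
edges in `cyclicSupport`, because an exchange leads from each of those outside the grove to an
infinite chain. -/
theorem mem_cyclicSupport_of_separates {x : V} (hx : x ∉ Q) (hxD : g.toQ.next x ∈ g.cyclicSupport)
    {e : E} (hs : Separates G (g.toQ.subtree x) e) : e ∈ g.cyclicSupport := by
  rcases hxD with hxD | ⟨x', y, hx', hy, hxy, hb, e', he', hne', hs'⟩
  · exact absurd (RootedForest.next_mem_edgeSet hx) (notMem_edgeSet_of_mem_cyclicEdges hxD)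
  · obtain rfl : x = x' := by
      rcases hb with hb | hb
      · exact RootedForest.next_inj hx hx' hb
      · exact absurd hb (RootedForest.next_ne_rev hx hx')
    by_cases he : e ∈ g.toQ.edgeSet
    · exact Or.inr ⟨x, y, hx, hy, hxy, RootedForest.eq_of_separates hx he hs, e', he', hne', hs'⟩
    · exact Or.inl (mem_cyclicEdges_of_step ⟨he, hne', x, y, hx, hy, hxy, hs, hs'⟩ he')

theorem indicator_sub_ne_zero {F : Type w} [Field F] {A : Set V} {e : E} :
    A.indicator (1 : V → F) (G.tgt e) - A.indicator (1 : V → F) (G.src e) ≠ 0 ↔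
      Separates G A e := by
  classical
  rw [Separates]
  by_cases h1 : G.src e ∈ A <;> by_cases h2 : G.tgt e ∈ A <;> simp [h1, h2]

theorem indicator_mem_potentialSpace {F : Type w} [Field F] {x : V} (hx : x ∉ Q)
    (hxD : g.toQ.next x ∈ g.cyclicSupport) :
    (g.toQ.subtree x).indicator (1 : V → F) ∈ potentialSpace F G Q g.cyclicSupport := by
  refine ⟨fun q hq => Set.indicator_of_notMem (RootedForest.notMem_subtree_of_mem hx hq) _,
    fun e he => ?_⟩
  by_contra hne
  exact he (mem_cyclicSupport_of_separates hx hxD (indicator_sub_ne_zero.1 hne))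

/-- Every vertex of `W` is sent to the first vertex outside `W` on its way to the root. -/
theorem exists_exit {R : Set V} (f : RootedForest G R) {W : Set V} (hW : ∀ y ∈ R, y ∉ W) :
    ∃ ρ : V → V, (∀ y, y ∉ W → ρ y = y) ∧ (∀ y ∈ W, ρ y = ρ (f.parent y)) ∧ ∀ y, ρ y ∉ W := by
  classical
  have hex : ∀ y, ∃ k, f.parent^[k] y ∉ W := fun y => by
    obtain ⟨k, hk⟩ := RootedForest.exists_iterate_parent_mem (f := f) y
    exact ⟨k, hW _ hk⟩
  refine ⟨fun y => f.parent^[Nat.find (hex y)] y, fun y hy => ?_, fun y hy => ?_,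
    fun y => Nat.find_spec (hex y)⟩
  · have : Nat.find (hex y) = 0 := (Nat.find_eq_zero _).2 hy
    simp only [this, Function.iterate_zero, id]
  · have : Nat.find (hex y) = Nat.find (hex (f.parent y)) + 1 :=
      Nat.find_comp_succ (hex y) (hex (f.parent y)) (not_not.2 hy)
    simp only [this, Function.iterate_succ_apply]

variable {F : Type w} [Field F] [Fintype V] [Fintype E]

/-- The fundamental circuit, relative to `P`, of an edge with an infinite chain of exchanges
consists of edges in `cyclicSupport`. -/
theorem fundamentalFlow_mem_flowSpace {e : E} (he : e ∈ g.cyclicEdges) :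
    g.toP.fundamentalFlow F e ∈ flowSpace F G P g.cyclicSupport := by
  refine ⟨fun e' => RootedForest.fundamentalFlow_rev e e', fun e' he' => ?_,
    fun p hp => RootedForest.divergence_fundamentalFlow e hp⟩
  by_contra hne
  refine he' ?_
  rcases RootedForest.fundamentalFlow_ne_zero hne with rfl | rfl | ⟨y, hy, hs, h⟩
  · exact Or.inl he
  · exact Or.inl (rev_mem_cyclicEdges he)
  · obtain ⟨x, hx, hxy⟩ := exists_toQ_next (g := g) hy
    refine Or.inr ⟨x, y, hx, hy, hxy, ?_, e, he, notMem_edgeSet_of_mem_cyclicEdges he, hs⟩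
    rcases hxy with hxy | hxy
    · rwa [hxy]
    · rw [hxy, G.rev_rev]
      exact h.symm

variable (F g) in
/-- Every edge of `cyclicSupport` lies on a fundamental circuit and in a fundamental cut contained
in `cyclicSupport`, so that `exists_weight` applies. -/
theorem exists_weight_cyclicSupport [Infinite F] :
    ∃ (c : E → F) (a : V → F), IsWeight G c ∧ (∀ q ∈ Q, a q = 0) ∧
      (∀ p, p ∉ P → laplacian G c a p = 0) ∧
      (∀ e ∈ g.cyclicSupport, a (G.tgt e) - a (G.src e) ≠ 0) ∧
      (∀ p, (∃ b ∈ flowSpace F G P g.cyclicSupport, divergenceMap F G b p ≠ 0) →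
        laplacian G c a p ≠ 0) ∧
      ∀ p, (∃ b ∈ potentialSpace F G Q g.cyclicSupport, b p ≠ 0) → a p ≠ 0 := by
  refine exists_weight G (fun e he => rev_mem_cyclicSupport he) ?_ ?_
  · rintro e (he | ⟨x, y, hx, hy, hxy, hb, e', he', hne', hs'⟩)
    · refine ⟨_, fundamentalFlow_mem_flowSpace he, ?_⟩
      rw [RootedForest.fundamentalFlow_self]
      · exact one_ne_zero
      · rw [g.edgeSet_eq]
        exact notMem_edgeSet_of_mem_cyclicEdges he
    · refine ⟨_, fundamentalFlow_mem_flowSpace he', ?_⟩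
      have hne := RootedForest.fundamentalFlow_next_ne_zero (F := F) (f := g.toP) (e := e')
        (by rw [g.edgeSet_eq]; exact hne') hy hs'
      have hne2 : g.toP.fundamentalFlow F e' (g.toQ.next x) ≠ 0 := by
        rcases hxy with hxy | hxy
        · rwa [hxy]
        · rwa [hxy, RootedForest.fundamentalFlow_rev, neg_ne_zero]
      rcases hb with rfl | rfl
      · exact hne2
      · rwa [RootedForest.fundamentalFlow_rev, neg_ne_zero]
  · rintro e (he | ⟨x, y, hx, hy, hxy, hb, e', he', hne', hs'⟩)
    · obtain ⟨e', he', h1, h2, x, y, hx, hy, hxy, hs, hs'⟩ := exists_step he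
      exact ⟨_, indicator_mem_potentialSpace hx
        (Or.inr ⟨x, y, hx, hy, hxy, Or.inl rfl, e', he', h2, hs'⟩),
        indicator_sub_ne_zero.2 hs⟩
    · refine ⟨_, indicator_mem_potentialSpace hx
        (Or.inr ⟨x, y, hx, hy, hxy, Or.inl rfl, e', he', hne', hs'⟩),
        indicator_sub_ne_zero.2 ?_⟩
      have hs := (RootedForest.separates_next_iff (f := g.toQ) hx hx).2 rfl
      rcases hb with rfl | rfl
      · exact hs
      · exact hs.rev

/-- If a grove had an infinite chain of exchanges, the mixed boundary value problem would be
singular for some edge weights. -/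
theorem cyclicEdges_eq_empty_of_injective [Infinite F]
    (h : ∀ c : E → F, IsWeight G c → ∀ a : V → F, (∀ q ∈ Q, a q = 0) →
      (∀ p, p ∉ P → laplacian G c a p = 0) → a = 0) : g.cyclicEdges = ∅ := by
  obtain ⟨c, a, hc, haQ, haP, hne, -, -⟩ := exists_weight_cyclicSupport g F
  rw [Set.eq_empty_iff_forall_notMem]
  intro e he
  refine hne e (Or.inl he) ?_
  rw [h c hc a haQ haP]
  simp

/-- If the flows and the potentials carried by an infinite chain of exchanges are invisible at the
boundary, then the vertices below the edges of the grove involved that leave this set at the same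
vertex form, together with that vertex, a harmonic subgraph with one boundary vertex. -/
theorem cyclicEdges_eq_empty_of_noOneBoundarySubgraph [Infinite F] {G : BoundaryGraph V E}
    {g : Grove G.toMultigraph P Q} (hb : G.boundary = P ∪ Q)
    (h : ∀ c : E → F, IsWeight G.toMultigraph c → ∀ a : V → F, (∀ q ∈ Q, a q = 0) →
      (∀ p, p ∉ P → laplacian G.toMultigraph c a p = 0) →
        (∀ p ∈ P, a p = 0) ∧ ∀ p, laplacian G.toMultigraph c a p = 0)
    (hno : NoOneBoundarySubgraph G) : g.cyclicEdges = ∅ := by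
  classical
  obtain ⟨c, a, hc, haQ, haP, -, hflow, hpot⟩ := exists_weight_cyclicSupport g F
  obtain ⟨hP0, hlap0⟩ := h c hc a haQ haP
  have hdiv : ∀ b ∈ flowSpace F G.toMultigraph P g.cyclicSupport, ∀ p,
      divergenceMap F G.toMultigraph b p = 0 := fun b hb p => by
    by_contra hne
    exact hflow p ⟨b, hb, hne⟩ (hlap0 p)
  have hpotP : ∀ b ∈ potentialSpace F G.toMultigraph Q g.cyclicSupport, ∀ p ∈ P, b p = 0 :=
    fun b hb p hp => by
      by_contra hne
      exact hpot p ⟨b, hb, hne⟩ (hP0 p hp)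
  -- `X` consists of the lower end points of the edges of the grove involved, and `W` of the
  -- vertices below these edges. The potentials being zero on `P`, the set `W` avoids the boundary.
  set X : Set V := {x | x ∉ Q ∧ g.toQ.next x ∈ g.cyclicSupport}
  set W : Set V := {y | ∃ x ∈ X, y ∈ g.toQ.subtree x}
  have hXW : X ⊆ W := fun x hx => ⟨x, hx, RootedForest.mem_subtree_self x⟩
  have hWQ : ∀ y ∈ Q, y ∉ W := by
    rintro y hy ⟨x, hx, hyx⟩
    exact RootedForest.notMem_subtree_of_mem hx.1 hy hyx
  have hWP : ∀ y ∈ P, y ∉ W := by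
    rintro y hy ⟨x, hx, hyx⟩
    have := hpotP _ (indicator_mem_potentialSpace hx.1 hx.2) y hy
    rw [Set.indicator_of_mem hyx] at this
    exact one_ne_zero this
  obtain ⟨ρ, hρout, hρin, hρW⟩ := exists_exit g.toQ hWQ
  have hρnext : ∀ z, z ∉ Q → z ∈ W →
      ρ (G.src (g.toQ.next z)) = ρ (G.tgt (g.toQ.next z)) := by
    intro z hz hzW
    rw [g.toQ.src_next z hz, hρin z hzW, RootedForest.parent_of_notMem hz]
  have hρsub : ∀ x ∈ X, ∀ s ∈ g.toQ.subtree x, ρ s = ρ x := by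
    rintro x hx s ⟨k, hk⟩
    induction k generalizing s with
    | zero => exact congrArg ρ hk
    | succ k ih => rw [hρin s ⟨x, hx, k + 1, hk⟩, ih _ hk]
  -- An edge at a vertex of `W` stays in the fibre of `ρ`. For the edges outside the grove this
  -- holds because their fundamental flow has no sources or sinks.
  have hρedge : ∀ e, G.src e ∈ W → ρ (G.src e) = ρ (G.tgt e) := by
    intro e heW
    by_cases heB : e ∈ g.toQ.edgeSet
    · obtain ⟨z, hz, rfl | rfl⟩ := heB
      · refine hρnext z hz ?_
        rwa [g.toQ.src_next z hz] at heW
      · rw [G.src_rev, G.tgt_rev]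
        refine (hρnext z hz ?_).symm
        obtain ⟨x, hx, hmem⟩ := heW
        rw [G.src_rev, ← RootedForest.parent_of_notMem hz] at hmem
        exact ⟨x, hx, RootedForest.mem_subtree_of_parent hmem⟩
    obtain ⟨x, hx, hmem⟩ := heW
    by_cases htgt : G.tgt e ∈ g.toQ.subtree x
    · rw [hρsub x hx _ hmem, hρsub x hx _ htgt]
    have heD : e ∈ g.cyclicEdges := by
      have hs : Separates G.toMultigraph (g.toQ.subtree x) e := fun hiff => htgt (hiff.1 hmem)
      rcases mem_cyclicSupport_of_separates hx.1 hx.2 hs with h | ⟨x', _, hx', _, _, h, _⟩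
      · exact h
      · exact absurd ⟨x', hx', h⟩ heB
    -- Pair the fundamental flow of `e` with the indicator function of a fibre of `ρ`.
    set h : V → F := fun v => if ρ v = ρ (G.src e) then 1 else 0 with hdef
    set θ : E → F := g.toP.pathFlow F (G.tgt e) - g.toP.pathFlow F (G.src e) with hθ
    have hθconst : ∀ e', θ e' ≠ 0 → ρ (G.src e') = ρ (G.tgt e') := by
      intro e' hne
      obtain ⟨y, hy, hs, hey⟩ := RootedForest.separates_of_pathFlow_ne hne
      obtain ⟨x', hx', hxy⟩ := exists_toQ_next (g := g) hy
      have hxX : x' ∈ X := ⟨hx', Or.inr ⟨x', y, hx', hy, hxy, Or.inl rfl, e, heD, heB, hs⟩⟩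
      have hr := hρnext x' hx' (hXW hxX)
      have : e' = g.toQ.next x' ∨ e' = G.rev (g.toQ.next x') := by
        rcases hxy with hxy | hxy
        · rwa [hxy]
        · rw [hxy, G.rev_rev]
          exact hey.symm
      rcases this with rfl | rfl
      · exact hr
      · rw [G.src_rev, G.tgt_rev, hr]
    have hθrev : ∀ e', θ (G.rev e') = - θ e' := fun e' => by
      simp only [hθ, Pi.sub_apply, RootedForest.pathFlow_rev]
      ring
    have hθsum : ∑ e', h (G.tgt e') * θ e' = 0 := by
      refine Finset.sum_involution (fun e' _ => G.rev e') (fun e' _ => ?_)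
        (fun e' _ _ => G.rev_ne e') (fun e' _ => Finset.mem_univ _) (fun e' _ => G.rev_rev e')
      rw [hθrev, G.tgt_rev]
      by_cases h0 : θ e' = 0
      · simp [h0]
      · simp only [hdef, hθconst e' h0]
        ring
    have hsum := sum_mul_divergence G.toMultigraph (g.toP.fundamentalFlow F e) h
    have hzero : ∀ p, divergence G.toMultigraph (g.toP.fundamentalFlow F e) p = 0 := fun p =>
      hdiv _ (fundamentalFlow_mem_flowSpace heD) p
    have hsplit : ∑ e', h (G.tgt e') * g.toP.fundamentalFlow F e e' =
        ∑ e', h (G.tgt e') * edgeFlow F G.toMultigraph e e' + ∑ e', h (G.tgt e') * θ e' := by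
      rw [← Finset.sum_add_distrib]
      exact Finset.sum_congr rfl fun e' _ => by
        rw [RootedForest.fundamentalFlow, Pi.add_apply, mul_add]
    rw [hsplit, hθsum, add_zero, ← sum_mul_divergence] at hsum
    simp only [hzero, mul_zero, Finset.sum_const_zero, divergence_edgeFlow, mul_sub, mul_ite,
      mul_one, Finset.sum_sub_distrib, Finset.sum_ite_eq, Finset.mem_univ, if_true] at hsum
    have h1 : h (G.src e) = 1 := by simp [hdef]
    rw [h1] at hsum
    by_contra hne
    have h2 : h (G.tgt e) = 0 := by simp [hdef, Ne.symm hne]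
    rw [h2] at hsum
    simp at hsum
  rw [Set.eq_empty_iff_forall_notMem]
  intro e₀ he₀
  obtain ⟨e', he', -, h2, x, y, hx, hy, hxy, -, hs'⟩ := exists_step he₀
  have hxX : x ∈ X := ⟨hx, Or.inr ⟨x, y, hx, hy, hxy, Or.inl rfl, e', he', h2, hs'⟩⟩
  have htgt : ∀ e, G.src e ∈ W → ρ (G.src e) = ρ x →
      (G.tgt e ∈ W ∧ ρ (G.tgt e) = ρ x) ∨ G.tgt e = ρ x := by
    intro e h1 h2
    rw [hρedge e h1] at h2
    by_cases hW' : G.tgt e ∈ W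
    · exact Or.inl ⟨hW', h2⟩
    · rw [hρout _ hW'] at h2
      exact Or.inr h2
  let H : HarmonicSubgraph G :=
    { verts := {y | y ∈ W ∧ ρ y = ρ x} ∪ {ρ x}
      edges := {e | (G.src e ∈ W ∧ ρ (G.src e) = ρ x) ∨ (G.tgt e ∈ W ∧ ρ (G.tgt e) = ρ x)}
      interior := {y | y ∈ W ∧ ρ y = ρ x}
      rev_mem := by
        intro e he
        rw [Set.mem_ofPred_eq, G.src_rev, G.tgt_rev]
        exact he.symm
      tgt_mem := by
        rintro e (he | he)
        · exact htgt e he.1 he.2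
        · exact Or.inl he
      interior_subset := Set.subset_union_left
      interior_disjoint := by
        rintro y ⟨hy, -⟩ hyb
        rw [hb] at hyb
        exact hyb.elim (fun h => hWP y h hy) (fun h => hWQ y h hy)
      star_subset := by
        rintro y hy e rfl
        exact Or.inr hy }
  refine hno ⟨H, Or.inl ⟨x, Or.inl ⟨hXW hxX, rfl⟩, ρ x, Or.inr rfl, ?_⟩, ρ x, ?_⟩
  · intro hxx
    exact hρW x (hxx ▸ hXW hxX)
  · ext y
    constructor
    · rintro ⟨h | h, hn⟩
      · exact absurd h hn
      · exact h
    · rintro rfl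
      exact ⟨Or.inr rfl, fun h => hρW x h.1⟩

end Grove

end Exchange

/-! ### Groves without exchange cycles -/

section FromGrove

variable {V : Type u} {E : Type v}

namespace RootedForest

variable {G : Multigraph V E} {R : Set V} {f : RootedForest G R}

theorem mem_subtree_parent {x y : V} (h : y ∈ f.subtree x) : y ∈ f.subtree (f.parent x) := by
  obtain ⟨k, rfl⟩ := h
  exact ⟨k + 1, Function.iterate_succ_apply' _ _ _⟩

/-- Two vertices on the path from `y` to its root are comparable. -/
theorem mem_subtree_or_mem_subtree {x x' y : V} (h : y ∈ f.subtree x) (h' : y ∈ f.subtree x') :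
    x ∈ f.subtree x' ∨ x' ∈ f.subtree x := by
  obtain ⟨k, rfl⟩ := h
  obtain ⟨k', rfl⟩ := h'
  rcases le_total k k' with hk | hk
  · exact Or.inl ⟨k' - k, by rw [← Function.iterate_add_apply, Nat.sub_add_cancel hk]⟩
  · exact Or.inr ⟨k - k', by rw [← Function.iterate_add_apply, Nat.sub_add_cancel hk]⟩

theorem rank_lt_of_mem_subtree {x y : V} (h : y ∈ f.subtree x) (hne : y ≠ x) :
    f.rank x < f.rank y := by
  have hy : y ∉ R := by
    intro hy
    obtain ⟨k, hk⟩ := h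
    rw [Function.iterate_fixed (parent_of_mem hy)] at hk
    exact hne hk
  have h1 := rank_le_of_mem_subtree ((mem_subtree_iff_parent hne).1 h)
  rw [parent_of_notMem hy] at h1
  exact h1.trans_lt (f.rank_lt y hy)

theorem subtree_eq_singleton {x : V} (hx : x ∉ R) (h : ∀ z, z ∉ R → G.tgt (f.next z) ≠ x) :
    f.subtree x = {x} := by
  ext y
  refine ⟨?_, by rintro rfl; exact mem_subtree_self _⟩
  rintro ⟨_ | k, hk⟩
  · exact hk
  · rw [Function.iterate_succ_apply'] at hk
    by_cases hz : f.parent^[k] y ∈ R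
    · rw [parent_of_mem hz] at hk
      exact absurd (hk ▸ hz) hx
    · rw [parent_of_notMem hz] at hk
      exact absurd hk (h _ hz)

theorem mem_subtree_symm {R' : Set V} {f' : RootedForest G R'}
    (h : ∀ x, x ∉ R → f'.parent (f.parent x) = x) {x y : V} (hy : y ∈ f.subtree x) :
    x ∈ f'.subtree y := by
  obtain ⟨k, hk⟩ := hy
  induction k generalizing y with
  | zero => exact ⟨0, hk.symm⟩
  | succ k ih =>
    by_cases hyR : y ∈ R
    · rw [Function.iterate_fixed (parent_of_mem hyR)] at hk
      exact ⟨0, hk.symm⟩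
    · have := mem_subtree_parent (ih (y := f.parent y) hk)
      rwa [h y hyR] at this

end RootedForest

namespace Grove

variable {G : Multigraph V E} {P Q : Set V} {g : Grove G P Q}

theorem mem_cyclicEdges_of_step_self {e : E} (h : g.Step e e) : e ∈ g.cyclicEdges := by
  intro hacc
  induction hacc with
  | intro e _ ih => exact ih e h h

/-- If no chain of exchanges can be continued forever, then no edge of the grove leads from its
start towards both `P` and `Q`. The start farthest from `Q` of such an edge would be a leaf of the
grove outside `P ∪ Q`, and a second edge at this leaf would be related to itself by an exchange. -/
theorem next_ne_next [Finite V] (hloop : ∀ e, G.src e ≠ G.tgt e)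
    (hdeg : ∀ x, x ∉ P → x ∉ Q → 2 ≤ G.degree x) (hcyc : g.cyclicEdges = ∅) {x y : V}
    (hx : x ∉ Q) (hy : y ∉ P) : g.toQ.next x ≠ g.toP.next y := by
  intro hxy
  obtain rfl : x = y := by rw [← g.toQ.src_next x hx, hxy, g.toP.src_next y hy]
  obtain ⟨x, ⟨hxQ, hxP, hxx⟩, hmax⟩ := Set.exists_max_image
    {x | x ∉ Q ∧ x ∉ P ∧ g.toQ.next x = g.toP.next x} g.toQ.rank (Set.toFinite _) ⟨x, hx, hy, hxy⟩
  have hchildQ : ∀ z, z ∉ Q → G.tgt (g.toQ.next z) ≠ x := by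
    intro z hz hzx
    obtain ⟨y, hy, h | h⟩ := exists_toP_next (g := g) hz
    · obtain rfl : z = y := by rw [← g.toQ.src_next z hz, h, g.toP.src_next y hy]
      have h1 := hmax z ⟨hz, hy, h⟩
      have h2 := g.toQ.rank_lt z hz
      rw [hzx] at h2
      exact absurd h1 (not_le.2 h2)
    · obtain rfl : y = x := by rw [← hzx, h, G.tgt_rev, g.toP.src_next y hy]
      rw [← hxx] at h
      exact RootedForest.next_ne_rev hz hxQ h
  have hchildP : ∀ z, z ∉ P → G.tgt (g.toP.next z) ≠ x := by
    intro z hz hzx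
    obtain ⟨y, hy, h | h⟩ := exists_toQ_next (g := g) hz
    · exact hchildQ y hy (by rw [h, hzx])
    · obtain rfl : y = x := by rw [← hzx, ← g.toQ.src_next y hy, h, G.src_rev]
      rw [hxx] at h
      exact RootedForest.next_ne_rev hxP hz h
  obtain ⟨e, he, hne⟩ := Set.exists_ne_of_one_lt_ncard (hdeg x hxP hxQ) (G.rev (g.toQ.next x))
  have he : G.tgt e = x := he
  have heB : e ∉ g.toQ.edgeSet := by
    rintro ⟨z, hz, rfl | rfl⟩
    · exact hchildQ z hz he
    · rw [G.tgt_rev, g.toQ.src_next z hz] at he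
      exact hne (he ▸ rfl)
  have hsrc : G.src e ≠ x := he ▸ hloop e
  have hsep : Separates G {x} e := fun h => hsrc (h.2 he)
  have hstep : g.Step e e := ⟨heB, heB, x, x, hxQ, hxP, Or.inl hxx,
    by rwa [RootedForest.subtree_eq_singleton hxQ hchildQ],
    by rwa [RootedForest.subtree_eq_singleton hxP hchildP]⟩
  have := mem_cyclicEdges_of_step_self hstep
  rw [hcyc] at this
  exact this

/-- If no chain of exchanges can be continued forever, then the grove, oriented towards `Q`, is a
union of disjoint paths from `P` to `Q`. An edge outside the grove never joins two vertices of one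
path, since it would be related to itself by an exchange. Hence each passage of a decreasing path
from one edge outside the grove to the next one is an exchange, and there is no infinite decreasing
path. -/
theorem isDirectedScaffold [Finite V] (hloop : ∀ e, G.src e ≠ G.tgt e)
    (hdeg : ∀ x, x ∉ P → x ∉ Q → 2 ≤ G.degree x) (hcyc : g.cyclicEdges = ∅) :
    IsDirectedScaffold G P Q {e | ∃ x, x ∉ Q ∧ e = g.toQ.next x} := by
  have hQP : ∀ x, x ∉ Q → g.toQ.parent x ∉ P ∧
      g.toQ.next x = G.rev (g.toP.next (g.toQ.parent x)) := by
    intro x hx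
    obtain ⟨y, hy, h⟩ := exists_toP_next (g := g) hx
    have h := h.resolve_left (next_ne_next hloop hdeg hcyc hx hy)
    have hy' : g.toQ.parent x = y := by
      rw [RootedForest.parent_of_notMem hx, h, G.tgt_rev, g.toP.src_next y hy]
    rw [hy']
    exact ⟨hy, h⟩
  have hPQ : ∀ y, y ∉ P → ∃ x, x ∉ Q ∧ g.toQ.parent x = y := by
    intro y hy
    obtain ⟨x, hx, h⟩ := exists_toQ_next (g := g) hy
    have h := h.resolve_left (next_ne_next hloop hdeg hcyc hx hy)
    refine ⟨x, hx, ?_⟩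
    rw [RootedForest.parent_of_notMem hx, h, G.tgt_rev, g.toP.src_next y hy]
  have hinv : ∀ x, x ∉ Q → g.toP.parent (g.toQ.parent x) = x := by
    intro x hx
    obtain ⟨h1, h2⟩ := hQP x hx
    rw [RootedForest.parent_of_notMem h1, ← G.src_rev, ← h2, g.toQ.src_next x hx]
  have hinv' : ∀ y, y ∉ P → g.toQ.parent (g.toP.parent y) = y := by
    intro y hy
    obtain ⟨x, hx, rfl⟩ := hPQ y hy
    rw [hinv x hx]
  have hnostep : ∀ e, ¬ g.Step e e := fun e he => by
    have := mem_cyclicEdges_of_step_self he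
    rw [hcyc] at this
    exact this
  have hchord : ∀ e, e ∉ g.toQ.edgeSet → G.src e ∉ g.toQ.subtree (G.tgt e) := by
    intro e he hmem
    have hne := hloop e
    have hsQ : G.src e ∉ Q := by
      intro h
      obtain ⟨k, hk⟩ := hmem
      rw [Function.iterate_fixed (RootedForest.parent_of_mem h)] at hk
      exact hne hk
    obtain ⟨h1, h2⟩ := hQP _ hsQ
    refine hnostep e ⟨he, he, G.src e, g.toQ.parent (G.src e), hsQ, h1, Or.inr h2, ?_, ?_⟩
    · intro h
      have h3 := RootedForest.rank_le_of_mem_subtree (h.1 (RootedForest.mem_subtree_self _))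
      exact absurd h3 (not_le.2 (RootedForest.rank_lt_of_mem_subtree hmem hne))
    · intro h
      have h3 : G.tgt e ∈ g.toP.subtree (g.toQ.parent (G.src e)) :=
        RootedForest.mem_subtree_symm hinv ((RootedForest.mem_subtree_iff_parent hne).1 hmem)
      have h4 := RootedForest.parent_notMem_subtree (f := g.toP) h1
      rw [hinv _ hsQ] at h4
      exact h4 (h.2 h3)
  have hchord' : ∀ e, e ∉ g.toQ.edgeSet → G.tgt e ∉ g.toQ.subtree (G.src e) := by
    intro e he
    have := hchord (G.rev e) (RootedForest.rev_notMem_edgeSet he)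
    rwa [G.src_rev, G.tgt_rev] at this
  refine ⟨?_, ?_, ?_, ?_, ?_, ?_⟩
  · rintro _ ⟨x, hx, rfl⟩ ⟨y, hy, h⟩
    exact RootedForest.next_ne_rev hy hx h.symm
  · rintro _ ⟨x, hx, rfl⟩ _ ⟨y, hy, rfl⟩ h
    rw [g.toQ.src_next x hx, g.toQ.src_next y hy] at h
    rw [h]
  · rintro _ ⟨x, hx, rfl⟩ _ ⟨y, hy, rfl⟩ h
    rw [← RootedForest.parent_of_notMem hx, ← RootedForest.parent_of_notMem hy] at h
    rw [← hinv x hx, h, hinv y hy]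
  · intro x
    constructor
    · rintro ⟨_, ⟨y, hy, rfl⟩, rfl⟩
      rwa [g.toQ.src_next y hy]
    · intro hx
      exact ⟨_, ⟨x, hx, rfl⟩, g.toQ.src_next x hx⟩
  · intro x
    constructor
    · rintro ⟨_, ⟨y, hy, rfl⟩, rfl⟩
      rw [← RootedForest.parent_of_notMem hy]
      exact (hQP y hy).1
    · intro hx
      obtain ⟨y, hy, rfl⟩ := hPQ x hx
      exact ⟨_, ⟨y, hy, rfl⟩, (RootedForest.parent_of_notMem hy).symm⟩
  · rintro ⟨r, h1, h2, h3⟩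
    have hB : ∀ k, (¬ ∃ x, x ∉ Q ∧ r k = g.toQ.next x) → r k ∉ g.toQ.edgeSet := by
      rintro k hk ⟨x, hx, h | h⟩
      · exact hk ⟨x, hx, h⟩
      · exact h2 k ⟨x, hx, by rw [h, G.rev_rev]⟩
    have hT : ∀ k, (∃ x, x ∉ Q ∧ r k = g.toQ.next x) →
        G.src (r k) ∉ Q ∧ r k = g.toQ.next (G.src (r k)) ∧
          G.src (r (k + 1)) = g.toQ.parent (G.src (r k)) := by
      rintro k ⟨x, hx, h⟩
      have hs : G.src (r k) = x := by rw [h, g.toQ.src_next x hx]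
      rw [hs]
      refine ⟨hx, h, ?_⟩
      rw [← h1 k, h, RootedForest.parent_of_notMem hx]
    have hrank : ∀ k, (∃ x, x ∉ Q ∧ r k = g.toQ.next x) →
        g.toQ.rank (G.src (r (k + 1))) < g.toQ.rank (G.src (r k)) := by
      intro k hk
      obtain ⟨h4, -, h5⟩ := hT k hk
      rw [h5, RootedForest.parent_of_notMem h4]
      exact g.toQ.rank_lt _ h4
    have hacc : ∀ e, Acc g.Step e := fun e => by
      by_contra h
      have : e ∈ g.cyclicEdges := h
      rw [hcyc] at this
      exact this
    have key : ∀ e, ∀ k, r k = e → r k ∉ g.toQ.edgeSet → False := by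
      intro e
      induction hacc e with
      | intro e _ ih =>
        rintro k rfl hk
        have hk1 : ∃ x, x ∉ Q ∧ r (k + 1) = g.toQ.next x :=
          (h3 k).resolve_left fun ⟨x, hx, h⟩ => hk (h ▸ RootedForest.next_mem_edgeSet hx)
        obtain ⟨hyQ, hry, hsy⟩ := hT _ hk1
        rw [← h1 k] at hyQ hry hsy
        obtain ⟨hyP, hyrev⟩ := hQP _ hyQ
        -- Until the next edge outside the grove, the path stays on the path through `r (k + 1)`.
        have hfollow : ∀ n i, g.toQ.rank (G.src (r i)) = n →
            g.toQ.parent (G.tgt (r k)) ∈ g.toQ.subtree (G.src (r i)) → False := by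
          intro n
          induction n using Nat.strong_induction_on with
          | _ n ihn =>
            rintro i rfl hmem
            by_cases hi : ∃ x, x ∉ Q ∧ r i = g.toQ.next x
            · refine ihn _ (hrank i hi) (i + 1) rfl ?_
              rw [(hT i hi).2.2]
              exact RootedForest.mem_subtree_parent hmem
            · have hiB := hB i hi
              refine ih (r i) ⟨hk, hiB, G.tgt (r k), g.toQ.parent (G.tgt (r k)), hyQ, hyP,
                Or.inr hyrev, ?_, ?_⟩ i rfl hiB
              · intro h
                exact hchord _ hk (h.2 (RootedForest.mem_subtree_self _))
              · intro h
                have h4 := RootedForest.mem_subtree_symm hinv'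
                  (h.1 (RootedForest.mem_subtree_symm hinv hmem))
                rcases RootedForest.mem_subtree_or_mem_subtree hmem h4 with h5 | h5
                · exact hchord _ hiB h5
                · exact hchord' _ hiB h5
        refine hfollow _ (k + 1 + 1) rfl ?_
        rw [hsy]
        exact RootedForest.mem_subtree_self _
    have hdesc : ∀ n i, g.toQ.rank (G.src (r i)) = n → False := by
      intro n
      induction n using Nat.strong_induction_on with
      | _ n ihn =>
        rintro i rfl
        by_cases hi : ∃ x, x ∉ Q ∧ r i = g.toQ.next x
        · exact ihn _ (hrank i hi) (i + 1) rfl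
        · exact key _ i rfl (hB i hi)
    exact hdesc _ 0 rfl

end Grove

end FromGrove

/-! ### Existence of groves -/

section CauchyBinet

variable {m k F : Type*} [Fintype m] [DecidableEq m] [Fintype k] [DecidableEq k] [Field F]

/-- A consequence of the Cauchy–Binet formula: if the determinant of a product does not vanish, then
neither do some pair of corresponding maximal minors of the factors. -/
theorem exists_submatrix_det_ne_zero {A : Matrix m k F} {B : Matrix k m F} (h : (A * B).det ≠ 0) :
    ∃ g : m → k, (A.submatrix id g).det ≠ 0 ∧ (B.submatrix g id).det ≠ 0 := by
  have hexp : (A * B).det = ∑ p : m → k, (A.submatrix id p).det * ∏ i, B (p i) i := by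
    simp only [Matrix.det_apply', Matrix.mul_apply, Finset.prod_univ_sum, Finset.mul_sum,
      Fintype.piFinset_univ, Matrix.submatrix_apply, id]
    rw [Finset.sum_comm]
    refine Finset.sum_congr rfl fun p _ => ?_
    rw [Finset.sum_mul]
    refine Finset.sum_congr rfl fun σ _ => ?_
    rw [Finset.prod_mul_distrib]
    ring
  by_contra hno
  push Not at hno
  refine h ?_
  rw [hexp, ← Finset.sum_fiberwise Finset.univ (fun p : m → k => Finset.univ.image p)]
  refine Finset.sum_eq_zero fun s _ => ?_
  by_cases hs : ∃ g : m → k, Injective g ∧ Finset.univ.image g = s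
  · -- The maps with image `s` are the maps `g ∘ π`.
    obtain ⟨g, hg, rfl⟩ := hs
    have hsum : ∑ π : Equiv.Perm m, (A.submatrix id (g ∘ π)).det * ∏ i, B ((g ∘ π) i) i =
        ∑ p : m → k with Finset.univ.image p = Finset.univ.image g,
          (A.submatrix id p).det * ∏ i, B (p i) i := by
      refine Finset.sum_bij (fun π _ => g ∘ π) (fun π _ => ?_) (fun π _ π' _ hπ => ?_)
        (fun p hp => ?_) (fun π _ => rfl)
      · rw [Finset.mem_filter]
        refine ⟨Finset.mem_univ _, ?_⟩
        rw [← Finset.image_image, Finset.image_univ_of_surjective π.surjective]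
      · ext i
        exact hg (congrFun hπ i)
      · have hp := (Finset.mem_filter.1 hp).2
        have h1 : ∀ i, ∃ j, g j = p i := fun i => by
          have : p i ∈ Finset.univ.image g := hp ▸ Finset.mem_image_of_mem p (Finset.mem_univ i)
          simpa using this
        choose π hπ using h1
        have hsurj : Surjective π := fun j => by
          have : g j ∈ Finset.univ.image p := hp ▸ Finset.mem_image_of_mem g (Finset.mem_univ j)
          obtain ⟨i, -, hi⟩ := Finset.mem_image.1 this
          exact ⟨i, hg ((hπ i).trans hi)⟩
        exact ⟨Equiv.ofBijective π (Finite.surjective_iff_bijective.1 hsurj), Finset.mem_univ _,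
          funext hπ⟩
    rw [← hsum]
    have hperm : ∀ π : Equiv.Perm m, (A.submatrix id (g ∘ π)).det =
        Equiv.Perm.sign π * (A.submatrix id g).det := fun π => by
      rw [← Matrix.det_permute', Matrix.submatrix_submatrix]
      rfl
    have hB : ∑ π : Equiv.Perm m, (A.submatrix id (g ∘ π)).det * ∏ i, B ((g ∘ π) i) i =
        (A.submatrix id g).det * (B.submatrix g id).det := by
      rw [Matrix.det_apply' (B.submatrix g id), Finset.mul_sum]
      refine Finset.sum_congr rfl fun π _ => ?_
      rw [hperm]
      simp only [Matrix.submatrix_apply, id, comp_apply]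
      ring
    rw [hB, mul_eq_zero]
    exact or_iff_not_imp_left.2 fun h' => hno g h'
  · refine Finset.sum_eq_zero fun p hp => ?_
    have hinj : ¬ Injective p := fun h' => hs ⟨p, h', (Finset.mem_filter.1 hp).2⟩
    simp only [Injective, not_forall] at hinj
    obtain ⟨i, j, hij, hne⟩ := hinj
    rw [Matrix.det_zero_of_column_eq hne (fun x => by simp [hij]), zero_mul]

/-- A nonzero determinant has a nonzero term in its Leibniz expansion. -/
theorem exists_perm_of_det_ne_zero {M : Matrix m m F} (h : M.det ≠ 0) :
    ∃ σ : Equiv.Perm m, ∀ i, M (σ i) i ≠ 0 := by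
  rw [Matrix.det_apply'] at h
  obtain ⟨σ, -, hσ⟩ := Finset.exists_ne_zero_of_sum_ne_zero h
  exact ⟨σ, fun i => Finset.prod_ne_zero_iff.1 (right_ne_zero_of_mul hσ) i (Finset.mem_univ i)⟩

end CauchyBinet

section Forest

variable {V : Type u} {E : Type v} {G : Multigraph V E} {R : Set V}

/-- Edges attached bijectively to the vertices outside `R` form a forest rooted at `R`, provided
that a potential vanishing on `R` and constant along these edges is zero. -/
theorem exists_rootedForest (F : Type w) [Field F] [Nonempty E] {ι : Type*} (g : ι → E)
    (τ : {x // x ∉ R} ≃ ι) (hinc : ∀ x, G.tgt (g (τ x)) = x ∨ G.src (g (τ x)) = x)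
    (hinj : ∀ h : V → F, (∀ x ∈ R, h x = 0) → (∀ i, h (G.tgt (g i)) = h (G.src (g i))) → h = 0) :
    ∃ f : RootedForest G R, f.edgeSet = {e | ∃ i, e = g i ∨ e = G.rev (g i)} := by
  classical
  have hnext : ∀ x, ∃ e : E, ∀ hx : x ∉ R,
      G.src e = x ∧ (e = g (τ ⟨x, hx⟩) ∨ e = G.rev (g (τ ⟨x, hx⟩))) := by
    intro x
    by_cases hx : x ∈ R
    · exact ⟨Classical.arbitrary E, fun h => absurd hx h⟩
    · rcases hinc ⟨x, hx⟩ with h | h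
      · exact ⟨G.rev (g (τ ⟨x, hx⟩)), fun _ => ⟨by rw [G.src_rev, h], Or.inr rfl⟩⟩
      · exact ⟨g (τ ⟨x, hx⟩), fun _ => ⟨h, Or.inl rfl⟩⟩
  choose next hnext using hnext
  let par : V → V := fun x => if x ∈ R then x else G.tgt (next x)
  have hpar : ∀ {x}, x ∉ R → par x = G.tgt (next x) := fun hx => if_neg hx
  -- The indicator function of the vertices whose path never reaches `R` vanishes.
  have hreach : ∀ x, ∃ k, par^[k] x ∈ R := by
    let N : Set V := {x | ∀ k, par^[k] x ∉ R}
    have hN : ∀ x, x ∉ R → (G.tgt (next x) ∈ N ↔ x ∈ N) := by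
      intro x hx
      rw [← hpar hx]
      constructor
      · rintro h (_ | k)
        · exact hx
        · exact h k
      · exact fun h k => h (k + 1)
    have h0 : N.indicator (fun _ => (1 : F)) = 0 := by
      refine hinj _ (fun x hx => Set.indicator_of_notMem (fun h : x ∈ N => h 0 hx) _) fun i => ?_
      obtain ⟨⟨x, hx⟩, rfl⟩ := τ.surjective i
      have h1 := hN x hx
      obtain ⟨hsrc, h2⟩ := hnext x hx
      have h3 : G.tgt (g (τ ⟨x, hx⟩)) ∈ N ↔ G.src (g (τ ⟨x, hx⟩)) ∈ N := by
        nth_rw 2 [← hsrc] at h1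
        rcases h2 with h | h
        · rwa [h] at h1
        · rw [h, G.tgt_rev, G.src_rev] at h1
          exact h1.symm
      by_cases h4 : G.src (g (τ ⟨x, hx⟩)) ∈ N
      · rw [Set.indicator_of_mem h4, Set.indicator_of_mem (h3.2 h4)]
      · rw [Set.indicator_of_notMem h4, Set.indicator_of_notMem (fun h => h4 (h3.1 h))]
    intro x
    by_contra hno
    have h1 : x ∈ N := fun k hk => hno ⟨k, hk⟩
    have := congrFun h0 x
    rw [Set.indicator_of_mem h1] at this
    exact one_ne_zero this
  refine ⟨⟨next, fun x => Nat.find (hreach x), fun x hx => (hnext x hx).1, fun x hx => ?_⟩, ?_⟩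
  · have hpos : Nat.find (hreach x) ≠ 0 := fun h => hx ((Nat.find_eq_zero (hreach x)).1 h)
    obtain ⟨k, hk⟩ := Nat.exists_eq_succ_of_ne_zero hpos
    rw [hk]
    refine Nat.lt_succ_of_le (Nat.find_min' _ ?_)
    have := Nat.find_spec (hreach x)
    rw [hk, Function.iterate_succ_apply, hpar hx] at this
    exact this
  · ext e
    constructor
    · rintro ⟨x, hx, he⟩
      refine ⟨τ ⟨x, hx⟩, ?_⟩
      change e = next x ∨ e = G.rev (next x) at he
      rcases (hnext x hx).2 with h | h <;> rw [h] at he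
      · exact he
      · rw [G.rev_rev] at he
        exact he.symm
    · rintro ⟨i, he⟩
      obtain ⟨⟨x, hx⟩, rfl⟩ := τ.surjective i
      refine ⟨x, hx, ?_⟩
      change e = next x ∨ e = G.rev (next x)
      rcases (hnext x hx).2 with h | h <;> rw [h]
      · exact he
      · rw [G.rev_rev]
        exact he.symm

/-- If every nonempty set of vertices outside `R` can be left along an edge, then breadth-first
search from `R` gives a spanning forest. -/
theorem exists_rootedForest_of_exit [Nonempty E]
    (h : ∀ U : Set V, U.Nonempty → (∀ x ∈ U, x ∉ R) → ∃ e, G.src e ∈ U ∧ G.tgt e ∉ U) :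
    Nonempty (RootedForest G R) := by
  classical
  let B : ℕ → Set V := fun n =>
    Nat.rec (motive := fun _ => Set V) R (fun _ S => {x | ∃ e, G.src e = x ∧ G.tgt e ∈ S}) n
  have hB : ∀ x, ∃ n, x ∈ B n := by
    by_contra hno
    push Not at hno
    obtain ⟨e, he, he'⟩ := h {x | ∀ n, x ∉ B n} hno fun x hx => hx 0
    simp only [Set.mem_ofPred_eq, not_forall, not_not] at he'
    obtain ⟨n, hn⟩ := he'
    exact he (n + 1) ⟨e, rfl, hn⟩
  let rank : V → ℕ := fun x => Nat.find (hB x)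
  have hnext : ∀ x, ∃ e : E, x ∉ R → G.src e = x ∧ rank (G.tgt e) < rank x := by
    intro x
    by_cases hx : x ∈ R
    · exact ⟨Classical.arbitrary E, fun h => absurd hx h⟩
    have hpos : rank x ≠ 0 := fun h => hx ((Nat.find_eq_zero (hB x)).1 h)
    obtain ⟨k, hk⟩ := Nat.exists_eq_succ_of_ne_zero hpos
    have : x ∈ B (rank x) := Nat.find_spec (hB x)
    rw [hk] at this
    obtain ⟨e, he, he'⟩ := this
    refine ⟨e, fun _ => ⟨he, ?_⟩⟩
    rw [hk]
    exact Nat.lt_succ_of_le (Nat.find_min' _ he')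
  choose next hnext using hnext
  exact ⟨⟨next, rank, fun x hx => (hnext x hx).1, fun x hx => (hnext x hx).2⟩⟩

end Forest

section GroveExistence

variable {V : Type u} {E : Type v} {F : Type w} [Field F] [Fintype E]

/-- A choice of one of the two orientations of each edge. -/
theorem exists_orientation (G : Multigraph V E) :
    ∃ O : Set E, ∀ e, e ∈ O ↔ G.rev e ∉ O := by
  refine ⟨{e | Fintype.equivFin E e < Fintype.equivFin E (G.rev e)}, fun e => ?_⟩
  have hne : Fintype.equivFin E e ≠ Fintype.equivFin E (G.rev e) :=
    fun h => G.rev_ne e ((Fintype.equivFin E).injective h).symm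
  rw [Set.mem_ofPred_eq, Set.mem_ofPred_eq, G.rev_rev, not_lt]
  exact ⟨le_of_lt, fun h => lt_of_le_of_ne h hne⟩

/-- The Laplacian, restricted to potentials vanishing on `Q` and to net currents outside `P`, is the
product of an incidence matrix and a weighted coboundary matrix. A pair of nonvanishing minors with
the same edges is a spanning forest rooted at `P` and rooted at `Q`. -/
theorem exists_grove [Fintype V] [Nonempty E] (G : Multigraph V E) {P Q : Set V}
    (hcard : P.ncard = Q.ncard) {c : E → F} (hc : IsWeight G c)
    (hinj : ∀ a : V → F, (∀ q ∈ Q, a q = 0) → (∀ p, p ∉ P → laplacian G c a p = 0) → a = 0) :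
    Nonempty (Grove G P Q) := by
  classical
  obtain ⟨O, hO⟩ := exists_orientation G
  obtain ⟨π, hπ⟩ := exists_perm_image hcard.symm
  let ε : {y // y ∉ Q} ≃ {x // x ∉ P} :=
    π.symm.subtypeEquiv fun y => not_congr (by rw [← hπ, Equiv.apply_symm_apply])
  -- `ext v` is the potential with values `v` outside `Q`, these vertices being indexed by the
  -- vertices outside `P`, and with value zero on `Q`.
  obtain ⟨ext, ext_mem, ext_notMem⟩ : ∃ ext : ({x // x ∉ P} → F) → V → F,
      (∀ v y, y ∈ Q → ext v y = 0) ∧ ∀ v y (h : y ∉ Q), ext v y = v (ε ⟨y, h⟩) :=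
    ⟨fun v y => if h : y ∈ Q then 0 else v (ε ⟨y, h⟩), fun v y h => dif_pos h,
      fun v y h => dif_neg h⟩
  have ext_sum : ∀ v y, ∑ i, ext (Pi.single i 1) y * v i = ext v y := by
    intro v y
    by_cases h : y ∈ Q
    · simp [ext_mem _ _ h]
    · simp [ext_notMem _ _ h, Pi.single_apply]
  -- `A` is the incidence matrix, one row for each vertex outside `P`; only one orientation of each
  -- edge has a nonzero column. `B` computes the current of a potential `ext v`.
  obtain ⟨A, A_apply⟩ : ∃ A : Matrix {x // x ∉ P} E F, ∀ x e, A x e = if e ∈ O then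
      (if G.tgt e = x then 1 else 0) - (if G.src e = x then 1 else 0) else 0 := ⟨_, fun _ _ => rfl⟩
  obtain ⟨B, B_apply⟩ : ∃ B : Matrix E {x // x ∉ P} F, ∀ e i, B e i =
      c e * (ext (Pi.single i 1) (G.tgt e) - ext (Pi.single i 1) (G.src e)) := ⟨_, fun _ _ => rfl⟩
  have hBv : ∀ v e, B.mulVec v e = c e * (ext v (G.tgt e) - ext v (G.src e)) := by
    intro v e
    rw [← ext_sum v, ← ext_sum v, ← Finset.sum_sub_distrib, Finset.mul_sum]
    simp only [Matrix.mulVec, dotProduct, B_apply]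
    exact Finset.sum_congr rfl fun i _ => by ring
  have hAv : ∀ b : E → F, (∀ e, b (G.rev e) = - b e) → ∀ x, A.mulVec b x = divergence G b x := by
    intro b hb x
    have h1 : A.mulVec b x = ∑ e, ((if e ∈ O then (if G.tgt e = x then b e else 0) else 0) +
        if G.rev (G.rev e) ∈ O then (if G.tgt (G.rev e) = x then b (G.rev e) else 0) else 0) := by
      simp only [Matrix.mulVec, dotProduct, A_apply, G.rev_rev, G.tgt_rev, hb]
      refine Finset.sum_congr rfl fun e _ => ?_
      split_ifs <;> ring
    rw [h1, Finset.sum_add_distrib,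
      sum_comp_rev G (fun e => if G.rev e ∈ O then (if G.tgt e = x then b e else 0) else 0),
      ← Finset.sum_add_distrib, divergence, Finset.sum_filter]
    refine Finset.sum_congr rfl fun e _ => ?_
    by_cases h : e ∈ O
    · simp [h, (hO e).1 h]
    · have h' : G.rev e ∈ O := by
        by_contra h'
        exact h ((hO e).2 h')
      simp [h, h']
  -- The product takes `v` to the net currents of `ext v` outside `P`.
  have hdet : (A * B).det ≠ 0 := by
    rw [Ne, ← Matrix.exists_mulVec_eq_zero_iff]
    rintro ⟨v, hv, h0⟩
    refine hv ?_
    have h1 : ext v = 0 := by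
      refine hinj _ (ext_mem v) fun p hp => ?_
      have h2 := congrFun h0 ⟨p, hp⟩
      rw [← Matrix.mulVec_mulVec, hAv _ fun e => ?_] at h2
      · rw [laplacian_eq_divergence]
        simp only [← hBv]
        exact h2
      · rw [hBv, hBv, hc.2, G.tgt_rev, G.src_rev]
        ring
    funext i
    have h3 := congrFun h1 (ε.symm i)
    rwa [ext_notMem _ _ (ε.symm i).2, Subtype.coe_eta, Equiv.apply_symm_apply] at h3
  obtain ⟨g, hA, hB⟩ := exists_submatrix_det_ne_zero hdet
  obtain ⟨σ, hσ⟩ := exists_perm_of_det_ne_zero hA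
  obtain ⟨ρ, hρ⟩ := exists_perm_of_det_ne_zero hB
  obtain ⟨f, hf⟩ := exists_rootedForest (G := G) (R := P) F g σ.symm (fun x => by
      have h := hσ (σ.symm x)
      rw [Matrix.submatrix_apply, Equiv.apply_symm_apply, id, A_apply] at h
      by_contra hno
      push Not at hno
      simp [hno.1, hno.2] at h)
    (fun h hP hd => by
      rw [Ne, ← Matrix.exists_vecMul_eq_zero_iff] at hA
      by_contra hne
      refine hA ⟨fun x => h x, fun h0 => hne ?_, ?_⟩
      · funext x
        by_cases hx : x ∈ P
        · exact hP x hx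
        · exact congrFun h0 ⟨x, hx⟩
      · have hsum : ∀ z : V, ∑ x : {x // x ∉ P}, h x * (if z = x then 1 else 0) = h z := by
          intro z
          by_cases hz : z ∈ P
          · rw [hP z hz]
            refine Finset.sum_eq_zero fun x _ => ?_
            rw [if_neg (fun h' : z = x => x.2 (h' ▸ hz)), mul_zero]
          · rw [Finset.sum_eq_single ⟨z, hz⟩]
            · simp
            · intro x _ hx
              rw [if_neg (fun h' => hx (Subtype.ext h'.symm)), mul_zero]
            · exact fun h' => absurd (Finset.mem_univ _) h'
        funext i
        by_cases hi : g i ∈ O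
        · simp only [Matrix.vecMul, dotProduct, Matrix.submatrix_apply, id, A_apply, if_pos hi,
            mul_sub, Finset.sum_sub_distrib, hsum, hd, sub_self, Pi.zero_apply]
        · simp [Matrix.vecMul, dotProduct, A_apply, hi])
  obtain ⟨f', hf'⟩ := exists_rootedForest (G := G) (R := Q) F g (ε.trans ρ) (fun y => by
      have h := hρ (ε y)
      rw [Matrix.submatrix_apply, id, B_apply] at h
      by_contra hno
      push Not at hno
      have h0 : ∀ z, z ≠ (y : V) → ext (Pi.single (ε y) 1) z = 0 := by
        intro z hz
        by_cases hzQ : z ∈ Q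
        · exact ext_mem _ _ hzQ
        · rw [ext_notMem _ _ hzQ, Pi.single_eq_of_ne]
          exact fun h' => hz (congrArg Subtype.val (ε.injective h'))
      exact h (by rw [← Equiv.trans_apply, h0 _ hno.1, h0 _ hno.2, sub_zero, mul_zero]))
    (fun h hQ hd => by
      rw [Ne, ← Matrix.exists_mulVec_eq_zero_iff] at hB
      have hext : ext (fun i => h (ε.symm i)) = h := by
        funext y
        by_cases hy : y ∈ Q
        · rw [ext_mem _ _ hy, hQ y hy]
        · rw [ext_notMem _ _ hy, Equiv.symm_apply_apply]
      by_contra hne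
      refine hB ⟨fun i => h (ε.symm i), fun h0 => hne ?_, ?_⟩
      · rw [← hext, h0]
        funext y
        by_cases hy : y ∈ Q
        · exact ext_mem _ _ hy
        · exact ext_notMem _ _ hy
      · funext i
        have := hBv (fun i => h (ε.symm i)) (g i)
        rw [hext, hd, sub_self, mul_zero] at this
        exact this)
  exact ⟨⟨f, f', hf.trans hf'.symm⟩⟩

end GroveExistence

/-! ### Networks without harmonic subgraphs with one boundary vertex -/

section OneBoundary

variable {V : Type u} {E : Type v} {G : BoundaryGraph V E}

/-- A set of interior vertices that cannot be left would, together with one vertex declared to be on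
the boundary, be a harmonic subgraph. -/
theorem NoOneBoundarySubgraph.exists_exit (hno : NoOneBoundarySubgraph G)
    (hne : ∀ x, x ∉ G.boundary → ∃ z, z ≠ x) {U : Set V} (hU : U.Nonempty)
    (hUb : ∀ x ∈ U, x ∉ G.boundary) : ∃ e, G.src e ∈ U ∧ G.tgt e ∉ U := by
  by_contra hexit
  push Not at hexit
  obtain ⟨x, hx⟩ := hU
  obtain ⟨z, hz⟩ := hne x (hUb x hx)
  refine hno ⟨⟨insert z U, {e | G.tgt e ∈ U}, U \ {z}, fun e he => ?_, fun e he => Or.inr he,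
    fun y hy => Or.inr hy.1, fun y hy => hUb y hy.1, ?_⟩, Or.inl ?_, z, ?_⟩
  · exact hexit (G.rev e) (by rw [G.src_rev]; exact he)
  · rintro y hy e rfl
    exact hy.1
  · exact ⟨z, Or.inl rfl, x, Or.inr hx, hz⟩
  · ext y
    simp only [Set.mem_sdiff, Set.mem_insert_iff, Set.mem_singleton_iff]
    tauto

/-- An interior vertex of degree one would be the only interior vertex of a harmonic subgraph with
one edge. -/
theorem NoOneBoundarySubgraph.two_le_degree [Finite E] (hno : NoOneBoundarySubgraph G)
    (hloop : ∀ e, G.src e ≠ G.tgt e) (hne : ∀ x, x ∉ G.boundary → ∃ z, z ≠ x) {x : V}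
    (hx : x ∉ G.boundary) : 2 ≤ G.degree x := by
  obtain ⟨e, he, -⟩ := hno.exists_exit hne (Set.singleton_nonempty x)
    (fun y hy => by rw [Set.mem_singleton_iff.1 hy]; exact hx)
  have he : G.src e = x := he
  by_contra hdeg
  have huniq : ∀ e', G.tgt e' = x → e' = G.rev e := by
    intro e' he'
    by_contra hne'
    refine hdeg ?_
    rw [Multigraph.degree, ← Set.ncard_pair hne']
    refine Set.ncard_le_ncard ?_ (Set.toFinite _)
    rintro _ (rfl | rfl)
    · exact he'
    · exact (G.tgt_rev e).trans he
  refine hno ⟨⟨{x, G.tgt e}, {e, G.rev e}, {x}, ?_, ?_, ?_, ?_, ?_⟩, Or.inr ⟨e, Or.inl rfl⟩,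
    G.tgt e, ?_⟩
  · rintro _ (rfl | rfl)
    · exact Or.inr rfl
    · exact Or.inl (G.rev_rev _)
  · rintro _ (rfl | rfl)
    · exact Or.inr rfl
    · exact Or.inl ((G.tgt_rev e).trans he)
  · exact fun y hy => Or.inl hy
  · rintro y rfl
    exact hx
  · rintro y rfl e' he'
    exact Or.inr (huniq e' he')
  · have := hloop e
    rw [he] at this
    ext y
    simp only [Set.mem_sdiff, Set.mem_insert_iff, Set.mem_singleton_iff]
    constructor
    · tauto
    · rintro rfl
      exact ⟨Or.inr rfl, this.symm⟩

end OneBoundary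

section Dirichlet

variable {V : Type u} {E : Type v} {F : Type w} [Field F] [Fintype E]

theorem laplacian_add_weight (G : Multigraph V E) (c c' : E → F) (a : V → F) (x : V) :
    laplacian G (c + c') a x = laplacian G c a x + laplacian G c' a x := by
  simp only [laplacian, Pi.add_apply, add_mul, Finset.sum_add_distrib]

theorem laplacian_const_weight (G : Multigraph V E) (t : F) (a : V → F) (x : V) :
    laplacian G (fun _ => t) a x = t * laplacian G (fun _ => 1) a x := by
  simp only [laplacian, Finset.mul_sum, one_mul]

/-- On a forest, the Dirichlet problem with unit weights is nonsingular: a harmonic potential is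
constant along the edges, starting from the leaves. -/
theorem RootedForest.eq_zero_of_laplacian_eq_zero [Finite V] {G : Multigraph V E} {R : Set V}
    (f : RootedForest G R) {a : V → F} (haR : ∀ x ∈ R, a x = 0)
    (ha : ∀ x, x ∉ R → laplacian G (f.edgeSet.indicator fun _ => 1) a x = 0) : a = 0 := by
  classical
  obtain ⟨N, hN⟩ := (Set.finite_range f.rank).bddAbove
  have hrank : ∀ x, f.rank x ≤ N := fun x => hN ⟨x, rfl⟩
  have hconst : ∀ k x, x ∉ R → N - f.rank x = k → a (G.tgt (f.next x)) = a x := by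
    intro k
    induction k using Nat.strong_induction_on with
    | _ k ih =>
      intro x hx hk
      have h := ha x hx
      rw [laplacian, Finset.sum_eq_single (G.rev (f.next x))] at h
      · rw [Set.indicator_of_mem (f.rev_mem_edgeSet (f.next_mem_edgeSet hx)), one_mul, G.tgt_rev,
          G.src_rev, f.src_next x hx, sub_eq_zero] at h
        exact h.symm
      · intro e he hne
        have he := (Finset.mem_filter.1 he).2
        by_cases hmem : e ∈ f.edgeSet
        · obtain ⟨z, hz, rfl | rfl⟩ := hmem
          · have hlt := f.rank_lt z hz
            rw [he] at hlt
            have h1 := hrank z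
            rw [ih (N - f.rank z) (by omega) z hz rfl, f.src_next z hz, sub_self, mul_zero]
          · rw [G.tgt_rev, f.src_next z hz] at he
            exact absurd (by rw [he]) hne
        · rw [Set.indicator_of_notMem hmem, zero_mul]
      · intro h'
        exact (h' (by simp [G.tgt_rev, f.src_next x hx])).elim
  have hzero : ∀ k x, f.rank x = k → a x = 0 := by
    intro k
    induction k using Nat.strong_induction_on with
    | _ k ih =>
      intro x hk
      by_cases hx : x ∈ R
      · exact haR x hx
      · rw [← hconst _ x hx rfl]
        exact ih _ (hk ▸ f.rank_lt x hx) _ rfl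
  exact funext fun x => hzero _ x rfl

/-- If the graph has a spanning forest rooted at `R`, then the Dirichlet problem is nonsingular for
some edge weights: its determinant is a polynomial in the edge weights that does not vanish
identically. -/
theorem RootedForest.exists_weight_dirichlet [Fintype V] [Infinite F] {G : Multigraph V E}
    {R : Set V} (f : RootedForest G R) :
    ∃ c : E → F, IsWeight G c ∧ ∀ a : V → F, (∀ x ∈ R, a x = 0) →
      (∀ x, x ∉ R → laplacian G c a x = 0) → a = 0 := by
  classical
  let c₀ : E → F := f.edgeSet.indicator fun _ => 1
  have hmixed : ∀ c : E → F, (∀ a : V → F, (∀ x ∈ R, a x = 0) →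
      (∀ x, x ∉ R → laplacian G c a x = 0) → a = 0) ↔
        (LinearMap.toMatrix' (mixedOperator G c R 1)).det ≠ 0 := by
    intro c
    rw [← injective_iff_det_toMatrix'_ne_zero]
    refine forall_congr' fun a => ⟨fun h h0 => h (fun x hx => ?_) fun x hx => ?_,
      fun h h1 h2 => h (funext fun x => ?_)⟩
    · rw [← Equiv.Perm.one_apply x, ← mixedOperator_apply_mem G c 1 a hx, h0]
      rfl
    · rw [← mixedOperator_apply_notMem G c 1 a hx, h0]
      rfl
    · by_cases hx : x ∈ R
      · rw [mixedOperator_apply_mem G c 1 a hx]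
        exact h1 x hx
      · rw [mixedOperator_apply_notMem G c 1 a hx]
        exact h2 x hx
  obtain ⟨M, hMxy⟩ : ∃ M : Matrix V V (Polynomial F), ∀ x y, M x y =
      Polynomial.C (mixedOperator G c₀ R 1 (Pi.single y 1) x) + Polynomial.X *
        Polynomial.C (if x ∈ R then 0 else laplacian G (fun _ => 1) (Pi.single y 1) x) :=
    ⟨_, fun _ _ => rfl⟩
  have hM : ∀ t : F, M.det.eval t =
      (LinearMap.toMatrix' (mixedOperator G (c₀ + fun _ => t) R 1)).det := by
    intro t
    rw [← Polynomial.coe_evalRingHom, RingHom.map_det]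
    congr 1
    ext x y
    rw [LinearMap.toMatrix'_apply]
    simp only [RingHom.mapMatrix_apply, Matrix.map_apply, hMxy, Polynomial.coe_evalRingHom,
      Polynomial.eval_add, Polynomial.eval_C, Polynomial.eval_mul, Polynomial.eval_X]
    by_cases hx : x ∈ R
    · rw [mixedOperator_apply_mem _ _ _ _ hx, mixedOperator_apply_mem _ _ _ _ hx, if_pos hx,
        mul_zero, add_zero]
    · rw [mixedOperator_apply_notMem _ _ _ _ hx, mixedOperator_apply_notMem _ _ _ _ hx, if_neg hx,
        laplacian_add_weight, laplacian_const_weight G t]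
  have hM0 : M.det ≠ 0 := by
    intro h
    have h1 := hM 0
    rw [h, Polynomial.eval_zero] at h1
    refine (hmixed _).1 (fun a haR ha => f.eq_zero_of_laplacian_eq_zero haR ?_) h1.symm
    have h2 : (c₀ + fun _ => (0 : F)) = c₀ := add_zero c₀
    rw [h2] at ha
    exact ha
  -- The weights `c₀ + t` take the values `t` and `1 + t`, which the factors `X` and `X + 1` keep
  -- different from zero.
  have hp : M.det * (Polynomial.X * (Polynomial.X + 1)) ≠ 0 := by
    refine mul_ne_zero hM0 (mul_ne_zero Polynomial.X_ne_zero ?_)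
    simpa using Polynomial.X_add_C_ne_zero (1 : F)
  obtain ⟨t, ht⟩ := Infinite.exists_notMem_finset
    (M.det * (Polynomial.X * (Polynomial.X + 1))).roots.toFinset
  rw [Multiset.mem_toFinset, Polynomial.mem_roots hp, Polynomial.IsRoot] at ht
  simp only [Polynomial.eval_mul, Polynomial.eval_X, Polynomial.eval_add, Polynomial.eval_one,
    mul_eq_zero, not_or, hM] at ht
  refine ⟨c₀ + fun _ => t, ⟨fun e => ?_, fun e => ?_⟩, (hmixed _).2 ht.1⟩
  · by_cases he : e ∈ f.edgeSet
    · simpa [c₀, he, add_comm] using ht.2.2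
    · simpa [c₀, he] using ht.2.1
  · have : G.rev e ∈ f.edgeSet ↔ e ∈ f.edgeSet :=
      ⟨fun h => by simpa [G.rev_rev] using f.rev_mem_edgeSet h, f.rev_mem_edgeSet⟩
    simp [c₀, Set.indicator_apply, this]

theorem NoOneBoundarySubgraph.exists_weight_dirichlet [Fintype V] [Infinite F]
    {G : BoundaryGraph V E} (hno : NoOneBoundarySubgraph G)
    (hne : ∀ x, x ∉ G.boundary → ∃ z, z ≠ x) :
    ∃ c : E → F, IsWeight G.toMultigraph c ∧ ∀ a : V → F, (∀ x ∈ G.boundary, a x = 0) →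
      (∀ x, x ∉ G.boundary → laplacian G.toMultigraph c a x = 0) → a = 0 := by
  rcases isEmpty_or_nonempty E with hE | hE
  · refine ⟨1, ⟨fun e => one_ne_zero, fun e => rfl⟩, fun a ha _ => funext fun x => ha x ?_⟩
    by_contra hx
    obtain ⟨e, -⟩ := hno.exists_exit hne (Set.singleton_nonempty x)
      (fun y hy => by rw [Set.mem_singleton_iff.1 hy]; exact hx)
    exact hE.elim e
  · obtain ⟨f⟩ := exists_rootedForest_of_exit (G := G.toMultigraph) (R := G.boundary)
      fun U hU hUb => hno.exists_exit hne hU hUb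
    exact f.exists_weight_dirichlet

end Dirichlet

/-! ### Scaffolds from the mixed boundary value problem -/

section Converse

variable {V : Type u} {E : Type v} {F : Type w} [Field F] [Fintype V] [Fintype E]

/-- A nonsingular mixed problem provides a grove, which is a scaffold if no chain of exchanges can
be continued forever. -/
theorem exists_isDirectedScaffold {G : Multigraph V E} {P Q : Set V}
    (hloop : ∀ e, G.src e ≠ G.tgt e) (hcard : P.ncard = Q.ncard)
    (hdeg : ∀ x, x ∉ P → x ∉ Q → 2 ≤ G.degree x) {c : E → F} (hc : IsWeight G c)
    (hinj : ∀ a : V → F, (∀ q ∈ Q, a q = 0) → (∀ p, p ∉ P → laplacian G c a p = 0) → a = 0)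
    (hcyc : ∀ g : Grove G P Q, g.cyclicEdges = ∅) : ∃ T, IsDirectedScaffold G P Q T := by
  rcases isEmpty_or_nonempty E with hE | hE
  · have hQ : Q = Set.univ := by
      rw [Set.eq_univ_iff_forall]
      intro x
      by_contra hx
      have := congrFun (hinj (Qᶜ.indicator fun _ => 1)
        (fun q hq => Set.indicator_of_notMem (fun h : q ∈ Qᶜ => h hq) _)
        fun p _ => by simp [laplacian]) x
      rw [Set.indicator_of_mem hx] at this
      exact one_ne_zero this
    have hP : P = Set.univ :=
      Set.eq_of_subset_of_ncard_le (Set.subset_univ P) (by rw [hcard, hQ]) (Set.toFinite _)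
    subst hP hQ
    exact ⟨∅, by simp, by simp, by simp, by simp, by simp, fun ⟨r, _⟩ => hE.elim (r 0)⟩
  · obtain ⟨g⟩ := exists_grove G hcard hc hinj
    exact ⟨_, g.isDirectedScaffold hloop hdeg (hcyc g)⟩

theorem MixedProblemSolvable.exists_isDirectedScaffold [Infinite F] {G : BoundaryGraph V E}
    {P Q : Set V} (hloop : ∀ e, G.src e ≠ G.tgt e) (hb : G.boundary = P ∪ Q)
    (hcard : P.ncard = Q.ncard) (h : MixedProblemSolvable F G P Q)
    (hdeg : ∀ x, x ∉ G.boundary → 2 ≤ G.degree x) :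
    ∃ T, IsDirectedScaffold G.toMultigraph P Q T := by
  have hdeg' : ∀ x, x ∉ P → x ∉ Q → 2 ≤ G.degree x := fun x hP hQ => hdeg x (by
    rw [hb]
    exact fun h => h.elim hP hQ)
  exact ElecNet.exists_isDirectedScaffold (c := fun _ => (1 : F)) hloop hcard hdeg'
    ⟨fun _ => one_ne_zero, fun _ => rfl⟩
    (fun a => h.eq_zero hb ⟨fun _ => one_ne_zero, fun _ => rfl⟩)
    (fun g => Grove.cyclicEdges_eq_empty_of_injective fun c hc a => h.eq_zero hb hc)

/-- Full rank says that solutions of the homogeneous mixed problem have zero boundary data. Weights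
for which the Dirichlet problem is nonsingular then give a grove. -/
theorem FullRank.exists_isDirectedScaffold [Infinite F] {G : BoundaryGraph V E}
    {P Q : Set V} {n : ℕ} (hloop : ∀ e, G.src e ≠ G.tgt e) (hb : G.boundary = P ∪ Q)
    (hP : P.ncard = n) (hQ : Q.ncard = n) (hV : n = 0 → Fintype.card V ≠ 1)
    (h : FullRank F G P Q n) (hno : NoOneBoundarySubgraph G) :
    ∃ T, IsDirectedScaffold G.toMultigraph P Q T := by
  have hne : ∀ x, x ∉ G.boundary → ∃ z, z ≠ x := by
    intro x hx
    by_contra hall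
    push Not at hall
    refine hV ?_ (Fintype.card_eq_one_iff.2 ⟨x, hall⟩)
    rw [← hP, Set.ncard_eq_zero, Set.eq_empty_iff_forall_notMem]
    intro p hp
    rw [hb] at hx
    exact hx (Or.inl (hall p ▸ hp))
  obtain ⟨c, hc, hdir⟩ := hno.exists_weight_dirichlet (F := F) hne
  refine ElecNet.exists_isDirectedScaffold hloop (hP.trans hQ.symm)
    (fun x hxP hxQ => hno.two_le_degree hloop hne ?_) hc (fun a haQ haP => hdir a ?_ ?_)
    (fun g => Grove.cyclicEdges_eq_empty_of_noOneBoundarySubgraph hb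
      (fun c hc a haQ haP => h.eq_zero hP hc haQ haP) hno)
  · rw [hb]
    exact fun h => h.elim hxP hxQ
  · rw [hb]
    rintro x (hx | hx)
    · exact (h.eq_zero hP hc haQ haP).1 x hx
    · exact haQ x hx
  · exact fun x _ => (h.eq_zero hP hc haQ haP).2 x

end Converse

end ElecNet

theorem mainTheorem9 {V : Type u} {E : Type v} [Fintype V] [Fintype E]
    (G : ElecNet.BoundaryGraph V E) (hloop : ∀ e, G.src e ≠ G.tgt e)
    (P Q : Set V) (n : ℕ) (hbdry : G.boundary = P ∪ Q) (hP : P.ncard = n) (hQ : Q.ncard = n)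
    (hV : n = 0 → Fintype.card V ≠ 1) :
    (List.TFAE [
      ElecNet.HasUniqueFullConnection G P Q,
      ∃ S : Set E, ElecNet.IsScaffold G S ∧ (G.src '' S)ᶜ = P ∧ (G.tgt '' S)ᶜ = Q,
      (G.toMultigraph.inOut P Q).HasFactorization12,
      (∀ (F : Type w) [Field F], ElecNet.FullRank F G P Q n) ∧ ElecNet.NoOneBoundarySubgraph G,
      (∀ (F : Type w) [Field F], ElecNet.MixedProblemSolvable F G P Q) ∧
        ∀ x, x ∉ G.boundary → 2 ≤ G.degree x]) ∧
    ∀ (F : Type w) [Field F] [Infinite F], List.TFAE [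
      ElecNet.HasUniqueFullConnection G P Q,
      ∃ S : Set E, ElecNet.IsScaffold G S ∧ (G.src '' S)ᶜ = P ∧ (G.tgt '' S)ᶜ = Q,
      (G.toMultigraph.inOut P Q).HasFactorization12,
      ElecNet.FullRank F G P Q n ∧ ElecNet.NoOneBoundarySubgraph G,
      ElecNet.MixedProblemSolvable F G P Q ∧ ∀ x, x ∉ G.boundary → 2 ≤ G.degree x] := by
  have hcard : P.ncard = Q.ncard := hP.trans hQ.symm
  have hbc := ElecNet.exists_isScaffold_iff G hbdry
  have hc := ElecNet.hasFactorization12_inOut_iff G.toMultigraph P Q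
  have ha : (∃ T, ElecNet.IsDirectedScaffold G.toMultigraph P Q T) →
      ElecNet.HasUniqueFullConnection G P Q := fun ⟨_, hT⟩ => hT.hasUniqueFullConnection hcard
  have he : ∀ (F : Type w) [Field F], ElecNet.HasUniqueFullConnection G P Q →
      ElecNet.MixedProblemSolvable F G P Q :=
    fun F _ h => h.mixedProblemSolvable hloop hbdry hcard
  have hdeg : ElecNet.HasUniqueFullConnection G P Q → ∀ x, x ∉ G.boundary → 2 ≤ G.degree x :=
    fun h x hx => h.two_le_degree hbdry hx
  have hT : ElecNet.HasUniqueFullConnection G P Q →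
      ∃ T, ElecNet.IsDirectedScaffold G.toMultigraph P Q T := fun h =>
    (he (ULift.{w} ℚ) h).exists_isDirectedScaffold hloop hbdry hcard (hdeg h)
  have hno : ElecNet.HasUniqueFullConnection G P Q → ElecNet.NoOneBoundarySubgraph G := fun h =>
    let ⟨_, hS⟩ := hT h
    hS.noOneBoundarySubgraph hbdry hloop
  have hd : ∀ (F : Type w) [Field F], ElecNet.HasUniqueFullConnection G P Q →
      ElecNet.FullRank F G P Q n := fun F _ h => (he F h).fullRank hbdry hP
  have hab : ElecNet.HasUniqueFullConnection G P Q →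
      ∃ S : Set E, ElecNet.IsScaffold G S ∧ (G.src '' S)ᶜ = P ∧ (G.tgt '' S)ᶜ = Q :=
    fun h => hbc.2 (hT h)
  constructor
  · tfae_have 1 → 2 := hab
    tfae_have 2 ↔ 3 := hbc.trans hc.symm
    tfae_have 2 → 1 := fun h => ha (hbc.1 h)
    tfae_have 1 → 4 := fun h => ⟨fun F _ => hd F h, hno h⟩
    tfae_have 1 → 5 := fun h => ⟨fun F _ => he F h, hdeg h⟩
    tfae_have 4 → 1 := fun h =>
      ha ((h.1 (ULift.{w} ℚ)).exists_isDirectedScaffold hloop hbdry hP hQ hV h.2)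
    tfae_have 5 → 1 := fun h =>
      ha ((h.1 (ULift.{w} ℚ)).exists_isDirectedScaffold hloop hbdry hcard h.2)
    tfae_finish
  · intro F _ _
    tfae_have 1 → 2 := hab
    tfae_have 2 ↔ 3 := hbc.trans hc.symm
    tfae_have 2 → 1 := fun h => ha (hbc.1 h)
    tfae_have 1 → 4 := fun h => ⟨hd F h, hno h⟩
    tfae_have 1 → 5 := fun h => ⟨he F h, hdeg h⟩
    tfae_have 4 → 1 := fun h =>
      ha (h.1.exists_isDirectedScaffold hloop hbdry hP hQ hV h.2)
    tfae_have 5 → 1 := fun h =>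
      ha (h.1.exists_isDirectedScaffold hloop hbdry hcard h.2)
    tfae_finish
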